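/- Let $S=\{0,1,2,\dots\}$ and let $U$ be a nonempty compact metric space with set $\mathcal P(U)$ of Borel probability measures. For $i\neq j$ in $S$ let $\lambda_{ij}:[0,\infty)\times U\to[0,\infty)$, let $c:S\times[0,\infty)\times U\to[0,\infty)$, and let $\alpha>0$. Write $\lambda_i=\sum_{k\neq i}\lambda_{ik}$, and for $\nu\in\mathcal P(U)$ write $\tilde\lambda_{ij}(y,\nu)=\int_U\lambda_{ij}(y,u)\,\nu(du)$, $\tilde c(i,y,\nu)=\int_U c(i,y,u)\,\nu(du)$. Assume: (A1) $\sup_{i,y,u}\lambda_i(y,u)<\infty$; (A2) $\inf_{i,y,u}\lambda_i(y,u)>0$; (A3) each $\lambda_{ij}$ ($j\ne i$) is jointly continuous in $(y,u)$ and, for each $i$, the series $\sum_{j\neq i}\lambda_{ij}(y,u)$ converges uniformly on $[0,\infty)\times U$; (A4) $c$ is bounded, and $c(i,y,u)$ is continuous in $y$ and continuous in $u$. **Controlled process.** Let $N$ be a Poisson random measure on $[0,\infty)\times\mathbb R$ with intensity $ds\,dz$ on a probability space $(\Omega,\mathcal F,\mathbb P)$. For fixed $(i,y,\nu)$ let $\Lambda_{ij}(y,\nu)$,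 $j\neq i$, be the consecutive left-closed, right-open intervals starting at $0$, in increasing order of $j$, of lengths $\tilde\lambda_{ij}(y,\nu)$. Put $h(i,y,\nu,z)=j-i$ and $g(i,y,\nu,z)=y$ if $z\in\Lambda_{ij}(y,\nu)$ for some $j\ne i$, and $h=g=0$ if there is no such $j$. Let $\mathcal U$ be the set of measurable $\mathbf u:S\times[0,\infty)\to\mathcal P(U)$. Given $\mathbf u\in\mathcal U$ and $i\in S$, let $(X,Y)$ be a strong solution (càdlàg, adapted to the completed filtration of $N$), with values in $S\times[0,\infty)$, of $$X_t=i+\int_{(0,t]}\int_{\mathbb R}h(X_{s-},Y_{s-},\mathbf u(X_{s-},Y_{s-}),z)\,N(ds,dz),$$ $$Y_t=t-\int_{(0,t]}\int_{\mathbb R}g(X_{s-},Y_{s-},\mathbf u(X_{s-},Y_{s-}),z)\,N(ds,dz),$$ and set $$J^{\mathbf u}_\alpha(i)=\mathbb E\int_0^\infty e^{-\alpha t}\,\tilde c(X_t,Y_t,\mathbf u(X_t,Y_t))\,dt,\qquad V_\alpha(i)=\inf_{\mathbf u\in\mathcal U}J^{\mathbf u}_\alpha(i).$$ **Optimality equation.**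 Let $\mathcal R$ be the set of measurable $r:[0,\infty)\to\mathcal P(U)$, $y\mapsto r_y$. For $r\in\mathcal R$ put $G_i^r(y)=\exp\bigl(-\int_0^y\int_U\lambda_i(s,u)\,r_s(du)\,ds\bigr)$, $$f(i,r)=\int_0^\infty e^{-\alpha y}G_i^r(y)\,\tilde c(i,y,r_y)\,dy,\qquad \hat p_{ij}(r)=\int_0^\infty G_i^r(y)\,\tilde\lambda_{ij}(y,r_y)\,dy,$$ $$F^r_{ij}(t)=\frac1{\hat p_{ij}(r)}\int_0^t G_i^r(y)\,\tilde\lambda_{ij}(y,r_y)\,dy$$ (terms with $\hat p_{ij}(r)=0$ are read as $0$ below), and consider, for functions $\phi:S\to\mathbb R$, $$\phi(i)=\min_{r\in\mathcal R}\Bigl[f(i,r)+\sum_{j\neq i}\hat p_{ij}(r)\int_0^\infty e^{-\alpha t}\phi(j)\,dF^r_{ij}(t)\Bigr]\quad(i\in S).\tag{1}$$ **Theorem.** For every $\mathbf u\in\mathcal U$ and $i\in S$ the process $(X,Y)$ exists and $J_\alpha^{\mathbf u}(i)$ does not depend on the choice of the solution. The value function $V_\alpha$ is bounded, it solves (1),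 the minimum being attained for every $i$, and it is the only bounded solution of (1). Moreover, whenever $r_i^*\in\mathcal R$ is, for each $i\in S$, a minimiser of the right-hand side of (1) with $\phi=V_\alpha$, the control $\mathbf u^*(i,y)=(r_i^*)_y$ is optimal: $J_\alpha^{\mathbf u^*}(i)=V_\alpha(i)$ for all $i\in S$. -/

import Mathlib

open MeasureTheory ProbabilityTheory Set Filter Topology
open scoped ENNReal NNReal

namespace AgeControl

/-! ### Poisson random measures -/

/-- `N` is a Poisson random measure on `E` with intensity `μ`: it takes values in
`{0, 1, 2, …, ∞}`, the mass of a measurable set of finite intensity is Poisson distributed with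
that intensity as its mean, and the masses of disjoint measurable sets are independent. -/
structure IsPoissonRandomMeasure {Ω E : Type*} [MeasurableSpace Ω] [MeasurableSpace E]
    (P : Measure Ω) (N : Ω → Measure E) (μ : Measure E) : Prop where
  measurable : Measurable N
  integer_valued : ∀ ω, ∀ B, MeasurableSet B → ∃ n : ℕ∞, N ω B = (n : ℝ≥0∞)
  law : ∀ B, MeasurableSet B → μ B ≠ ∞ →
    P.map (fun ω => N ω B) =
      (poissonMeasure (μ B).toNNReal).map (fun n : ℕ => (n : ℝ≥0∞))
  indep : ∀ (n : ℕ) (B : Fin n → Set E), (∀ k, MeasurableSet (B k)) →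
    Pairwise (fun k l => Disjoint (B k) (B l)) →
    iIndepFun (fun k ω => N ω (B k)) P

/-- The measure `ds × dz` on `[0, ∞) × ℝ`, regarded as a measure on `ℝ × ℝ`. -/
noncomputable def noiseIntensity : Measure (ℝ × ℝ) :=
  ((volume : Measure ℝ).restrict (Ici 0)).prod volume

/-- The history of the noise up to time `t`: the `σ`-algebra generated by the restriction of `N`
to `(-∞, t] × ℝ`, that is, by the masses of the measurable subsets of this strip. -/
@[reducible]
noncomputable def noiseHistory {Ω : Type*} (N : Ω → Measure (ℝ × ℝ)) (t : ℝ) : MeasurableSpace Ω :=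
  MeasurableSpace.comap (fun ω => (N ω).restrict (Iic t ×ˢ univ)) inferInstance

section Model

variable {U : Type*} [MeasurableSpace U]

/-! ### Rates, costs and controls

Ages and times are real numbers; only values at nonnegative ages and times are ever used. -/

/-- Total jump rate `-λ_ii(y, u) = ∑_{k ≠ i} λ_ik(y, u)`. -/
noncomputable def exitRate (lam : ℕ → ℕ → ℝ → U → ℝ) (i : ℕ) (y : ℝ) (u : U) : ℝ :=
  ∑' k : {k : ℕ // k ≠ i}, lam i k y u

/-- Relaxed jump rate: the average of `λ_ij(y, ·)` under `ν`. -/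
noncomputable def relaxedRate (lam : ℕ → ℕ → ℝ → U → ℝ) (i j : ℕ) (y : ℝ)
    (ν : ProbabilityMeasure U) : ℝ :=
  ∫ u, lam i j y u ∂(ν : Measure U)

/-- Relaxed running cost: the average of `c(i, y, ·)` under `ν`. -/
noncomputable def relaxedCost (c : ℕ → ℝ → U → ℝ) (i : ℕ) (y : ℝ)
    (ν : ProbabilityMeasure U) : ℝ :=
  ∫ u, c i y u ∂(ν : Measure U)

variable (U) in
/-- Admissible (stationary, relaxed) controls: measurable functions of the state and the age. -/
def Control : Type _ :=
  {u : ℕ → ℝ → ProbabilityMeasure U // Measurable (Function.uncurry u)}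

variable (U) in
/-- The set `R` of measurable functions `r` from ages to probability measures on `U`. -/
def Action : Type _ :=
  {r : ℝ → ProbabilityMeasure U // Measurable r}

/-- The control `u(i, y) = r_i(y)` given by a choice of `r_i` in every state `i`. -/
def controlOfActions (r : ℕ → Action U) : Control U :=
  ⟨fun i y => (r i).1 y, measurable_from_prod_countable_right fun i => (r i).2⟩

/-! ### The controlled process -/

/-- For fixed `i`, the consecutive left-closed right-open intervals `Λ_ij(y, ν)`, `j ≠ i`,
starting at `0` and of length `relaxedRate lam i j y ν`. -/
noncomputable def jumpInterval (lam : ℕ → ℕ → ℝ → U → ℝ) (i j : ℕ) (y : ℝ)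
    (ν : ProbabilityMeasure U) : Set ℝ :=
  Ico (∑ k ∈ (Finset.range j).filter (· ≠ i), relaxedRate lam i k y ν)
    ((∑ k ∈ (Finset.range j).filter (· ≠ i), relaxedRate lam i k y ν) + relaxedRate lam i j y ν)

/-- `j - i` if `z ∈ Λ_ij(y, ν)` for some (unique) `j ≠ i`, and `0` otherwise. -/
noncomputable def stateJump (lam : ℕ → ℕ → ℝ → U → ℝ) (i : ℕ) (y : ℝ)
    (ν : ProbabilityMeasure U) (z : ℝ) : ℝ :=
  ∑' j : {j : ℕ // j ≠ i}, (jumpInterval lam i j y ν).indicator (fun _ => (j : ℝ) - (i : ℝ)) z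

/-- `y` if `z` lies in one of the intervals `Λ_ij(y, ν)`, `j ≠ i`, and `0` otherwise. -/
noncomputable def ageJump (lam : ℕ → ℕ → ℝ → U → ℝ) (i : ℕ) (y : ℝ)
    (ν : ProbabilityMeasure U) (z : ℝ) : ℝ :=
  (⋃ j : {j : ℕ // j ≠ i}, jumpInterval lam i j y ν).indicator (fun _ => y) z

/-- `stateJump` evaluated along the left limits of a path `(x, a)` of state and age. -/
noncomputable def stateJumpAlong (lam : ℕ → ℕ → ℝ → U → ℝ) (u : Control U)
    (x : ℝ → ℕ) (a : ℝ → ℝ) (p : ℝ × ℝ) : ℝ :=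
  stateJump lam (Function.leftLim x p.1) (Function.leftLim a p.1)
    (u.1 (Function.leftLim x p.1) (Function.leftLim a p.1)) p.2

/-- `ageJump` evaluated along the left limits of a path `(x, a)` of state and age. -/
noncomputable def ageJumpAlong (lam : ℕ → ℕ → ℝ → U → ℝ) (u : Control U)
    (x : ℝ → ℕ) (a : ℝ → ℝ) (p : ℝ × ℝ) : ℝ :=
  ageJump lam (Function.leftLim x p.1) (Function.leftLim a p.1)
    (u.1 (Function.leftLim x p.1) (Function.leftLim a p.1)) p.2

/-- `x` is right-continuous on `[0, ∞)` and has left limits on `(0, ∞)`. -/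
def IsCadlag {F : Type*} [TopologicalSpace F] (x : ℝ → F) : Prop :=
  (∀ t, 0 ≤ t → ContinuousWithinAt x (Ici t) t) ∧
    ∀ t, 0 < t → ∃ l, Tendsto x (𝓝[<] t) (𝓝 l)

variable {Ω : Type*} [MeasurableSpace Ω]

/-- `(X, Y)` is a strong solution, started in state `i` with age `y`, of
`X_t = X_0 + ∫_{(0,t]} ∫ h(X_{s-}, Y_{s-}, u(X_{s-}, Y_{s-}), z) N(ds, dz)`,
`Y_t = Y_0 + t - ∫_{(0,t]} ∫ g(X_{s-}, Y_{s-}, u(X_{s-}, Y_{s-}), z) N(ds, dz)`: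
it is adapted to the (`P`-completed) history of `N`, almost all its paths are càdlàg, and almost
surely the integrals converge and the equations hold at all times `t ≥ 0`. -/
structure IsSolution (P : Measure Ω) (N : Ω → Measure (ℝ × ℝ)) (lam : ℕ → ℕ → ℝ → U → ℝ)
    (u : Control U) (i : ℕ) (y : ℝ) (X : ℝ → Ω → ℕ) (Y : ℝ → Ω → ℝ) : Prop where
  state_adapted : ∀ t, 0 ≤ t → ∃ X' : Ω → ℕ, Measurable[noiseHistory N t] X' ∧ X t =ᵐ[P] X'
  age_adapted : ∀ t, 0 ≤ t → ∃ Y' : Ω → ℝ, Measurable[noiseHistory N t] Y' ∧ Y t =ᵐ[P] Y'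
  state_cadlag : ∀ᵐ ω ∂P, IsCadlag (fun t => X t ω)
  age_cadlag : ∀ᵐ ω ∂P, IsCadlag (fun t => Y t ω)
  state_equation : ∀ᵐ ω ∂P, ∀ t, 0 ≤ t →
    IntegrableOn (stateJumpAlong lam u (fun s => X s ω) (fun s => Y s ω))
      (Ioc 0 t ×ˢ univ) (N ω) ∧
    (X t ω : ℝ) = i +
      ∫ p in Ioc 0 t ×ˢ univ, stateJumpAlong lam u (fun s => X s ω) (fun s => Y s ω) p ∂(N ω)
  age_equation : ∀ᵐ ω ∂P, ∀ t, 0 ≤ t →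
    IntegrableOn (ageJumpAlong lam u (fun s => X s ω) (fun s => Y s ω))
      (Ioc 0 t ×ˢ univ) (N ω) ∧
    Y t ω = y + t -
      ∫ p in Ioc 0 t ×ˢ univ, ageJumpAlong lam u (fun s => X s ω) (fun s => Y s ω) p ∂(N ω)

/-- `E ∫_0^∞ e^{-αt} c̃(X_t, Y_t, u(X_t, Y_t)) dt` for given processes `X`, `Y`. -/
noncomputable def processCost (P : Measure Ω) (c : ℕ → ℝ → U → ℝ) (α : ℝ) (u : Control U)
    (X : ℝ → Ω → ℕ) (Y : ℝ → Ω → ℝ) : ℝ :=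
  ∫ ω, (∫ t in Ioi (0 : ℝ),
    Real.exp (-α * t) * relaxedCost c (X t ω) (Y t ω) (u.1 (X t ω) (Y t ω))) ∂P

open Classical in
/-- The discounted cost `J^u_α(i)`: the cost of a solution started from state `i` with age `0`.
(The main theorem contains that solutions exist and all have this cost.) -/
noncomputable def discountedCost (P : Measure Ω) (N : Ω → Measure (ℝ × ℝ))
    (lam : ℕ → ℕ → ℝ → U → ℝ) (c : ℕ → ℝ → U → ℝ) (α : ℝ) (u : Control U) (i : ℕ) : ℝ :=
  if h : ∃ Z : (ℝ → Ω → ℕ) × (ℝ → Ω → ℝ), IsSolution P N lam u i 0 Z.1 Z.2 then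
    processCost P c α u h.choose.1 h.choose.2
  else 0

/-- The value function `V_α(i) = inf_u J^u_α(i)`. -/
noncomputable def valueFunction (P : Measure Ω) (N : Ω → Measure (ℝ × ℝ))
    (lam : ℕ → ℕ → ℝ → U → ℝ) (c : ℕ → ℝ → U → ℝ) (α : ℝ) (i : ℕ) : ℝ :=
  ⨅ u : Control U, discountedCost P N lam c α u i

/-! ### The semi-Markov optimality equation -/

/-- `exp (- ∫_0^y ∫_U ∑_{k ≠ i} λ_ik(s, u) r_s(du) ds)`. -/
noncomputable def survival (lam : ℕ → ℕ → ℝ → U → ℝ) (i : ℕ) (r : Action U) (y : ℝ) : ℝ :=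
  Real.exp (-∫ s in Ioc 0 y, ∫ u, exitRate lam i s u ∂(r.1 s : Measure U))

/-- The expected one-stage cost `f(i, r)`. -/
noncomputable def stageCost (lam : ℕ → ℕ → ℝ → U → ℝ) (c : ℕ → ℝ → U → ℝ) (α : ℝ)
    (i : ℕ) (r : Action U) : ℝ :=
  ∫ y in Ioi (0 : ℝ), Real.exp (-α * y) * survival lam i r y * relaxedCost c i y (r.1 y)

/-- The transition probability `p̂_ij(r)`. -/
noncomputable def transitionProb (lam : ℕ → ℕ → ℝ → U → ℝ) (i j : ℕ) (r : Action U) : ℝ :=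
  ∫ y in Ioi (0 : ℝ), survival lam i r y * relaxedRate lam i j y (r.1 y)

/-- The sojourn time distribution function `F^r_ij(t)`, `t ≥ 0`. -/
noncomputable def sojournDist (lam : ℕ → ℕ → ℝ → U → ℝ) (i j : ℕ) (r : Action U) (t : ℝ) : ℝ :=
  (∫ y in Ioc 0 t, survival lam i r y * relaxedRate lam i j y (r.1 y)) / transitionProb lam i j r

/-- The measure `dF^r_ij`; `sojournLaw_Iic` identifies its distribution function. -/
noncomputable def sojournLaw (lam : ℕ → ℕ → ℝ → U → ℝ) (i j : ℕ) (r : Action U) : Measure ℝ :=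
  (volume.restrict (Ioi 0)).withDensity fun y =>
    ENNReal.ofReal (survival lam i r y * relaxedRate lam i j y (r.1 y) / transitionProb lam i j r)

/-- `r ↦ f(i, r) + ∑_{j ≠ i} p̂_ij(r) ∫_0^∞ e^{-αt} φ(j) dF^r_ij(t)`. -/
noncomputable def bellman (lam : ℕ → ℕ → ℝ → U → ℝ) (c : ℕ → ℝ → U → ℝ) (α : ℝ)
    (φ : ℕ → ℝ) (i : ℕ) (r : Action U) : ℝ :=
  stageCost lam c α i r +
    ∑' j : {j : ℕ // j ≠ i}, transitionProb lam i j r *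
      ∫ t, Real.exp (-α * t) * φ j ∂(sojournLaw lam i j r)

/-- `φ(i) = min_r [...]` for all `i`: the minimum over `R` is attained and equals `φ(i)`. -/
def SolvesOptimalityEquation (lam : ℕ → ℕ → ℝ → U → ℝ) (c : ℕ → ℝ → U → ℝ) (α : ℝ)
    (φ : ℕ → ℝ) : Prop :=
  ∀ i, IsLeast (Set.range (bellman lam c α φ i)) (φ i)

/-- The distribution function of `sojournLaw` is `sojournDist`. -/
theorem sojournLaw_Iic (lam : ℕ → ℕ → ℝ → U → ℝ) (i j : ℕ) (r : Action U) (t : ℝ)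
    (hnn : ∀ y, 0 ≤ y → ∀ u, 0 ≤ lam i j y u)
    (hint : IntegrableOn (fun y => survival lam i r y * relaxedRate lam i j y (r.1 y))
      (Ioc 0 t)) :
    sojournLaw lam i j r (Iic t) = ENNReal.ofReal (sojournDist lam i j r t) := by
  have hd : ∀ y, 0 < y → 0 ≤ survival lam i r y * relaxedRate lam i j y (r.1 y) := fun y hy =>
    mul_nonneg (Real.exp_pos _).le (integral_nonneg (hnn y hy.le))
  have hp : 0 ≤ transitionProb lam i j r := setIntegral_nonneg measurableSet_Ioi hd
  have hset : Iic t ∩ Ioi (0 : ℝ) = Ioc 0 t := by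
    ext x
    simp [and_comm]
  unfold sojournLaw sojournDist
  rw [withDensity_apply _ measurableSet_Iic, Measure.restrict_restrict measurableSet_Iic, hset,
    ← integral_div, ofReal_integral_eq_lintegral_ofReal (hint.div_const _)]
  exact (ae_restrict_iff' measurableSet_Ioc).2
    (Eventually.of_forall fun y hy => div_nonneg (hd y hy.1) hp)

end Model

end AgeControl

/-!
The proof replaces the controlled jump process by a resolvent equation for functions `v` of state
and age. Let `Lam` bound the exit rates. Only the points of the noise with mark in `[0, Lam)` can
cause jumps, and they arrive at the rate `Lam`, whatever the control. Conditioning on the first of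
them suggests that the cost `v (i, y)` from state `i` and age `y` on under a control solves
`v (i, y) = ∫_0^∞ exp (-(α + Lam) s) H(v) (i, y + s) ds`, where the Hamiltonian `H(v)` is the
running cost plus `∑_j λ_ij v (j, 0) + (Lam - λ_i) v (i, ·)`, averaged over the actions of the
control.
Minimising the Hamiltonian over the actions instead gives the equation for the optimal cost. Both
operators are monotone and Lipschitz of constant `Lam < α + Lam`, so that solutions exist by
contraction (`exists_resolvent_fixedPoint`) and can be compared (`le_of_resolvent_eq`). The theorem
follows from three links between these fixed points and the objects in its statement.

*Cost of a control* (`processCost_eq`). Over a time interval of length `δ` the noise has, up to a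
probability of order `δ ^ 2`, no point or one, and the new points are independent of the past
(`IsPoissonRandomMeasure.map_restrict_empty`,
`IsPoissonRandomMeasure.map_restrict_single`); a path is determined by them, and is the same
measurable function of the noise for all solutions (`IsPath.eq_cellStep`,
`exists_measurable_eq_path`). Hence the value at the beginning of the interval is the expected cost
over the interval plus the discounted expected value at its end, up to an error of order `δ ^ 2`
(`abs_integral_value_sub_le`). Summing over the cells of a partition of `[0, T]`, refining the
partition and letting `T` tend to infinity shows that every solution started in `(i, 0)` has the
cost `v (i, 0)`. No Markov property at stopping times is needed. Solutions exist because the points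
of the noise in the strip are locally finite, so that a path can be continued from one to the next
(`exists_isPath`).

*Optimality equation* (`bellman_eq_of_resolvent_eq`). If the values of the states entered are held
fixed at `φ j`, in place of `v (j, 0)`, the equation becomes, in each state, a linear equation in
the age. Multiplying its solution by the discounted survival function turns it into an absolutely
continuous function with explicit derivative, whence its value at age `0` is the right-hand side of
the optimality equation.

*Attainment* (`exists_action_averageHamiltonian_eq_min`). The Hamiltonian is continuous in the
action, so a measurable choice of minimising actions exists.

Therefore the minimum in the optimality equation is attained, and equals the value at age `0` of the
fixed point of the minimised Hamiltonian with `φ` held fixed (`isLeast_bellman`). A function `φ`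
thus solves the optimality equation iff this value is `φ i` again, that is, iff the fixed point
solves the equation in which `v (j, 0)` is not held fixed; this determines `φ`
(`IsOptimalValue.solves_iff`).
Comparison with the fixed points of the controls identifies `φ` with the value function
(`IsOptimalValue.valueFunction_eq`). For minimisers `r i` of the right-hand side, the fixed point
with `φ` held fixed takes the values `φ i` at age `0`, hence is the cost of the control built from
the `r i`.
-/

set_option linter.unusedSectionVars false

open scoped BoundedContinuousFunction

namespace AgeControl

/-! ### Poisson random measures: independence and small cells -/

section Noise

variable {Ω E : Type*} [MeasurableSpace Ω] [MeasurableSpace E]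
  {P : Measure Ω} {N : Ω → Measure E} {μ : Measure E}

theorem measurable_measure_restrict {S : Set E} (hS : MeasurableSet S) :
    Measurable fun ν : Measure E => ν.restrict S :=
  Measure.measurable_of_measurable_coe _ fun A hA => by
    simpa only [Measure.restrict_apply hA] using Measure.measurable_coe (hA.inter hS)

theorem IsPoissonRandomMeasure.measurable_mass (hN : IsPoissonRandomMeasure P N μ)
    {B : Set E} (hB : MeasurableSet B) : Measurable fun ω => N ω B :=
  (Measure.measurable_coe hB).comp hN.measurable

theorem IsPoissonRandomMeasure.iIndepFun_mass (hN : IsPoissonRandomMeasure P N μ)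
    {ι : Type*} [Fintype ι] {B : ι → Set E} (hB : ∀ k, MeasurableSet (B k))
    (hd : Pairwise fun k l => Disjoint (B k) (B l)) :
    iIndepFun (fun k ω => N ω (B k)) P := by
  let e := Fintype.equivFin ι
  have h := hN.indep (Fintype.card ι) (fun k => B (e.symm k)) (fun k => hB _)
    (fun k l hkl => hd (e.symm.injective.ne hkl))
  have h' := h.precomp (g := e) e.injective
  simpa using h'

open Classical in
/-- The restriction of a Poisson random measure to a set `S` is independent of the masses of
finitely many disjoint sets outside `S`: the masses of finitely many measurable subsets of `S`
are sums of masses of the atoms of the finite algebra they generate. -/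
theorem IsPoissonRandomMeasure.indep_restrict [IsProbabilityMeasure P]
    (hN : IsPoissonRandomMeasure P N μ)
    {S : Set E} (hS : MeasurableSet S) {κ : Type*} [Fintype κ] {D : κ → Set E}
    (hD : ∀ k, MeasurableSet (D k)) (hDS : ∀ k, Disjoint S (D k))
    (hDD : Pairwise fun k l => Disjoint (D k) (D l)) :
    Indep (MeasurableSpace.comap (fun ω => (N ω).restrict S) inferInstance)
      (⨆ k, MeasurableSpace.comap (fun ω => N ω (D k)) inferInstance) P := by
  let m : Finset {A : Set E // MeasurableSet A} → MeasurableSpace Ω := fun t =>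
    ⨆ A ∈ t, MeasurableSpace.comap (fun ω => N ω (A.1 ∩ S)) inferInstance
  have hle : MeasurableSpace.comap (fun ω => (N ω).restrict S) inferInstance ≤ ⨆ t, m t := by
    have : Measurable[⨆ t, m t] (fun ω => (N ω).restrict S) := by
      refine @Measure.measurable_of_measurable_coe E Ω _ (⨆ t, m t) _ fun A hA => ?_
      simp only [Measure.restrict_apply hA]
      have h1 : Measurable[m {⟨A, hA⟩}] fun ω => N ω (A ∩ S) := by
        have : MeasurableSpace.comap (fun ω => N ω (A ∩ S)) inferInstance ≤ m {⟨A, hA⟩} :=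
          le_iSup₂_of_le (⟨A, hA⟩ : {A : Set E // MeasurableSet A}) (by simp) le_rfl
        exact (comap_measurable _).mono this le_rfl
      exact h1.mono (le_iSup m _) le_rfl
    exact this.comap_le
  refine indep_of_indep_of_le_left (indep_iSup_of_directed_le (fun t => ?_) (fun t => ?_) ?_ ?_) hle
  · -- the atoms of the algebra generated by the members of `t`
    let B : (t → Bool) ⊕ κ → Set E := Sum.elim
      (fun f => S ∩ ⋂ A : t, if f A then A.1.1 else A.1.1ᶜ) D
    have hB : ∀ k, MeasurableSet (B k) := by
      rintro (f | k)
      · refine hS.inter (MeasurableSet.iInter fun A => ?_)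
        split_ifs
        · exact A.1.2
        · exact A.1.2.compl
      · exact hD k
    have hdisj : ∀ f g : t → Bool, f ≠ g → Disjoint (B (Sum.inl f)) (B (Sum.inl g)) := by
      intro f g hfg
      obtain ⟨A, hA⟩ := Function.ne_iff.1 hfg
      rw [Set.disjoint_left]
      rintro x ⟨-, hx⟩ ⟨-, hx'⟩
      have h1 := mem_iInter.1 hx A
      have h2 := mem_iInter.1 hx' A
      cases hf : f A <;> cases hg : g A <;> simp_all
    have hpd : Pairwise fun k l => Disjoint (B k) (B l) := by
      rintro (f | k) (g | l) hkl
      · exact hdisj f g (by simpa using hkl)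
      · exact (hDS l).mono_left inter_subset_left
      · exact ((hDS k).mono_left inter_subset_left).symm
      · exact hDD (by simpa using hkl)
    have hind := (hN.iIndepFun_mass hB hpd).iIndep
    have hle' : ∀ k, MeasurableSpace.comap (fun ω => N ω (B k)) inferInstance ≤
        (inferInstance : MeasurableSpace Ω) := fun k => (hN.measurable_mass (hB k)).comap_le
    have key := indep_iSup_of_disjoint hle' hind
      (S := Set.range (Sum.inl : (t → Bool) → (t → Bool) ⊕ κ)) (T := Set.range Sum.inr)
      (Set.isCompl_range_inl_range_inr.disjoint)
    refine indep_of_indep_of_le_right (indep_of_indep_of_le_left key ?_) ?_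
    · refine iSup₂_le fun A hA => ?_
      refine Measurable.comap_le ?_
      have hsum : (fun ω => N ω (A.1 ∩ S)) = fun ω =>
          ∑ f ∈ Finset.univ.filter (fun f : t → Bool => f ⟨A, hA⟩ = true), N ω (B (Sum.inl f)) := by
        funext ω
        rw [← measure_biUnion_finset (fun f _ g _ hfg => hdisj f g hfg) (fun f _ => hB _)]
        congr 1
        ext x
        simp only [mem_inter_iff, mem_iUnion, Finset.mem_filter, Finset.mem_univ, true_and,
          exists_prop]
        constructor
        · rintro ⟨hxA, hxS⟩
          refine ⟨fun C => decide (x ∈ C.1.1), by simpa using hxA, hxS, mem_iInter.2 fun C => ?_⟩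
          by_cases hC : x ∈ C.1.1 <;> simp [hC]
        · rintro ⟨f, hf, hxS, hx⟩
          have := mem_iInter.1 hx ⟨A, hA⟩
          rw [if_pos hf] at this
          exact ⟨this, hxS⟩
      rw [hsum]
      refine Finset.measurable_sum _ fun f _ => ?_
      refine (comap_measurable _).mono ?_ le_rfl
      exact le_iSup₂_of_le (Sum.inl f) ⟨f, rfl⟩ le_rfl
    · refine iSup_le fun k => ?_
      exact le_iSup₂_of_le (Sum.inr k) ⟨k, rfl⟩ le_rfl
  · exact iSup₂_le fun A _ => (hN.measurable_mass (A.2.inter hS)).comap_le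
  · exact iSup_le fun k => (hN.measurable_mass (hD k)).comap_le
  · intro s t
    refine ⟨s ∪ t, ?_, ?_⟩ <;>
    · refine iSup₂_le fun A hA => ?_
      exact le_iSup₂_of_le A (by simp [hA]) le_rfl

theorem IsPoissonRandomMeasure.prob_mass_eq (hN : IsPoissonRandomMeasure P N μ)
    {B : Set E} (hB : MeasurableSet B) (hfin : μ B ≠ ∞) (n : ℕ) :
    P {ω | N ω B = n} =
      ENNReal.ofReal (Real.exp (-(μ B).toReal) * (μ B).toReal ^ n / n.factorial) := by
  have h := congrArg (fun ν : Measure ℝ≥0∞ => ν {(n : ℝ≥0∞)}) (hN.law B hB hfin)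
  rw [Measure.map_apply (hN.measurable_mass hB) (measurableSet_singleton _),
    Measure.map_apply (measurable_of_countable _) (measurableSet_singleton _)] at h
  have h2 : (fun k : ℕ => (k : ℝ≥0∞)) ⁻¹' {(n : ℝ≥0∞)} = {n} := by
    ext k; simp
  rw [h2, poissonMeasure_singleton] at h
  exact h

theorem IsPoissonRandomMeasure.mass_eq_zero_or_one (hN : IsPoissonRandomMeasure P N μ)
    {B : Set E} (hB : MeasurableSet B) {ω : Ω} (h : N ω B ≤ 1) : N ω B = 0 ∨ N ω B = 1 := by
  obtain ⟨n, hn⟩ := hN.integer_valued ω B hB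
  rw [hn] at h ⊢
  have h1 : n ≤ 1 := by exact_mod_cast h
  rcases Order.le_one_iff.1 h1 with h0 | h0
  · simp [h0]
  · simp [h0]

theorem IsPoissonRandomMeasure.prob_one_lt_mass_le [IsProbabilityMeasure P]
    (hN : IsPoissonRandomMeasure P N μ)
    {B : Set E} (hB : MeasurableSet B) (hfin : μ B ≠ ∞) :
    P {ω | 1 < N ω B} ≤ ENNReal.ofReal ((μ B).toReal ^ 2) := by
  set r := (μ B).toReal with hr
  have hr0 : 0 ≤ r := ENNReal.toReal_nonneg
  have h0 := hN.prob_mass_eq hB hfin 0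
  have h1 := hN.prob_mass_eq hB hfin 1
  have hm := hN.measurable_mass hB
  simp only [Nat.cast_zero, pow_zero, mul_one, Nat.factorial_zero, Nat.cast_one, div_one,
    pow_one, Nat.factorial_one, ← hr] at h0 h1
  have hset : {ω | 1 < N ω B} = ({ω | N ω B = 0} ∪ {ω | N ω B = 1})ᶜ := by
    ext ω
    simp only [mem_ofPred_eq, mem_compl_iff, mem_union]
    constructor
    · rintro h (h' | h') <;> simp [h'] at h
    · intro h
      by_contra h'
      exact h (hN.mass_eq_zero_or_one hB (not_lt.1 h'))
  have hms0 : MeasurableSet {ω | N ω B = 0} := hm (measurableSet_singleton _)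
  have hms1 : MeasurableSet {ω | N ω B = 1} := hm (measurableSet_singleton _)
  rw [hset, prob_compl_eq_one_sub (hms0.union hms1), measure_union _ hms1, h0, h1,
    ← ENNReal.ofReal_add (by positivity) (by positivity), ← ENNReal.ofReal_one,
    ← ENNReal.ofReal_sub _ (by positivity)]
  · refine ENNReal.ofReal_le_ofReal ?_
    have := Real.add_one_le_exp (-r)
    nlinarith
  · rw [Set.disjoint_left]
    rintro ω h h'
    simp only [mem_ofPred_eq] at h h'
    simp [h] at h'

/-- If exactly one point of the noise lies in `C`, the noise is a Dirac mass on `C`. -/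
theorem IsPoissonRandomMeasure.exists_restrict_eq_dirac [StandardBorelSpace E]
    (hN : IsPoissonRandomMeasure P N μ) {C : Set E} (hC : MeasurableSet C) {ω : Ω}
    (h1 : N ω C = 1) : ∃ p ∈ C, (N ω).restrict C = Measure.dirac p := by
  have : IsZeroOneMeasure ((N ω).restrict C) := ⟨fun s hs => by
    rw [Measure.restrict_apply hs]
    exact hN.mass_eq_zero_or_one (hs.inter hC) (h1 ▸ measure_mono inter_subset_right)⟩
  have : NeZero ((N ω).restrict C) := ⟨fun h => by
    have := congrArg (fun ν : Measure E => ν univ) h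
    simp [h1] at this⟩
  obtain ⟨p, hp⟩ := IsZeroOneMeasure.exists_eq_dirac (μ := (N ω).restrict C)
  refine ⟨p, ?_, hp⟩
  by_contra hpC
  have := congrArg (fun ν : Measure E => ν C) hp
  simp [Measure.restrict_apply hC, h1, Measure.dirac_apply' _ hC, hpC] at this

/-- The law of a variable `Z` of the past is unaffected by the event that a later set `C` carries
no point. -/
theorem IsPoissonRandomMeasure.map_restrict_empty [IsProbabilityMeasure P]
    (hN : IsPoissonRandomMeasure P N μ) {S C : Set E} (hS : MeasurableSet S)
    (hC : MeasurableSet C) (hSC : Disjoint S C) (hfin : μ C ≠ ∞)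
    {γ : Type*} [MeasurableSpace γ] {Z : Ω → γ}
    (hZ : Measurable[MeasurableSpace.comap (fun ω => (N ω).restrict S) inferInstance] Z) :
    (P.restrict {ω | N ω C = 0}).map Z =
      ENNReal.ofReal (Real.exp (-(μ C).toReal)) • P.map Z := by
  have hle : MeasurableSpace.comap (fun ω => (N ω).restrict S) inferInstance ≤
      (inferInstance : MeasurableSpace Ω) :=
    ((measurable_measure_restrict hS).comp hN.measurable).comap_le
  have hZ' : Measurable Z := hZ.mono hle le_rfl
  ext A hA
  rw [Measure.map_apply hZ' hA, Measure.restrict_apply (hZ' hA), Measure.smul_apply,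
    Measure.map_apply hZ' hA]
  have hind := hN.indep_restrict hS (κ := Unit) (D := fun _ => C) (fun _ => hC) (fun _ => hSC)
    (fun a b h => absurd rfl h)
  rw [Indep_iff] at hind
  have h2 : MeasurableSet[⨆ _ : Unit, MeasurableSpace.comap (fun ω => N ω C) inferInstance]
      {ω | N ω C = 0} := by
    refine (le_iSup (fun _ : Unit => MeasurableSpace.comap (fun ω => N ω C) inferInstance) ())
      _ ⟨{0}, measurableSet_singleton _, rfl⟩
  rw [hind _ _ (hZ hA) h2]
  have h0 := hN.prob_mass_eq hC hfin 0
  simp only [Nat.cast_zero, pow_zero, mul_one, Nat.factorial_zero, Nat.cast_one, div_one] at h0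
  rw [h0, mul_comm, smul_eq_mul]

/-- On the event that exactly one point of the noise lies in a later set `C`, this point is
independent of a variable `Z` of the past, and distributed as `exp (-μ C) • μ` on `C`. -/
theorem IsPoissonRandomMeasure.map_restrict_single [IsProbabilityMeasure P]
    (hN : IsPoissonRandomMeasure P N μ) {S C : Set E} (hS : MeasurableSet S)
    (hC : MeasurableSet C) (hSC : Disjoint S C) (hfin : μ C ≠ ∞)
    {γ : Type*} [MeasurableSpace γ] {Z : Ω → γ}
    (hZ : Measurable[MeasurableSpace.comap (fun ω => (N ω).restrict S) inferInstance] Z)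
    {p : Ω → E} (hp : Measurable p)
    (hpC : ∀ ω, N ω C = 1 → (N ω).restrict C = Measure.dirac (p ω)) :
    (P.restrict {ω | N ω C = 1}).map (fun ω => (Z ω, p ω)) =
      (P.map Z).prod (ENNReal.ofReal (Real.exp (-(μ C).toReal)) • μ.restrict C) := by
  have hle : MeasurableSpace.comap (fun ω => (N ω).restrict S) inferInstance ≤
      (inferInstance : MeasurableSpace Ω) :=
    ((measurable_measure_restrict hS).comp hN.measurable).comap_le
  have hZ' : Measurable Z := hZ.mono hle le_rfl
  have : IsFiniteMeasure (μ.restrict C) := ⟨by simpa using hfin.lt_top⟩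
  have : IsProbabilityMeasure (P.map Z) := Measure.isProbabilityMeasure_map hZ'.aemeasurable
  have : IsFiniteMeasure (ENNReal.ofReal (Real.exp (-(μ C).toReal)) • μ.restrict C) :=
    ⟨by simpa using ENNReal.mul_lt_top ENNReal.ofReal_lt_top hfin.lt_top⟩
  symm
  refine Measure.prod_eq fun A B hA hB => ?_
  rw [Measure.map_apply (hZ'.prodMk hp) (hA.prod hB),
    Measure.restrict_apply ((hZ'.prodMk hp) (hA.prod hB)), Measure.smul_apply,
    Measure.map_apply hZ' hA, Measure.restrict_apply hB]
  have hCB := hC.inter hB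
  have hCB' := hC.diff hB
  have hset : (fun ω => (Z ω, p ω)) ⁻¹' A ×ˢ B ∩ {ω | N ω C = 1} =
      Z ⁻¹' A ∩ ({ω | N ω (C ∩ B) = 1} ∩ {ω | N ω (C \ B) = 0}) := by
    ext ω
    simp only [mem_inter_iff, mem_preimage, mem_prod, mem_ofPred_eq, and_assoc]
    refine and_congr_right fun _ => ?_
    have hadd : N ω C = N ω (C ∩ B) + N ω (C \ B) := (measure_inter_add_sdiff C hB).symm
    have hdirac : N ω C = 1 → N ω (C ∩ B) = B.indicator 1 (p ω) := by
      intro h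
      rw [inter_comm, ← Measure.restrict_apply hB, hpC ω h, Measure.dirac_apply' _ hB]
    constructor
    · rintro ⟨hpB, h⟩
      have h1 : N ω (C ∩ B) = 1 := by rw [hdirac h]; simp [hpB]
      refine ⟨h1, ?_⟩
      rw [h, h1] at hadd
      have : (1 : ℝ≥0∞) + 0 = 1 + N ω (C \ B) := by rw [add_zero]; exact hadd
      exact ((ENNReal.add_right_inj ENNReal.one_ne_top).1 this).symm
    · rintro ⟨h1, h0⟩
      have h : N ω C = 1 := by rw [hadd, h1, h0, add_zero]
      refine ⟨?_, h⟩
      by_contra hpB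
      have := hdirac h
      rw [h1] at this
      simp [hpB] at this
  have hDD : Pairwise fun k l : Bool =>
      Disjoint (bif k then C ∩ B else C \ B) (bif l then C ∩ B else C \ B) := by
    have hd : Disjoint (C ∩ B) (C \ B) := disjoint_sdiff_inter.symm
    rintro (_ | _) (_ | _) h
    · exact absurd rfl h
    · exact hd.symm
    · exact hd
    · exact absurd rfl h
  have hDm : ∀ k : Bool, MeasurableSet (bif k then C ∩ B else C \ B) := by
    rintro (_ | _)
    · exact hCB'
    · exact hCB
  have hind := hN.indep_restrict hS hDm (fun k => by
    cases k
    · exact hSC.mono_right sdiff_subset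
    · exact hSC.mono_right inter_subset_left) hDD
  have hind2 := hN.iIndepFun_mass hDm hDD
  rw [Indep_iff] at hind
  rw [hset, hind _ _ (hZ hA)]
  · have hf1 : μ (C ∩ B) ≠ ∞ := ne_top_of_le_ne_top hfin (measure_mono inter_subset_left)
    have hf0 : μ (C \ B) ≠ ∞ := ne_top_of_le_ne_top hfin (measure_mono sdiff_subset)
    have h1 := hN.prob_mass_eq hCB hf1 1
    have h0 := hN.prob_mass_eq hCB' hf0 0
    have hi := (hind2.indepFun (i := true) (j := false) (by simp)).measure_inter_preimage_eq_mul
      {1} {0} (measurableSet_singleton _) (measurableSet_singleton _)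
    simp only [Nat.cast_zero, pow_zero, mul_one, Nat.factorial_zero, Nat.cast_one, div_one,
      pow_one, Nat.factorial_one] at h0 h1
    have hi' : P ({ω | N ω (C ∩ B) = 1} ∩ {ω | N ω (C \ B) = 0}) =
        P {ω | N ω (C ∩ B) = 1} * P {ω | N ω (C \ B) = 0} := hi
    rw [hi', h1, h0, ← measure_inter_add_sdiff C hB, ENNReal.toReal_add hf1 hf0, neg_add,
      Real.exp_add, ENNReal.ofReal_mul (by positivity), ENNReal.ofReal_mul (by positivity),
      ENNReal.ofReal_toReal hf1, smul_eq_mul, inter_comm C B]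
    ring
  · refine MeasurableSet.inter ?_ ?_
    · exact (le_iSup (fun k : Bool => MeasurableSpace.comap
        (fun ω => N ω (bif k then C ∩ B else C \ B)) inferInstance) true)
        _ ⟨{1}, measurableSet_singleton _, rfl⟩
    · exact (le_iSup (fun k : Bool => MeasurableSpace.comap
        (fun ω => N ω (bif k then C ∩ B else C \ B)) inferInstance) false)
        _ ⟨{0}, measurableSet_singleton _, rfl⟩

end Noise

/-! ### Cells of the noise -/

/-- The part of the strip `[0, ∞) × [0, Lam)` belonging to the time interval `(s, t]`. -/
def cell (Lam s t : ℝ) : Set (ℝ × ℝ) := Ioc s t ×ˢ Ico 0 Lam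

theorem measurableSet_cell (Lam s t : ℝ) : MeasurableSet (cell Lam s t) :=
  measurableSet_Ioc.prod measurableSet_Ico

theorem noiseIntensity_cell {Lam s t : ℝ} (hs : 0 ≤ s) (hst : s ≤ t) :
    noiseIntensity (cell Lam s t) = ENNReal.ofReal ((t - s) * Lam) := by
  rw [noiseIntensity, cell, Measure.prod_prod, Measure.restrict_apply measurableSet_Ioc,
    inter_eq_left.2 (show Ioc s t ⊆ Ici 0 from fun x hx => hs.trans hx.1.le), Real.volume_Ioc,
    Real.volume_Ico, sub_zero,
    ENNReal.ofReal_mul (by linarith)]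

/-- The `k`-th point of the partition of `[s, t]` into `m` intervals of equal length. -/
noncomputable def gridPoint (s t : ℝ) (m k : ℕ) : ℝ := s + k * ((t - s) / m)

theorem gridPoint_zero (s t : ℝ) (m : ℕ) : gridPoint s t m 0 = s := by simp [gridPoint]

theorem gridPoint_last (s t : ℝ) {m : ℕ} (hm : m ≠ 0) : gridPoint s t m m = t := by
  have : (m : ℝ) ≠ 0 := by exact_mod_cast hm
  simp only [gridPoint]; field_simp; ring

theorem gridPoint_succ (s t : ℝ) (m k : ℕ) :
    gridPoint s t m (k + 1) = gridPoint s t m k + (t - s) / m := by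
  simp only [gridPoint]; push_cast; ring

theorem gridPoint_mono {s t : ℝ} (hst : s ≤ t) (m : ℕ) : Monotone (gridPoint s t m) := by
  refine monotone_nat_of_le_succ fun k => ?_
  rw [gridPoint_succ]
  have : 0 ≤ (t - s) / m := div_nonneg (by linarith) (by positivity)
  linarith

/-- Almost surely a sufficiently fine dyadic partition of `(s, t]` separates the points of the
strip: the probability that some cell holds two points is at most the sum of the squares of the
intensities of the cells. -/
theorem IsPoissonRandomMeasure.ae_exists_grid_mass_le_one {Ω : Type*} [MeasurableSpace Ω]
    {P : Measure Ω} [IsProbabilityMeasure P] {N : Ω → Measure (ℝ × ℝ)}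
    (hN : IsPoissonRandomMeasure P N noiseIntensity) {Lam s t : ℝ} (hs : 0 ≤ s) (hst : s ≤ t) :
    ∀ᵐ ω ∂P, ∃ n : ℕ, ∀ k < 2 ^ n,
      N ω (cell Lam (gridPoint s t (2 ^ n) k) (gridPoint s t (2 ^ n) (k + 1))) ≤ 1 := by
  have hcell : ∀ n k : ℕ, noiseIntensity
      (cell Lam (gridPoint s t (2 ^ n) k) (gridPoint s t (2 ^ n) (k + 1))) =
      ENNReal.ofReal ((t - s) / (2 ^ n : ℕ) * Lam) := by
    intro n k
    have h0 : s ≤ gridPoint s t (2 ^ n) k := by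
      simpa [gridPoint_zero] using gridPoint_mono hst (2 ^ n) (Nat.zero_le k)
    rw [noiseIntensity_cell (hs.trans h0) (gridPoint_mono hst _ (Nat.le_succ k)), gridPoint_succ]
    congr 2; ring
  have hbound : ∀ n : ℕ, P {ω | ¬ ∃ n : ℕ, ∀ k < 2 ^ n,
      N ω (cell Lam (gridPoint s t (2 ^ n) k) (gridPoint s t (2 ^ n) (k + 1))) ≤ 1} ≤
      ENNReal.ofReal (((t - s) * Lam) ^ 2 * (1 / 2) ^ n) := by
    intro n
    calc P {ω | ¬ ∃ n : ℕ, ∀ k < 2 ^ n,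
          N ω (cell Lam (gridPoint s t (2 ^ n) k) (gridPoint s t (2 ^ n) (k + 1))) ≤ 1}
        ≤ P (⋃ k ∈ Finset.range (2 ^ n), {ω | 1 <
          N ω (cell Lam (gridPoint s t (2 ^ n) k) (gridPoint s t (2 ^ n) (k + 1)))}) := by
          refine measure_mono fun ω hω => ?_
          simp only [mem_ofPred_eq, not_exists, not_forall, not_le] at hω
          obtain ⟨k, hk, h⟩ := hω n
          exact mem_biUnion (by simpa using hk) h
      _ ≤ ∑ k ∈ Finset.range (2 ^ n), P {ω | 1 <
          N ω (cell Lam (gridPoint s t (2 ^ n) k) (gridPoint s t (2 ^ n) (k + 1)))} :=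
          measure_biUnion_finset_le _ _
      _ ≤ ∑ k ∈ Finset.range (2 ^ n),
          ENNReal.ofReal (((t - s) / (2 ^ n : ℕ) * Lam) ^ 2) := by
          refine Finset.sum_le_sum fun k _ => ?_
          refine (hN.prob_one_lt_mass_le (measurableSet_cell _ _ _)
            (by rw [hcell]; exact ENNReal.ofReal_ne_top)).trans ?_
          rw [hcell]
          refine ENNReal.ofReal_le_ofReal ?_
          rw [ENNReal.toReal_ofReal']
          rcases le_total 0 ((t - s) / (2 ^ n : ℕ) * Lam) with h | h
          · rw [max_eq_left h]
          · rw [max_eq_right h]; nlinarith [sq_nonneg ((t - s) / (2 ^ n : ℕ) * Lam)]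
      _ = _ := by
          rw [Finset.sum_const, Finset.card_range, nsmul_eq_mul,
            ← ENNReal.ofReal_natCast, ← ENNReal.ofReal_mul (Nat.cast_nonneg _)]
          congr 1
          push_cast
          rw [one_div, inv_pow]
          field_simp
  rw [ae_iff]
  have h1 : Tendsto (fun n : ℕ => ((t - s) * Lam) ^ 2 * (1 / 2 : ℝ) ^ n) atTop (𝓝 0) := by
    simpa using (tendsto_pow_atTop_nhds_zero_of_lt_one (by norm_num : (0 : ℝ) ≤ 1 / 2)
      (by norm_num)).const_mul (((t - s) * Lam) ^ 2)
  simpa using ge_of_tendsto' (ENNReal.tendsto_ofReal h1) hbound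

/-- The position of the point of `ν` in `C ⊆ [0, ∞) × [0, ∞)`, if there is exactly one. -/
noncomputable def atomPosition (C : Set (ℝ × ℝ)) (ν : Measure (ℝ × ℝ)) : ℝ × ℝ :=
  ((∫⁻ p in C, ENNReal.ofReal p.1 ∂ν).toReal, (∫⁻ p in C, ENNReal.ofReal p.2 ∂ν).toReal)

theorem measurable_atomPosition {C : Set (ℝ × ℝ)} (hC : MeasurableSet C) :
    Measurable (atomPosition C) := by
  refine Measurable.prodMk ?_ ?_
  · exact ((Measure.measurable_lintegral (by fun_prop)).comp
      (measurable_measure_restrict hC)).ennreal_toReal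
  · exact ((Measure.measurable_lintegral (by fun_prop)).comp
      (measurable_measure_restrict hC)).ennreal_toReal

theorem atomPosition_eq {C : Set (ℝ × ℝ)} {ν : Measure (ℝ × ℝ)} {p : ℝ × ℝ}
    (h : ν.restrict C = Measure.dirac p) (h1 : 0 ≤ p.1) (h2 : 0 ≤ p.2) :
    atomPosition C ν = p := by
  simp only [atomPosition, h, lintegral_dirac, ENNReal.toReal_ofReal h1, ENNReal.toReal_ofReal h2]

theorem IsPoissonRandomMeasure.restrict_cell_eq_dirac {Ω : Type*} [MeasurableSpace Ω]
    {P : Measure Ω} {N : Ω → Measure (ℝ × ℝ)} {μ : Measure (ℝ × ℝ)}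
    (hN : IsPoissonRandomMeasure P N μ) {Lam s t : ℝ} (hs : 0 ≤ s)
    {ω : Ω} (h : N ω (cell Lam s t) = 1) :
    atomPosition (cell Lam s t) (N ω) ∈ cell Lam s t ∧
      (N ω).restrict (cell Lam s t) =
        Measure.dirac (atomPosition (cell Lam s t) (N ω)) := by
  obtain ⟨p, hp, hd⟩ := hN.exists_restrict_eq_dirac (measurableSet_cell _ _ _) h
  rw [atomPosition_eq hd (hs.trans hp.1.1.le) hp.2.1]
  exact ⟨hp, hd⟩

/-! ### Rates and costs along a control -/

section Rates

variable {U : Type*} [MetricSpace U] [CompactSpace U] [MeasurableSpace U] [BorelSpace U]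

/-- The standing assumptions on the rates: they are nonnegative and continuous, the series of the
rates out of a state converges uniformly, and `Lam` bounds the exit rates. -/
structure BoundedRates (lam : ℕ → ℕ → ℝ → U → ℝ) (Lam : ℝ) : Prop where
  nonneg : ∀ i j, i ≠ j → ∀ y, 0 ≤ y → ∀ u, 0 ≤ lam i j y u
  cont : ∀ i j, i ≠ j → ContinuousOn (fun p : ℝ × U => lam i j p.1 p.2) (Ici 0 ×ˢ univ)
  unif : ∀ i, TendstoUniformlyOn
    (fun (n : ℕ) (p : ℝ × U) => ∑ j ∈ (Finset.range n).filter (· ≠ i), lam i j p.1 p.2)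
    (fun p : ℝ × U => exitRate lam i p.1 p.2) atTop (Ici 0 ×ˢ univ)
  exit_le : ∀ i y, 0 ≤ y → ∀ u, exitRate lam i y u ≤ Lam

/-- The standing assumptions on the running cost. -/
structure BoundedCost (c : ℕ → ℝ → U → ℝ) (C : ℝ) : Prop where
  nonneg : ∀ i y, 0 ≤ y → ∀ u, 0 ≤ c i y u
  age : ∀ i u, ContinuousOn (fun y => c i y u) (Ici 0)
  action : ∀ i y, 0 ≤ y → Continuous (c i y)
  le : ∀ i y, 0 ≤ y → ∀ u, c i y u ≤ C

theorem hasSum_subtype_ne {a : ℕ → ℝ} {i : ℕ} {s : ℝ} :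
    HasSum (fun j : {j : ℕ // j ≠ i} => a j) s ↔
      HasSum (fun j => if j ≠ i then a j else 0) s := by
  have := hasSum_subtype_iff_indicator (f := a) (a := s) (s := {j : ℕ | j ≠ i})
  have h2 : ({j : ℕ | j ≠ i}.indicator a) = fun j => if j ≠ i then a j else 0 := by
    ext j; simp [indicator_apply]
  rw [h2] at this
  exact this

variable {lam : ℕ → ℕ → ℝ → U → ℝ} {Lam : ℝ} {c : ℕ → ℝ → U → ℝ} {C : ℝ}

theorem BoundedRates.hasSum_exitRate (h : BoundedRates lam Lam) (i : ℕ) {y : ℝ} (hy : 0 ≤ y)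
    (u : U) : HasSum (fun j : {j : ℕ // j ≠ i} => lam i j y u) (exitRate lam i y u) := by
  rw [hasSum_subtype_ne (a := fun j => lam i j y u)]
  rw [hasSum_iff_tendsto_nat_of_nonneg]
  · have := (h.unif i).tendsto_at (x := (y, u)) ⟨hy, mem_univ _⟩
    simpa only [Finset.sum_filter] using this
  · intro j
    split_ifs with hj
    · exact h.nonneg i j (Ne.symm hj) y hy u
    · exact le_rfl

theorem BoundedRates.exitRate_nonneg (h : BoundedRates lam Lam) (i : ℕ) {y : ℝ} (hy : 0 ≤ y)
    (u : U) : 0 ≤ exitRate lam i y u :=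
  HasSum.nonneg (fun j : {j : ℕ // j ≠ i} => h.nonneg i j (Ne.symm j.2) y hy u)
    (h.hasSum_exitRate i hy u)

theorem continuous_clamp : Continuous fun p : ℝ × U => ((max p.1 0, p.2) : ℝ × U) := by fun_prop

theorem ContinuousOn.comp_clamp {f : ℝ × U → ℝ} (hf : ContinuousOn f (Ici 0 ×ˢ univ)) :
    Continuous fun p : ℝ × U => f (max p.1 0, p.2) :=
  hf.comp_continuous continuous_clamp fun _ => ⟨mem_Ici.2 (le_max_right _ _), mem_univ _⟩

theorem BoundedRates.continuous_lam (h : BoundedRates lam Lam) {i j : ℕ} (hij : i ≠ j) :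
    Continuous fun p : ℝ × U => lam i j (max p.1 0) p.2 :=
  ContinuousOn.comp_clamp (h.cont i j hij)

theorem BoundedRates.continuous_exitRate (h : BoundedRates lam Lam) (i : ℕ) :
    Continuous fun p : ℝ × U => exitRate lam i (max p.1 0) p.2 := by
  refine ContinuousOn.comp_clamp (f := fun p => exitRate lam i p.1 p.2) ?_
  refine (h.unif i).continuousOn (Frequently.of_forall fun n => ?_)
  exact continuousOn_finsetSum _ fun j hj => h.cont i j (Ne.symm (Finset.mem_filter.1 hj).2)

/-- Averages over a measurable family of probability measures are measurable. -/
theorem measurable_average {γ : Type*} [MeasurableSpace γ] {r : γ → ProbabilityMeasure U}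
    (hr : Measurable r) {f : γ × U → ℝ} (hf : Measurable f) :
    Measurable fun y => ∫ u, f (y, u) ∂(r y : Measure U) := by
  let κ : Kernel γ U := ⟨fun y => (r y : Measure U), measurable_subtype_coe.comp hr⟩
  have : IsMarkovKernel κ := ⟨fun y => (r y).2⟩
  exact (StronglyMeasurable.integral_kernel_prod_right' (κ := κ) hf.stronglyMeasurable).measurable

theorem abs_integral_le_of_abs_le {ν : Measure U} [IsProbabilityMeasure ν] {f : U → ℝ} {K : ℝ}
    (h : ∀ u, |f u| ≤ K) : |∫ u, f u ∂ν| ≤ K := by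
  simpa using norm_integral_le_of_norm_le_const (μ := ν) (f := f) (C := K)
    (Eventually.of_forall h)

theorem BoundedRates.continuous_lam_right (h : BoundedRates lam Lam) {i j : ℕ} (hij : i ≠ j)
    {y : ℝ} (hy : 0 ≤ y) : Continuous fun u => lam i j y u := by
  have := (h.continuous_lam hij).comp (Continuous.prodMk_right y)
  simpa [Function.comp_def, max_eq_left hy] using this

theorem BoundedRates.continuous_exitRate_right (h : BoundedRates lam Lam) (i : ℕ)
    {y : ℝ} (hy : 0 ≤ y) : Continuous fun u => exitRate lam i y u := by
  have := (h.continuous_exitRate i).comp (Continuous.prodMk_right y)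
  simpa [Function.comp_def, max_eq_left hy] using this

theorem integrable_of_continuous {ν : Measure U} [IsProbabilityMeasure ν] {f : U → ℝ}
    (hf : Continuous f) : Integrable f ν :=
  hf.integrable_of_hasCompactSupport (HasCompactSupport.of_compactSpace f)

/-- Averaging the series `∑_j lam_ij φ_j` over the actions may be done term by term. -/
theorem BoundedRates.hasSum_relaxedRate_mul (h : BoundedRates lam Lam) (i : ℕ) {y : ℝ}
    (hy : 0 ≤ y) (ν : ProbabilityMeasure U) {φ : ℕ → ℝ} {K : ℝ} (hφ : ∀ j, |φ j| ≤ K) :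
    HasSum (fun j : {j : ℕ // j ≠ i} => relaxedRate lam i j y ν * φ j)
      (∫ u, ∑' j : {j : ℕ // j ≠ i}, lam i j y u * φ j ∂(ν : Measure U)) := by
  have hs : ∀ u, Summable fun j : {j : ℕ // j ≠ i} => lam i j y u * φ j := fun u =>
    Summable.of_norm_bounded ((h.hasSum_exitRate i hy u).summable.mul_right K) fun j => by
      rw [norm_mul, Real.norm_of_nonneg (h.nonneg i j (Ne.symm j.2) y hy u)]
      exact mul_le_mul_of_nonneg_left (hφ j) (h.nonneg i j (Ne.symm j.2) y hy u)
  have key := hasSum_integral_of_dominated_convergence (μ := (ν : Measure U))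
    (F := fun (j : {j : ℕ // j ≠ i}) u => lam i j y u * φ j)
    (f := fun u => ∑' j : {j : ℕ // j ≠ i}, lam i j y u * φ j)
    (fun j u => lam i j y u * K)
    (fun j => ((h.continuous_lam_right (Ne.symm j.2) hy).mul
      continuous_const).aestronglyMeasurable)
    (fun j => Eventually.of_forall fun u => by
      rw [norm_mul, Real.norm_of_nonneg (h.nonneg i j (Ne.symm j.2) y hy u)]
      exact mul_le_mul_of_nonneg_left (hφ j) (h.nonneg i j (Ne.symm j.2) y hy u))
    (Eventually.of_forall fun u => (h.hasSum_exitRate i hy u).summable.mul_right K)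
    ?_ (Eventually.of_forall fun u => (hs u).hasSum)
  · simp only [integral_mul_const] at key
    exact key
  · simp_rw [tsum_mul_right]
    exact integrable_of_continuous ((h.continuous_exitRate_right i hy).mul continuous_const)

theorem BoundedRates.hasSum_relaxedRate (h : BoundedRates lam Lam) (i : ℕ) {y : ℝ}
    (hy : 0 ≤ y) (ν : ProbabilityMeasure U) :
    HasSum (fun j : {j : ℕ // j ≠ i} => relaxedRate lam i j y ν)
      (∫ u, exitRate lam i y u ∂(ν : Measure U)) := by
  simpa [exitRate] using h.hasSum_relaxedRate_mul i hy ν (φ := fun _ => 1) (K := 1) (by simp)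

theorem BoundedRates.relaxedRate_nonneg (h : BoundedRates lam Lam) {i j : ℕ} (hij : i ≠ j) {y : ℝ}
    (hy : 0 ≤ y) (ν : ProbabilityMeasure U) : 0 ≤ relaxedRate lam i j y ν :=
  integral_nonneg (h.nonneg i j hij y hy)

theorem BoundedRates.relaxedExitRate_le (h : BoundedRates lam Lam) (i : ℕ) {y : ℝ}
    (hy : 0 ≤ y) (ν : ProbabilityMeasure U) :
    ∫ u, exitRate lam i y u ∂(ν : Measure U) ≤ Lam := by
  refine (integral_mono (integrable_of_continuous (h.continuous_exitRate_right i hy))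
    (integrable_const Lam) (h.exit_le i y hy)).trans (by simp)

/-- The rate `i → j` at age `y` under the control `u`; negative ages are read as `0`. -/
noncomputable def policyRate (lam : ℕ → ℕ → ℝ → U → ℝ) (u : Control U) (i j : ℕ) (y : ℝ) : ℝ :=
  relaxedRate lam i j (max y 0) (u.1 i (max y 0))

/-- The running cost at age `y` under the control `u`; negative ages are read as `0`. -/
noncomputable def policyCost (c : ℕ → ℝ → U → ℝ) (u : Control U) (i : ℕ) (y : ℝ) : ℝ :=
  relaxedCost c i (max y 0) (u.1 i (max y 0))

theorem measurable_control_clamp (u : Control U) (i : ℕ) :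
    Measurable fun y : ℝ => u.1 i (max y 0) := by
  have h1 : Measurable fun y : ℝ => ((i, max y 0) : ℕ × ℝ) := by fun_prop
  exact u.2.comp h1

theorem BoundedRates.measurable_policyRate (h : BoundedRates lam Lam) (u : Control U) {i j : ℕ}
    (hij : i ≠ j) : Measurable (policyRate lam u i j) :=
  measurable_average (measurable_control_clamp u i)
    (f := fun p => lam i j (max p.1 0) p.2) (h.continuous_lam hij).measurable

theorem BoundedRates.policyRate_nonneg (h : BoundedRates lam Lam) (u : Control U) {i j : ℕ}
    (hij : i ≠ j) (y : ℝ) : 0 ≤ policyRate lam u i j y :=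
  h.relaxedRate_nonneg hij (le_max_right _ _) _

theorem BoundedCost.measurable_clamp (hc : BoundedCost c C) (i : ℕ) :
    Measurable fun p : ℝ × U => c i (max p.1 0) p.2 := by
  have := measurable_uncurry_of_continuous_of_measurable (u := fun (a : U) (y : ℝ) =>
    c i (max y 0) a) (fun y => hc.action i _ (le_max_right _ _)) (fun a =>
    ((hc.age i a).comp_continuous (by fun_prop : Continuous fun y : ℝ => max y 0)
      fun y => mem_Ici.2 (le_max_right _ _)).measurable)
  exact this.comp measurable_swap

theorem BoundedCost.measurable_policyCost (hc : BoundedCost c C) (u : Control U) (i : ℕ) :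
    Measurable (policyCost c u i) :=
  measurable_average (measurable_control_clamp u i)
    (f := fun p => c i (max p.1 0) p.2) (hc.measurable_clamp i)

theorem BoundedCost.abs_le (hc : BoundedCost c C) (i : ℕ) {y : ℝ} (hy : 0 ≤ y) (u : U) :
    |c i y u| ≤ C := by
  rw [abs_of_nonneg (hc.nonneg i y hy u)]; exact hc.le i y hy u

theorem BoundedCost.abs_policyCost_le (hc : BoundedCost c C) (u : Control U) (i : ℕ) (y : ℝ) :
    |policyCost c u i y| ≤ C :=
  abs_integral_le_of_abs_le fun a => hc.abs_le i (le_max_right _ _) a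

/-! ### The transition at a point of the noise -/

/-- A point of the noise with mark `z`, met in state `x.1` at age `x.2` under the control `u`,
triggers a jump to state `j`. -/
def JumpsTo (lam : ℕ → ℕ → ℝ → U → ℝ) (u : Control U) (x : ℕ × ℝ) (z : ℝ) (j : ℕ) : Prop :=
  j ≠ x.1 ∧ z ∈ jumpInterval lam x.1 j (max x.2 0) (u.1 x.1 (max x.2 0))

open Classical in
/-- State and age after a point of the noise with mark `z` is met in state `x.1` at age `x.2`. -/
noncomputable def postJump (lam : ℕ → ℕ → ℝ → U → ℝ) (u : Control U) (x : ℕ × ℝ) (z : ℝ) : ℕ × ℝ :=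
  if h : ∃ j, JumpsTo lam u x z j then (Nat.find h, 0) else x

theorem sum_filter_policyRate (u : Control U) (x : ℕ × ℝ) (j : ℕ) :
    ∑ k ∈ (Finset.range j).filter (· ≠ x.1),
      relaxedRate lam x.1 k (max x.2 0) (u.1 x.1 (max x.2 0)) =
    ∑ k ∈ Finset.range j, if k ≠ x.1 then policyRate lam u x.1 k x.2 else 0 := by
  rw [Finset.sum_filter]; rfl

theorem BoundedRates.filter_nonneg (h : BoundedRates lam Lam) (u : Control U) (x : ℕ × ℝ) (k : ℕ) :
    0 ≤ if k ≠ x.1 then policyRate lam u x.1 k x.2 else 0 := by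
  split_ifs with hk
  · exact h.policyRate_nonneg u (Ne.symm hk) _
  · exact le_rfl

theorem jumpsTo_iff (u : Control U) (x : ℕ × ℝ) (z : ℝ) (j : ℕ) :
    JumpsTo lam u x z j ↔ j ≠ x.1 ∧
      (∑ k ∈ Finset.range j, if k ≠ x.1 then policyRate lam u x.1 k x.2 else 0) ≤ z ∧
      z < (∑ k ∈ Finset.range j, if k ≠ x.1 then policyRate lam u x.1 k x.2 else 0) +
        policyRate lam u x.1 j x.2 := by
  simp only [JumpsTo, jumpInterval, mem_Ico, sum_filter_policyRate]
  rfl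

theorem BoundedRates.jumpsTo_unique (h : BoundedRates lam Lam) {u : Control U} {x : ℕ × ℝ} {z : ℝ}
    {j k : ℕ} (hj : JumpsTo lam u x z j) (hk : JumpsTo lam u x z k) : j = k := by
  wlog hjk : j < k generalizing j k
  · rcases lt_trichotomy j k with h' | h' | h'
    · exact absurd h' hjk
    · exact h'
    · exact (this hk hj h').symm
  exfalso
  rw [jumpsTo_iff] at hj hk
  have hmono : (∑ l ∈ Finset.range (j + 1), if l ≠ x.1 then policyRate lam u x.1 l x.2 else 0) ≤
      ∑ l ∈ Finset.range k, if l ≠ x.1 then policyRate lam u x.1 l x.2 else 0 :=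
    Finset.sum_le_sum_of_subset_of_nonneg (Finset.range_mono hjk)
      fun l _ _ => h.filter_nonneg u x l
  rw [Finset.sum_range_succ, if_pos hj.1] at hmono
  linarith [hj.2.2, hk.2.1]

theorem BoundedRates.mem_Ico_of_jumpsTo (h : BoundedRates lam Lam) {u : Control U} {x : ℕ × ℝ}
    {z : ℝ} {j : ℕ} (hj : JumpsTo lam u x z j) : z ∈ Ico 0 Lam := by
  rw [jumpsTo_iff] at hj
  refine ⟨(Finset.sum_nonneg fun k _ => h.filter_nonneg u x k).trans hj.2.1, ?_⟩
  have h1 : HasSum (fun k => if k ≠ x.1 then policyRate lam u x.1 k x.2 else 0)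
      (∫ a, exitRate lam x.1 (max x.2 0) a ∂(u.1 x.1 (max x.2 0) : Measure U)) :=
    (hasSum_subtype_ne (a := fun k => policyRate lam u x.1 k x.2)).1
      (h.hasSum_relaxedRate x.1 (le_max_right x.2 0) (u.1 x.1 (max x.2 0)))
  have h2 := sum_le_hasSum (Finset.range (j + 1)) (fun k _ => h.filter_nonneg u x k) h1
  rw [Finset.sum_range_succ] at h2
  refine hj.2.2.trans_le (le_trans ?_ (h.relaxedExitRate_le x.1 (le_max_right x.2 0)
    (u.1 x.1 (max x.2 0))))
  simpa [hj.1, policyRate] using h2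

theorem postJump_of_jumpsTo (h : BoundedRates lam Lam) {u : Control U} {x : ℕ × ℝ} {z : ℝ}
    {j : ℕ} (hj : JumpsTo lam u x z j) : postJump lam u x z = (j, 0) := by
  classical
  have hex : ∃ j, JumpsTo lam u x z j := ⟨j, hj⟩
  rw [postJump, dif_pos hex, h.jumpsTo_unique (Nat.find_spec hex) hj]

theorem postJump_of_not_jumpsTo {u : Control U} {x : ℕ × ℝ} {z : ℝ}
    (hj : ¬ ∃ j, JumpsTo lam u x z j) : postJump lam u x z = x := by
  rw [postJump, dif_neg hj]

theorem BoundedRates.postJump_of_notMem (h : BoundedRates lam Lam) {u : Control U} {x : ℕ × ℝ}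
    {z : ℝ} (hz : z ∉ Ico 0 Lam) : postJump lam u x z = x :=
  postJump_of_not_jumpsTo fun ⟨_, hj⟩ => hz (h.mem_Ico_of_jumpsTo hj)

theorem postJump_nonneg (u : Control U) {x : ℕ × ℝ} (hx : 0 ≤ x.2) (z : ℝ) :
    0 ≤ (postJump lam u x z).2 := by
  rw [postJump]; split_ifs
  · exact le_rfl
  · exact hx

theorem BoundedRates.stateJump_eq (h : BoundedRates lam Lam) (u : Control U) (i : ℕ) {y : ℝ}
    (hy : 0 ≤ y) (z : ℝ) :
    stateJump lam i y (u.1 i y) z = ((postJump lam u (i, y) z).1 : ℝ) - i := by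
  have hJ : ∀ j, JumpsTo lam u (i, y) z j ↔ j ≠ i ∧ z ∈ jumpInterval lam i j y (u.1 i y) := by
    intro j; simp only [JumpsTo, max_eq_left hy]
  unfold stateJump
  by_cases hex : ∃ j, JumpsTo lam u (i, y) z j
  · obtain ⟨j, hj⟩ := hex
    have hj' := (hJ j).1 hj
    rw [postJump_of_jumpsTo h hj, tsum_eq_single ⟨j, hj'.1⟩]
    · simp [hj'.2]
    · rintro ⟨k, hki⟩ hk
      refine indicator_of_notMem (fun hz => hk (Subtype.ext ?_)) _
      exact h.jumpsTo_unique ((hJ k).2 ⟨hki, hz⟩) hj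
  · rw [postJump_of_not_jumpsTo hex, sub_self]
    refine (tsum_congr fun k => ?_).trans tsum_zero
    exact indicator_of_notMem (fun hz => hex ⟨k, (hJ k).2 ⟨k.2, hz⟩⟩) _

theorem BoundedRates.ageJump_eq (h : BoundedRates lam Lam) (u : Control U) (i : ℕ) {y : ℝ}
    (hy : 0 ≤ y) (z : ℝ) :
    ageJump lam i y (u.1 i y) z = y - (postJump lam u (i, y) z).2 := by
  have hJ : ∀ j, JumpsTo lam u (i, y) z j ↔ j ≠ i ∧ z ∈ jumpInterval lam i j y (u.1 i y) := by
    intro j; simp only [JumpsTo, max_eq_left hy]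
  unfold ageJump
  by_cases hex : ∃ j, JumpsTo lam u (i, y) z j
  · obtain ⟨j, hj⟩ := hex
    have hj' := (hJ j).1 hj
    rw [postJump_of_jumpsTo h hj, indicator_of_mem (mem_iUnion.2 ⟨⟨j, hj'.1⟩, hj'.2⟩)]
    simp
  · rw [postJump_of_not_jumpsTo hex, sub_self]
    refine indicator_of_notMem (fun hz => ?_) _
    obtain ⟨k, hk⟩ := mem_iUnion.1 hz
    exact hex ⟨k, (hJ k).2 ⟨k.2, hk⟩⟩

theorem BoundedRates.measurableSet_jumpsTo (h : BoundedRates lam Lam) (u : Control U) (j : ℕ) :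
    MeasurableSet {q : (ℕ × ℝ) × ℝ | JumpsTo lam u q.1 q.2 j} := by
  have hr : ∀ k, Measurable fun x : ℕ × ℝ =>
      if k ≠ x.1 then policyRate lam u x.1 k x.2 else 0 := fun k => by
    refine measurable_from_prod_countable_right fun i => ?_
    by_cases hk : k ≠ i
    · simpa [hk] using h.measurable_policyRate u (Ne.symm hk)
    · simp [hk]
  have hset : {q : (ℕ × ℝ) × ℝ | JumpsTo lam u q.1 q.2 j} = {q | j ≠ q.1.1} ∩
      ({q | (∑ k ∈ Finset.range j, if k ≠ q.1.1 then policyRate lam u q.1.1 k q.1.2 else 0) ≤ q.2}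
      ∩ {q | q.2 < (∑ k ∈ Finset.range (j + 1),
        if k ≠ q.1.1 then policyRate lam u q.1.1 k q.1.2 else 0)}) := by
    ext q
    simp only [mem_ofPred_eq, jumpsTo_iff, mem_inter_iff, Finset.sum_range_succ]
    refine and_congr_right fun hj => ?_
    rw [if_pos hj]
  rw [hset]
  refine MeasurableSet.inter ?_ (MeasurableSet.inter ?_ ?_)
  · exact (measurableSet_eq_fun measurable_const (measurable_fst.comp measurable_fst)).compl
  · exact measurableSet_le ((Finset.measurable_sum _ fun k _ => hr k).comp measurable_fst)
      measurable_snd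
  · exact measurableSet_lt measurable_snd
      ((Finset.measurable_sum _ fun k _ => hr k).comp measurable_fst)

theorem BoundedRates.measurable_postJump (h : BoundedRates lam Lam) (u : Control U) :
    Measurable fun q : (ℕ × ℝ) × ℝ => postJump lam u q.1 q.2 := by
  classical
  let p : ℕ → (ℕ × ℝ) × ℝ → Prop := fun j q =>
    JumpsTo lam u q.1 q.2 j ∨ ¬ ∃ k, JumpsTo lam u q.1 q.2 k
  have hno : MeasurableSet {q : (ℕ × ℝ) × ℝ | ¬ ∃ k, JumpsTo lam u q.1 q.2 k} := by
    have : {q : (ℕ × ℝ) × ℝ | ¬ ∃ k, JumpsTo lam u q.1 q.2 k} =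
        (⋃ k, {q : (ℕ × ℝ) × ℝ | JumpsTo lam u q.1 q.2 k})ᶜ := by
      ext q; simp
    rw [this]
    exact (MeasurableSet.iUnion fun k => h.measurableSet_jumpsTo u k).compl
  have hex : ∀ q, ∃ j, p j q := fun q => by
    by_cases hq : ∃ k, JumpsTo lam u q.1 q.2 k
    · exact hq.imp fun k hk => Or.inl hk
    · exact ⟨0, Or.inr hq⟩
  have hmeas := Measurable.find (p := p)
    (f := fun j (q : (ℕ × ℝ) × ℝ) => if JumpsTo lam u q.1 q.2 j then ((j, 0) : ℕ × ℝ) else q.1)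
    (fun j => Measurable.ite (h.measurableSet_jumpsTo u j) measurable_const measurable_fst)
    (fun j => (h.measurableSet_jumpsTo u j).union hno) hex
  convert hmeas using 2 with q
  by_cases hq : ∃ k, JumpsTo lam u q.1 q.2 k
  · have hs : p _ q := Nat.find_spec (hex q)
    have hj := hs.resolve_right (not_not.2 hq)
    rw [postJump_of_jumpsTo h hj, if_pos hj]
  · rw [postJump_of_not_jumpsTo hq, if_neg fun hj => hq ⟨_, hj⟩]

/-- The integral of `v` over the outcomes of a transition as its mark runs through `[0, Lam)`: the
marks that trigger a jump to `j` make up an interval of length `policyRate lam u x.1 j x.2`, and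
the remaining ones leave `x` unchanged. -/
theorem BoundedRates.integral_postJump (h : BoundedRates lam Lam) (hLam : 0 ≤ Lam) (u : Control U)
    (x : ℕ × ℝ) {v : ℕ × ℝ → ℝ} (hv : Measurable v) {K : ℝ} (hK : ∀ x, |v x| ≤ K) :
    ∫ z in Ico 0 Lam, v (postJump lam u x z) = Lam * v x +
      ∑' j : {j : ℕ // j ≠ x.1}, policyRate lam u x.1 j x.2 * (v (j, 0) - v x) := by
  have hm : Measurable fun z => v (postJump lam u x z) :=
    hv.comp ((h.measurable_postJump u).comp measurable_prodMk_left)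
  have hint : IntegrableOn (fun z => v (postJump lam u x z)) (Ico 0 Lam) :=
    Measure.integrableOn_of_bounded (by simp) hm.aestronglyMeasurable
      (Eventually.of_forall fun z => hK _)
  have hint2 : IntegrableOn (fun z => v (postJump lam u x z) - v x) (Ico 0 Lam) :=
    hint.sub (integrableOn_const (by simp))
  let A : {j : ℕ // j ≠ x.1} → Set ℝ := fun j => {z | JumpsTo lam u x z j}
  have hA : ∀ j : {j : ℕ // j ≠ x.1}, A j =
      jumpInterval lam x.1 j (max x.2 0) (u.1 x.1 (max x.2 0)) := by
    intro j; ext z; simp [A, JumpsTo, j.2]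
  have hAm : ∀ j, MeasurableSet (A j) := fun j => by
    rw [hA]; exact measurableSet_Ico
  have hAd : Pairwise (Function.onFun Disjoint A) := fun j k hjk => by
    rw [Function.onFun, Set.disjoint_left]
    exact fun z hz hz' => hjk (Subtype.ext (h.jumpsTo_unique hz hz'))
  have hAsub : (⋃ j, A j) ⊆ Ico 0 Lam := iUnion_subset fun j z hz => h.mem_Ico_of_jumpsTo hz
  have h1 : ∫ z in Ico 0 Lam, (v (postJump lam u x z) - v x) =
      ∫ z in ⋃ j, A j, (v (postJump lam u x z) - v x) := by
    refine setIntegral_eq_of_subset_of_forall_sdiff_eq_zero measurableSet_Ico hAsub ?_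
    rintro z ⟨-, hz⟩
    rw [postJump_of_not_jumpsTo, sub_self]
    rintro ⟨j, hj⟩
    exact hz (mem_iUnion.2 ⟨⟨j, hj.1⟩, hj⟩)
  have h2 := (hasSum_integral_iUnion hAm hAd (hint2.mono_set hAsub)).tsum_eq
  rw [← h1, integral_sub hint (integrableOn_const (by simp)), setIntegral_const] at h2
  have h3 : ∀ j, ∫ z in A j, (v (postJump lam u x z) - v x) =
      policyRate lam u x.1 j x.2 * (v (j, 0) - v x) := by
    intro j
    have : ∫ z in A j, (v (postJump lam u x z) - v x) = ∫ z in A j, (v (j, 0) - v x) :=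
      setIntegral_congr_fun (hAm j) fun z hz => by
        simp only [postJump_of_jumpsTo h (show JumpsTo lam u x z j from hz)]
    rw [this, setIntegral_const, hA, smul_eq_mul, jumpInterval, Measure.real, Real.volume_Ico,
      add_sub_cancel_left, ENNReal.toReal_ofReal
        (h.relaxedRate_nonneg (Ne.symm j.2) (le_max_right _ _) _)]
    rfl
  simp_rw [h3] at h2
  rw [h2]
  simp [Measure.real, hLam]

end Rates

/-! ### Paths of the controlled process -/

section Path

theorem IsCadlag.tendsto_leftLim {F : Type*} [TopologicalSpace F] [T2Space F] {x : ℝ → F}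
    (hx : IsCadlag x) {t : ℝ} (ht : 0 < t) : Tendsto x (𝓝[<] t) (𝓝 (Function.leftLim x t)) := by
  obtain ⟨l, hl⟩ := hx.2 t ht
  rwa [leftLim_eq_of_tendsto hl]

variable {ν : Measure (ℝ × ℝ)} {Lam : ℝ}

/-- A function vanishing off the strip has integral zero over a time interval without points. -/
theorem integral_strip_of_empty {f : ℝ × ℝ → ℝ} {s t : ℝ}
    (hf : ∀ p : ℝ × ℝ, p.1 ∈ Ioc s t → p.2 ∉ Ico 0 Lam → f p = 0) (h : ν (cell Lam s t) = 0) :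
    IntegrableOn f (Ioc s t ×ˢ univ) ν ∧ ∫ p in Ioc s t ×ˢ univ, f p ∂ν = 0 := by
  have hz : ∀ p ∈ (Ioc s t ×ˢ univ : Set (ℝ × ℝ)) \ cell Lam s t, f p = 0 := by
    rintro p ⟨hp, hp'⟩
    exact hf p hp.1 fun h2 => hp' ⟨hp.1, h2⟩
  have hsub : cell Lam s t ⊆ Ioc s t ×ˢ univ := prod_mono le_rfl (subset_univ _)
  have hm : MeasurableSet (Ioc s t ×ˢ univ : Set (ℝ × ℝ)) :=
    measurableSet_Ioc.prod MeasurableSet.univ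
  constructor
  · refine IntegrableOn.of_forall_sdiff_eq_zero (s := cell Lam s t) ?_ hm hz
    rw [IntegrableOn, Measure.restrict_eq_zero.2 h]
    exact integrable_zero_measure
  · rw [setIntegral_eq_of_subset_of_forall_sdiff_eq_zero hm hsub hz, Measure.restrict_eq_zero.2 h,
      integral_zero_measure]

/-- A function vanishing off the strip has integral `f p` over a time interval whose only point
is `p`. -/
theorem integral_strip_of_single {f : ℝ × ℝ → ℝ} {s t : ℝ}
    (hf : ∀ p : ℝ × ℝ, p.1 ∈ Ioc s t → p.2 ∉ Ico 0 Lam → f p = 0) {p : ℝ × ℝ}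
    (h : ν.restrict (cell Lam s t) = Measure.dirac p) :
    IntegrableOn f (Ioc s t ×ˢ univ) ν ∧ ∫ p in Ioc s t ×ˢ univ, f p ∂ν = f p := by
  have hz : ∀ p ∈ (Ioc s t ×ˢ univ : Set (ℝ × ℝ)) \ cell Lam s t, f p = 0 := by
    rintro p ⟨hp, hp'⟩
    exact hf p hp.1 fun h2 => hp' ⟨hp.1, h2⟩
  have hsub : cell Lam s t ⊆ Ioc s t ×ˢ univ := prod_mono le_rfl (subset_univ _)
  have hm : MeasurableSet (Ioc s t ×ˢ univ : Set (ℝ × ℝ)) :=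
    measurableSet_Ioc.prod MeasurableSet.univ
  constructor
  · refine IntegrableOn.of_forall_sdiff_eq_zero (s := cell Lam s t) ?_ hm hz
    rw [IntegrableOn, h]
    exact integrable_dirac (by simp)
  · rw [setIntegral_eq_of_subset_of_forall_sdiff_eq_zero hm hsub hz, h, integral_dirac]

/-- The time interval `(s, t]` carries at most one point of `ν` in the strip. -/
def IsSparse (Lam : ℝ) (ν : Measure (ℝ × ℝ)) (s t : ℝ) : Prop :=
  ν (cell Lam s t) = 0 ∨ ∃ p ∈ cell Lam s t, ν.restrict (cell Lam s t) = Measure.dirac p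

theorem cell_mono {s t s' t' : ℝ} (hs : s ≤ s') (ht : t' ≤ t) :
    cell Lam s' t' ⊆ cell Lam s t :=
  prod_mono (Ioc_subset_Ioc hs ht) le_rfl

theorem restrict_cell_of_mem {s t s' t' : ℝ} (hs : s ≤ s') (ht : t' ≤ t) {p : ℝ × ℝ}
    (h : ν.restrict (cell Lam s t) = Measure.dirac p) (hp : p ∈ cell Lam s' t') :
    ν.restrict (cell Lam s' t') = Measure.dirac p := by
  classical
  rw [← Measure.restrict_restrict_of_subset (cell_mono hs ht), h,
    restrict_dirac' (measurableSet_cell _ _ _), if_pos hp]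

theorem cell_eq_zero_of_notMem {s t s' t' : ℝ} (hs : s ≤ s') (ht : t' ≤ t) {p : ℝ × ℝ}
    (h : ν.restrict (cell Lam s t) = Measure.dirac p) (hp : p ∉ cell Lam s' t') :
    ν (cell Lam s' t') = 0 := by
  rw [← Measure.restrict_eq_self ν (cell_mono hs ht), h,
    Measure.dirac_apply' _ (measurableSet_cell _ _ _), indicator_of_notMem hp]

theorem IsSparse.mass_le_one {s t : ℝ} (h : IsSparse Lam ν s t) : ν (cell Lam s t) ≤ 1 := by
  rcases h with h | ⟨p, hp, h⟩
  · simp [h]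
  · rw [← Measure.restrict_apply_self, h]; exact prob_le_one

variable {U : Type*} [MetricSpace U] [CompactSpace U] [MeasurableSpace U] [BorelSpace U]
  {lam : ℕ → ℕ → ℝ → U → ℝ} {u : Control U} {i : ℕ} {x : ℝ → ℕ} {a : ℝ → ℝ}

/-- `(x, a)` is a path of state and age driven by the realization `ν` of the noise and started
in `(i, 0)`. -/
structure IsPath (lam : ℕ → ℕ → ℝ → U → ℝ) (u : Control U) (ν : Measure (ℝ × ℝ)) (i : ℕ)
    (x : ℝ → ℕ) (a : ℝ → ℝ) : Prop where
  state_cadlag : IsCadlag x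
  age_cadlag : IsCadlag a
  state_equation : ∀ t, 0 ≤ t → IntegrableOn (stateJumpAlong lam u x a) (Ioc 0 t ×ˢ univ) ν ∧
    (x t : ℝ) = i + ∫ p in Ioc 0 t ×ˢ univ, stateJumpAlong lam u x a p ∂ν
  age_equation : ∀ t, 0 ≤ t → IntegrableOn (ageJumpAlong lam u x a) (Ioc 0 t ×ˢ univ) ν ∧
    a t = 0 + t - ∫ p in Ioc 0 t ×ˢ univ, ageJumpAlong lam u x a p ∂ν

theorem setIntegral_Ioc_prod_union {f : ℝ × ℝ → ℝ} {s t : ℝ} (hs : 0 ≤ s) (hst : s ≤ t)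
    (hf : IntegrableOn f (Ioc 0 s ×ˢ univ) ν) (hf' : IntegrableOn f (Ioc s t ×ˢ univ) ν) :
    IntegrableOn f (Ioc 0 t ×ˢ univ) ν ∧ ∫ p in Ioc 0 t ×ˢ univ, f p ∂ν =
      ∫ p in Ioc 0 s ×ˢ univ, f p ∂ν + ∫ p in Ioc s t ×ˢ univ, f p ∂ν := by
  have hU : (Ioc 0 t ×ˢ univ : Set (ℝ × ℝ)) = Ioc 0 s ×ˢ univ ∪ Ioc s t ×ˢ univ := by
    rw [← union_prod, Ioc_union_Ioc_eq_Ioc hs hst]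
  have hd : Disjoint (Ioc 0 s ×ˢ univ : Set (ℝ × ℝ)) (Ioc s t ×ˢ univ) :=
    Disjoint.set_prod_left (Ioc_disjoint_Ioc_of_le le_rfl) _ _
  rw [hU]
  exact ⟨hf.union hf', setIntegral_union hd (measurableSet_Ioc.prod MeasurableSet.univ) hf hf'⟩

theorem IsPath.state_increment (hp : IsPath lam u ν i x a) {s t : ℝ} (hs : 0 ≤ s) (hst : s ≤ t) :
    (x t : ℝ) = x s + ∫ p in Ioc s t ×ˢ univ, stateJumpAlong lam u x a p ∂ν := by
  have h1 := hp.state_equation s hs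
  have h2 := hp.state_equation t (hs.trans hst)
  have h3 := (setIntegral_Ioc_prod_union hs hst h1.1
    (h2.1.mono_set (prod_mono (Ioc_subset_Ioc_left hs) le_rfl))).2
  linarith [h1.2, h2.2]

theorem IsPath.age_increment (hp : IsPath lam u ν i x a) {s t : ℝ} (hs : 0 ≤ s) (hst : s ≤ t) :
    a t = a s + (t - s) - ∫ p in Ioc s t ×ˢ univ, ageJumpAlong lam u x a p ∂ν := by
  have h1 := hp.age_equation s hs
  have h2 := hp.age_equation t (hs.trans hst)
  have h3 := (setIntegral_Ioc_prod_union hs hst h1.1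
    (h2.1.mono_set (prod_mono (Ioc_subset_Ioc_left hs) le_rfl))).2
  linarith [h1.2, h2.2]

theorem IsPath.state_zero (hp : IsPath lam u ν i x a) : x 0 = i := by
  simpa using (hp.state_equation 0 le_rfl).2

theorem IsPath.age_zero (hp : IsPath lam u ν i x a) : a 0 = 0 := by
  simpa using (hp.age_equation 0 le_rfl).2

/-- The integral over the shrinking time intervals `(s, t]` tends to the integral over the
slice `{t} × ℝ` as `s` increases to `t`. -/
theorem tendsto_setIntegral_left {f : ℝ × ℝ → ℝ} {t : ℝ} (ht : 0 < t)
    (hf : IntegrableOn f (Ioc 0 t ×ˢ univ) ν) :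
    Tendsto (fun s => ∫ p in Ioc s t ×ˢ univ, f p ∂ν) (𝓝[<] t)
      (𝓝 (∫ p in {t} ×ˢ univ, f p ∂ν)) := by
  have hm : ∀ s, MeasurableSet (Ioc s t ×ˢ univ : Set (ℝ × ℝ)) := fun s =>
    measurableSet_Ioc.prod MeasurableSet.univ
  have hm' : MeasurableSet ({t} ×ˢ univ : Set (ℝ × ℝ)) :=
    (measurableSet_singleton t).prod MeasurableSet.univ
  have hev : ∀ᶠ s in 𝓝[<] t, 0 ≤ s :=
    (eventually_gt_nhds ht).filter_mono nhdsWithin_le_nhds |>.mono fun s hs => hs.le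
  have h1 : Tendsto (fun s => ∫ p in Ioc 0 t ×ˢ univ, (Ioc s t ×ˢ univ).indicator f p ∂ν) (𝓝[<] t)
      (𝓝 (∫ p in Ioc 0 t ×ˢ univ, ({t} ×ˢ univ).indicator f p ∂ν)) := by
    refine tendsto_integral_filter_of_dominated_convergence (fun p => ‖f p‖) ?_ ?_ hf.norm ?_
    · exact Eventually.of_forall fun s => hf.aestronglyMeasurable.indicator (hm s)
    · exact Eventually.of_forall fun s => Eventually.of_forall fun p =>
        norm_indicator_le_norm_self _ _
    · refine (ae_restrict_iff' (hm 0)).2 (Eventually.of_forall fun p hp => ?_)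
      rcases hp.1.2.eq_or_lt with h | h
      · have h1 : p ∈ ({t} ×ˢ univ : Set (ℝ × ℝ)) := ⟨h, mem_univ _⟩
        refine tendsto_const_nhds.congr' ?_
        filter_upwards [self_mem_nhdsWithin] with s hs
        have h2 : p ∈ (Ioc s t ×ˢ univ : Set (ℝ × ℝ)) := ⟨⟨h ▸ hs, h.le⟩, mem_univ _⟩
        rw [indicator_of_mem h1, indicator_of_mem h2]
      · have h1 : p ∉ ({t} ×ˢ univ : Set (ℝ × ℝ)) := fun h' => h.ne h'.1
        refine tendsto_const_nhds.congr' ?_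
        filter_upwards [(eventually_gt_nhds h).filter_mono nhdsWithin_le_nhds] with s hs
        have h2 : p ∉ (Ioc s t ×ˢ univ : Set (ℝ × ℝ)) := fun h' => hs.not_gt h'.1.1
        rw [indicator_of_notMem h1, indicator_of_notMem h2]
  rw [setIntegral_indicator hm', prod_inter_prod, inter_univ] at h1
  rw [inter_eq_right.2 (show ({t} : Set ℝ) ⊆ Ioc 0 t by simpa using ht)] at h1
  refine h1.congr' ?_
  filter_upwards [hev] with s hs
  rw [setIntegral_indicator (hm s), prod_inter_prod, inter_univ,
    inter_eq_right.2 (Ioc_subset_Ioc_left hs)]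

/-- The age never becomes negative. Below zero the drift and the jumps only increase the age, so
that it would have to enter the negative half-line by a jump; but a jump from a nonnegative age
leads to age `0`, as the noise has at most one point at a time. -/
theorem IsPath.age_nonneg (h : BoundedRates lam Lam) (hp : IsPath lam u ν i x a)
    (hν : ∀ t, 0 < t → ν ({t} ×ˢ Ico 0 Lam) ≤ 1) {t : ℝ} (ht : 0 ≤ t) : 0 ≤ a t := by
  by_contra! hneg
  let S : Set ℝ := {s | s ∈ Icc 0 t ∧ 0 ≤ a s}
  have h0S : (0 : ℝ) ∈ S := ⟨⟨le_rfl, ht⟩, hp.age_zero.ge⟩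
  have hbdd : BddAbove S := ⟨t, fun s hs => hs.1.2⟩
  set σ := sSup S with hσ
  have hσ0 : 0 ≤ σ := le_csSup hbdd h0S
  have hσt : σ ≤ t := csSup_le ⟨0, h0S⟩ fun s hs => hs.1.2
  have hafter : ∀ r, σ < r → r ≤ t → a r < 0 := by
    intro r hr hrt
    by_contra! hr0
    exact hr.not_ge (le_csSup hbdd ⟨⟨hσ0.trans hr.le, hrt⟩, hr0⟩)
  have hσneg : a σ < 0 := by
    have hinc := hp.age_increment hσ0 hσt
    have hle : ∫ p in Ioc σ t ×ˢ univ, ageJumpAlong lam u x a p ∂ν ≤ 0 := by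
      refine setIntegral_nonpos (measurableSet_Ioc.prod MeasurableSet.univ) fun p hp' => ?_
      have hl : Function.leftLim a p.1 ≤ 0 := by
        refine le_of_tendsto (hp.age_cadlag.tendsto_leftLim (hσ0.trans_lt hp'.1.1)) ?_
        filter_upwards [Ioo_mem_nhdsLT hp'.1.1] with r hr
        exact (hafter r hr.1 (hr.2.le.trans hp'.1.2)).le
      unfold ageJumpAlong ageJump
      exact indicator_apply_le' (fun _ => hl) fun _ => le_rfl
    linarith
  have hσpos : 0 < σ := by
    refine hσ0.lt_of_ne fun h' => ?_
    rw [← h', hp.age_zero] at hσneg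
    exact hσneg.false
  have hlim := hp.age_cadlag.tendsto_leftLim hσpos
  set l := Function.leftLim a σ with hl
  -- the age is nonnegative at times arbitrarily close to `σ` on the left
  have hl0 : 0 ≤ l := by
    refine ge_of_tendsto_of_frequently hlim ?_
    rw [frequently_iff]
    intro V hV
    obtain ⟨r, hr, hrV⟩ := (mem_nhdsLT_iff_exists_Ioo_subset).1 hV
    obtain ⟨s, hs, hrs⟩ := exists_lt_of_lt_csSup ⟨0, h0S⟩ (show r < sSup S from hr)
    have hsσ : s ≠ σ := fun h' => by
      have := hs.2
      rw [h'] at this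
      exact hσneg.not_ge this
    exact ⟨s, hrV ⟨hrs, (le_csSup hbdd hs).lt_of_ne hsσ⟩, hs.2⟩
  have hjump : a σ = l - ∫ p in {σ} ×ˢ univ, ageJumpAlong lam u x a p ∂ν := by
    have h1 : Tendsto (fun s => a s + (σ - s) - ∫ p in Ioc s σ ×ˢ univ,
        ageJumpAlong lam u x a p ∂ν) (𝓝[<] σ)
        (𝓝 (l + (σ - σ) - ∫ p in {σ} ×ˢ univ, ageJumpAlong lam u x a p ∂ν)) := by
      refine Tendsto.sub (hlim.add ?_) (tendsto_setIntegral_left hσpos (hp.age_equation σ hσ0).1)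
      exact ((continuous_const.sub continuous_id).tendsto σ).mono_left nhdsWithin_le_nhds
    have h2 : Tendsto (fun s => a s + (σ - s) - ∫ p in Ioc s σ ×ˢ univ,
        ageJumpAlong lam u x a p ∂ν) (𝓝[<] σ) (𝓝 (a σ)) := by
      refine tendsto_const_nhds.congr' ?_
      filter_upwards [Ioo_mem_nhdsLT hσpos] with s hs
      exact hp.age_increment hs.1.le hs.2.le
    rw [tendsto_nhds_unique h2 h1, sub_self, add_zero]
  have hval : ∫ p in {σ} ×ˢ univ, ageJumpAlong lam u x a p ∂ν ≤ l := by
    set A : Set ℝ := ⋃ j : {j : ℕ // j ≠ Function.leftLim x σ},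
      jumpInterval lam (Function.leftLim x σ) j l (u.1 (Function.leftLim x σ) l) with hA
    have hAm : MeasurableSet A := MeasurableSet.iUnion fun j => measurableSet_Ico
    have hAsub : A ⊆ Ico 0 Lam := by
      refine iUnion_subset fun j z hz => ?_
      refine h.mem_Ico_of_jumpsTo (u := u) (x := (Function.leftLim x σ, l)) (j := j) ⟨j.2, ?_⟩
      simpa only [max_eq_left hl0] using hz
    have hmσ : MeasurableSet ({σ} ×ˢ univ : Set (ℝ × ℝ)) :=
      (measurableSet_singleton σ).prod MeasurableSet.univ
    have heq : ∫ p in {σ} ×ˢ univ, ageJumpAlong lam u x a p ∂ν =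
        ∫ p in {σ} ×ˢ univ, (univ ×ˢ A).indicator (fun _ => l) p ∂ν := by
      refine setIntegral_congr_fun hmσ fun p hp' => ?_
      have hp1 : p.1 = σ := hp'.1
      have hpA : ageJumpAlong lam u x a p = A.indicator (fun _ => l) p.2 := by
        rw [ageJumpAlong, ageJump, hp1]
      by_cases hpm : p.2 ∈ A
      · rw [hpA, indicator_of_mem (show p ∈ (univ ×ˢ A : Set (ℝ × ℝ)) from ⟨mem_univ _, hpm⟩),
          indicator_of_mem hpm]
      · rw [hpA, indicator_of_notMem (show p ∉ (univ ×ˢ A : Set (ℝ × ℝ)) from fun h' => hpm h'.2),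
          indicator_of_notMem hpm]
    have hle : ν ({σ} ×ˢ A) ≤ 1 :=
      (measure_mono (prod_mono le_rfl hAsub)).trans (hν σ hσpos)
    rw [heq, setIntegral_indicator (MeasurableSet.univ.prod hAm), prod_inter_prod, inter_univ,
      univ_inter, setIntegral_const, smul_eq_mul]
    have : ν.real ({σ} ×ˢ A) ≤ 1 := by
      exact ENNReal.toReal_mono ENNReal.one_ne_top hle
    nlinarith
  linarith

theorem leftLim_age_nonneg (ha : IsCadlag a) (hn : ∀ t, 0 ≤ t → 0 ≤ a t) {t : ℝ} (ht : 0 < t) :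
    0 ≤ Function.leftLim a t := by
  refine ge_of_tendsto (ha.tendsto_leftLim ht) ?_
  filter_upwards [Ioo_mem_nhdsLT ht] with r hr
  exact hn r hr.1.le

theorem BoundedRates.stateJumpAlong_eq (h : BoundedRates lam Lam) (ha : IsCadlag a)
    (hn : ∀ t, 0 ≤ t → 0 ≤ a t) {p : ℝ × ℝ} (hp : 0 < p.1) :
    stateJumpAlong lam u x a p =
      ((postJump lam u (Function.leftLim x p.1, Function.leftLim a p.1) p.2).1 : ℝ) -
        Function.leftLim x p.1 :=
  h.stateJump_eq u _ (leftLim_age_nonneg ha hn hp) _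

theorem BoundedRates.ageJumpAlong_eq (h : BoundedRates lam Lam) (ha : IsCadlag a)
    (hn : ∀ t, 0 ≤ t → 0 ≤ a t) {p : ℝ × ℝ} (hp : 0 < p.1) :
    ageJumpAlong lam u x a p = Function.leftLim a p.1 -
      (postJump lam u (Function.leftLim x p.1, Function.leftLim a p.1) p.2).2 :=
  h.ageJump_eq u _ (leftLim_age_nonneg ha hn hp) _

theorem BoundedRates.stateJumpAlong_eq_zero (h : BoundedRates lam Lam) (ha : IsCadlag a)
    (hn : ∀ t, 0 ≤ t → 0 ≤ a t) {p : ℝ × ℝ} (hp : 0 < p.1) (hz : p.2 ∉ Ico 0 Lam) :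
    stateJumpAlong lam u x a p = 0 := by
  rw [h.stateJumpAlong_eq ha hn hp, h.postJump_of_notMem hz, sub_self]

theorem BoundedRates.ageJumpAlong_eq_zero (h : BoundedRates lam Lam) (ha : IsCadlag a)
    (hn : ∀ t, 0 ≤ t → 0 ≤ a t) {p : ℝ × ℝ} (hp : 0 < p.1) (hz : p.2 ∉ Ico 0 Lam) :
    ageJumpAlong lam u x a p = 0 := by
  rw [h.ageJumpAlong_eq ha hn hp, h.postJump_of_notMem hz, sub_self]

theorem IsPath.eq_of_empty (h : BoundedRates lam Lam) (hp : IsPath lam u ν i x a)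
    (hn : ∀ t, 0 ≤ t → 0 ≤ a t) {s t : ℝ} (hs : 0 ≤ s) (hst : s ≤ t)
    (hν : ν (cell Lam s t) = 0) : x t = x s ∧ a t = a s + (t - s) := by
  constructor
  · have h1 := hp.state_increment hs hst
    rw [(integral_strip_of_empty (fun p hp' hz => h.stateJumpAlong_eq_zero hp.age_cadlag hn
      (hs.trans_lt hp'.1) hz) hν).2, add_zero] at h1
    exact_mod_cast h1
  · rw [hp.age_increment hs hst, (integral_strip_of_empty (fun p hp' hz =>
      h.ageJumpAlong_eq_zero hp.age_cadlag hn (hs.trans_lt hp'.1) hz) hν).2, sub_zero]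

/-- State and age at time `t`, if they are given by `y` at time `s` and the noise has the single
point `p` in between. -/
noncomputable def afterPoint (lam : ℕ → ℕ → ℝ → U → ℝ) (u : Control U) (s t : ℝ) (y : ℕ × ℝ)
    (p : ℝ × ℝ) : ℕ × ℝ :=
  ((postJump lam u (y.1, y.2 + (p.1 - s)) p.2).1,
    (postJump lam u (y.1, y.2 + (p.1 - s)) p.2).2 + (t - p.1))

theorem tendsto_left_of_eventually_linear {s σ : ℝ} (hsσ : s < σ)
    (hx : ∀ r, s ≤ r → r < σ → x r = x s) (ha : ∀ r, s ≤ r → r < σ → a r = a s + (r - s)) :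
    Tendsto x (𝓝[<] σ) (𝓝 (x s)) ∧ Tendsto a (𝓝[<] σ) (𝓝 (a s + (σ - s))) := by
  constructor
  · refine tendsto_const_nhds.congr' ?_
    filter_upwards [Ioo_mem_nhdsLT hsσ] with r hr
    exact (hx r hr.1.le hr.2).symm
  · have : Tendsto (fun r => a s + (r - s)) (𝓝[<] σ) (𝓝 (a s + (σ - s))) :=
      ((continuous_const.add (continuous_id.sub continuous_const)).tendsto σ).mono_left
        nhdsWithin_le_nhds
    refine this.congr' ?_
    filter_upwards [Ioo_mem_nhdsLT hsσ] with r hr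
    exact (ha r hr.1.le hr.2).symm

theorem IsPath.eq_of_single (h : BoundedRates lam Lam) (hp : IsPath lam u ν i x a)
    (hn : ∀ t, 0 ≤ t → 0 ≤ a t) {s t : ℝ} (hs : 0 ≤ s) {p : ℝ × ℝ} (hpc : p ∈ cell Lam s t)
    (hν : ν.restrict (cell Lam s t) = Measure.dirac p) :
    (x t, a t) = afterPoint lam u s t (x s, a s) p := by
  have hst : s ≤ t := hpc.1.1.le.trans hpc.1.2
  have hp0 : 0 < p.1 := hs.trans_lt hpc.1.1
  have hbefore : ∀ r, s ≤ r → r < p.1 → x r = x s ∧ a r = a s + (r - s) := fun r hr hrp =>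
    hp.eq_of_empty h hn hs hr (cell_eq_zero_of_notMem le_rfl (hrp.le.trans hpc.1.2) hν
      fun h' => hrp.not_ge h'.1.2)
  obtain ⟨hlx, hla⟩ := tendsto_left_of_eventually_linear hpc.1.1
    (fun r hr hrp => (hbefore r hr hrp).1) fun r hr hrp => (hbefore r hr hrp).2
  have hlx' := leftLim_eq_of_tendsto hlx
  have hla' := leftLim_eq_of_tendsto hla
  have h1 := hp.state_increment hs hst
  have h2 := hp.age_increment hs hst
  rw [(integral_strip_of_single (fun p hp' hz => h.stateJumpAlong_eq_zero hp.age_cadlag hn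
      (hs.trans_lt hp'.1) hz) hν).2, h.stateJumpAlong_eq hp.age_cadlag hn hp0, hlx', hla'] at h1
  rw [(integral_strip_of_single (fun p hp' hz => h.ageJumpAlong_eq_zero hp.age_cadlag hn
      (hs.trans_lt hp'.1) hz) hν).2, h.ageJumpAlong_eq hp.age_cadlag hn hp0, hlx', hla'] at h2
  refine Prod.ext ?_ ?_
  · have : (x t : ℝ) = ((postJump lam u (x s, a s + (p.1 - s)) p.2).1 : ℝ) := by linarith
    exact_mod_cast this
  · simp only [afterPoint]
    linarith

/-! ### Construction of paths -/

/-- A path up to time `b`, continued beyond `b` with constant state and linearly growing age. -/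
structure IsPathUpTo (lam : ℕ → ℕ → ℝ → U → ℝ) (u : Control U) (ν : Measure (ℝ × ℝ)) (i : ℕ)
    (b : ℝ) (x : ℝ → ℕ) (a : ℝ → ℝ) : Prop where
  state_cadlag : IsCadlag x
  age_cadlag : IsCadlag a
  age_nonneg : ∀ t, 0 ≤ t → 0 ≤ a t
  state_after : ∀ t, b ≤ t → x t = x b
  age_after : ∀ t, b ≤ t → a t = a b + (t - b)
  state_equation : ∀ t, 0 ≤ t → t ≤ b →
    IntegrableOn (stateJumpAlong lam u x a) (Ioc 0 t ×ˢ univ) ν ∧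
    (x t : ℝ) = i + ∫ p in Ioc 0 t ×ˢ univ, stateJumpAlong lam u x a p ∂ν
  age_equation : ∀ t, 0 ≤ t → t ≤ b →
    IntegrableOn (ageJumpAlong lam u x a) (Ioc 0 t ×ˢ univ) ν ∧
    a t = 0 + t - ∫ p in Ioc 0 t ×ˢ univ, ageJumpAlong lam u x a p ∂ν

theorem isPathUpTo_zero (lam : ℕ → ℕ → ℝ → U → ℝ) (u : Control U) (ν : Measure (ℝ × ℝ)) (i : ℕ) :
    IsPathUpTo lam u ν i 0 (fun _ => i) (fun t => t) where
  state_cadlag := ⟨fun _ _ => continuousWithinAt_const, fun _ _ => ⟨i, tendsto_const_nhds⟩⟩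
  age_cadlag := ⟨fun _ _ => continuousWithinAt_id,
    fun t _ => ⟨t, tendsto_id.mono_left nhdsWithin_le_nhds⟩⟩
  age_nonneg := fun _ ht => ht
  state_after := fun _ _ => rfl
  age_after := fun t _ => by simp
  state_equation := fun t h0 h1 => by
    obtain rfl := le_antisymm h1 h0
    simp
  age_equation := fun t h0 h1 => by
    obtain rfl := le_antisymm h1 h0
    simp

theorem IsPathUpTo.extend_of_empty (h : BoundedRates lam Lam) {b b' : ℝ}
    (hp : IsPathUpTo lam u ν i b x a) (hb : 0 ≤ b) (hbb' : b ≤ b') (hν : ν (cell Lam b b') = 0) :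
    IsPathUpTo lam u ν i b' x a where
  state_cadlag := hp.state_cadlag
  age_cadlag := hp.age_cadlag
  age_nonneg := hp.age_nonneg
  state_after := fun t ht => by rw [hp.state_after t (hbb'.trans ht), hp.state_after b' hbb']
  age_after := fun t ht => by
    rw [hp.age_after t (hbb'.trans ht), hp.age_after b' hbb']; ring
  state_equation := fun t h0 h1 => by
    rcases le_total t b with htb | htb
    · exact hp.state_equation t h0 htb
    obtain ⟨hi, he⟩ := integral_strip_of_empty (fun p hp' hz =>
      h.stateJumpAlong_eq_zero (u := u) (x := x) hp.age_cadlag hp.age_nonneg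
        (hb.trans_lt hp'.1) hz) (measure_mono_null (cell_mono le_rfl h1) hν)
    obtain ⟨hi', he'⟩ := hp.state_equation b hb le_rfl
    obtain ⟨hu, hs⟩ := setIntegral_Ioc_prod_union hb htb hi' hi
    exact ⟨hu, by rw [hs, he, add_zero, hp.state_after t htb, he']⟩
  age_equation := fun t h0 h1 => by
    rcases le_total t b with htb | htb
    · exact hp.age_equation t h0 htb
    obtain ⟨hi, he⟩ := integral_strip_of_empty (fun p hp' hz =>
      h.ageJumpAlong_eq_zero (u := u) (x := x) hp.age_cadlag hp.age_nonneg
        (hb.trans_lt hp'.1) hz) (measure_mono_null (cell_mono le_rfl h1) hν)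
    obtain ⟨hi', he'⟩ := hp.age_equation b hb le_rfl
    obtain ⟨hu, hs⟩ := setIntegral_Ioc_prod_union hb htb hi' hi
    exact ⟨hu, by rw [hs, he, add_zero, hp.age_after t htb, he']; ring⟩

/-- Paths that agree before `σ` have the same left limits, and hence the same jumps, up to and
including time `σ`. -/
theorem leftLim_congr {F : Type*} [TopologicalSpace F] [T2Space F] {x x' : ℝ → F}
    (hx : IsCadlag x) {σ t : ℝ} (ht : 0 < t) (htσ : t ≤ σ) (hxx : ∀ r < σ, x' r = x r) :
    Function.leftLim x' t = Function.leftLim x t := by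
  refine leftLim_eq_of_tendsto ((hx.tendsto_leftLim ht).congr' ?_)
  filter_upwards [self_mem_nhdsWithin] with r hr
  exact (hxx r (lt_of_lt_of_le hr htσ)).symm

theorem stateJumpAlong_congr {x' : ℝ → ℕ} {a' : ℝ → ℝ} (hx : IsCadlag x) (ha : IsCadlag a)
    {σ : ℝ} (hxx : ∀ r < σ, x' r = x r) (haa : ∀ r < σ, a' r = a r) {p : ℝ × ℝ}
    (hp : p.1 ∈ Ioc 0 σ) : stateJumpAlong lam u x' a' p = stateJumpAlong lam u x a p := by
  rw [stateJumpAlong, stateJumpAlong, leftLim_congr hx hp.1 hp.2 hxx,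
    leftLim_congr ha hp.1 hp.2 haa]

theorem ageJumpAlong_congr {x' : ℝ → ℕ} {a' : ℝ → ℝ} (hx : IsCadlag x) (ha : IsCadlag a)
    {σ : ℝ} (hxx : ∀ r < σ, x' r = x r) (haa : ∀ r < σ, a' r = a r) {p : ℝ × ℝ}
    (hp : p.1 ∈ Ioc 0 σ) : ageJumpAlong lam u x' a' p = ageJumpAlong lam u x a p := by
  rw [ageJumpAlong, ageJumpAlong, leftLim_congr hx hp.1 hp.2 hxx,
    leftLim_congr ha hp.1 hp.2 haa]

theorem isCadlag_glue {F : Type*} [TopologicalSpace F] {x y : ℝ → F} (hx : IsCadlag x)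
    (hy : Continuous y) (σ : ℝ) : IsCadlag fun t => if t < σ then x t else y t := by
  constructor
  · intro t ht
    rcases lt_or_ge t σ with hts | hts
    · refine ((hx.1 t ht).congr_of_eventuallyEq ?_ (by simp [hts]))
      filter_upwards [(eventually_lt_nhds hts).filter_mono nhdsWithin_le_nhds] with r hr
      simp [hr]
    · refine (hy.continuousWithinAt.congr_of_eventuallyEq ?_ (by simp [hts]))
      filter_upwards [self_mem_nhdsWithin] with r hr
      simp [hts.trans hr]
  · intro t ht
    rcases le_or_gt t σ with hts | hts
    · obtain ⟨l, hl⟩ := hx.2 t ht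
      refine ⟨l, hl.congr' ?_⟩
      filter_upwards [self_mem_nhdsWithin] with r hr
      have : r < σ := lt_of_lt_of_le hr hts
      simp [this]
    · refine ⟨y t, ((hy.tendsto t).mono_left nhdsWithin_le_nhds).congr' ?_⟩
      filter_upwards [(eventually_gt_nhds hts).filter_mono nhdsWithin_le_nhds] with r hr
      have : ¬ r < σ := hr.le.not_gt
      simp [this]

/-- A path up to time `b` extends through an interval with at most one point: it is left as it is
before the point, and restarted at the point with the state and age after the transition. -/
theorem IsPathUpTo.extend (h : BoundedRates lam Lam) {b b' : ℝ}
    (hp : IsPathUpTo lam u ν i b x a) (hb : 0 ≤ b) (hbb' : b ≤ b') (hν : IsSparse Lam ν b b') :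
    ∃ x' a', IsPathUpTo lam u ν i b' x' a' ∧ ∀ t ≤ b, x' t = x t ∧ a' t = a t := by
  rcases hν with hν | ⟨p, hpc, hν⟩
  · exact ⟨x, a, hp.extend_of_empty h hb hbb' hν, fun t _ => ⟨rfl, rfl⟩⟩
  have hbσ : b < p.1 := hpc.1.1
  have hσb : p.1 ≤ b' := hpc.1.2
  have hσ0 : 0 < p.1 := hb.trans_lt hbσ
  set q := postJump lam u (x b, a b + (p.1 - b)) p.2 with hq
  have hq0 : 0 ≤ q.2 := postJump_nonneg u
    (add_nonneg (hp.age_nonneg b hb) (sub_nonneg.2 hbσ.le)) _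
  let x' : ℝ → ℕ := fun t => if t < p.1 then x t else q.1
  let a' : ℝ → ℝ := fun t => if t < p.1 then a t else q.2 + (t - p.1)
  have hxx : ∀ r < p.1, x' r = x r := fun r hr => if_pos hr
  have haa : ∀ r < p.1, a' r = a r := fun r hr => if_pos hr
  have hxx' : ∀ r, p.1 ≤ r → x' r = q.1 := fun r hr => if_neg hr.not_gt
  have haa' : ∀ r, p.1 ≤ r → a' r = q.2 + (r - p.1) := fun r hr => if_neg hr.not_gt
  have hcx : IsCadlag x' := isCadlag_glue hp.state_cadlag continuous_const p.1
  have hca : IsCadlag a' := isCadlag_glue hp.age_cadlag (by fun_prop) p.1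
  have hna : ∀ t, 0 ≤ t → 0 ≤ a' t := by
    intro t ht
    rcases lt_or_ge t p.1 with h' | h'
    · rw [haa t h']; exact hp.age_nonneg t ht
    · rw [haa' t h']; linarith
  obtain ⟨hlx, hla⟩ := tendsto_left_of_eventually_linear (x := x') (a := a') hbσ
    (fun r hr hrp => by rw [hxx r hrp, hxx b hbσ, hp.state_after r hr])
    fun r hr hrp => by rw [haa r hrp, haa b hbσ, hp.age_after r hr]
  have hlx' := leftLim_eq_of_tendsto hlx
  have hla' := leftLim_eq_of_tendsto hla
  rw [hxx b hbσ] at hlx'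
  rw [haa b hbσ] at hla'
  have hold : ∀ t, t < p.1 → IsPathUpTo lam u ν i (max b t) x a := fun t ht =>
    hp.extend_of_empty h hb (le_max_left _ _) (cell_eq_zero_of_notMem le_rfl
      (max_le hbb' (ht.le.trans hσb)) hν fun h' => (max_lt hbσ ht).not_ge h'.1.2)
  have hm : ∀ t, MeasurableSet (Ioc 0 t ×ˢ univ : Set (ℝ × ℝ)) := fun t =>
    measurableSet_Ioc.prod MeasurableSet.univ
  have hSc : ∀ t < p.1, EqOn (stateJumpAlong lam u x' a') (stateJumpAlong lam u x a)
      (Ioc 0 t ×ˢ univ) := fun t ht r hr =>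
    stateJumpAlong_congr hp.state_cadlag hp.age_cadlag hxx haa ⟨hr.1.1, hr.1.2.trans ht.le⟩
  have hAc : ∀ t < p.1, EqOn (ageJumpAlong lam u x' a') (ageJumpAlong lam u x a)
      (Ioc 0 t ×ˢ univ) := fun t ht r hr =>
    ageJumpAlong_congr hp.state_cadlag hp.age_cadlag hxx haa ⟨hr.1.1, hr.1.2.trans ht.le⟩
  have hSe : ∀ t, 0 ≤ t → t < p.1 →
      IntegrableOn (stateJumpAlong lam u x' a') (Ioc 0 t ×ˢ univ) ν ∧
      (x t : ℝ) = i + ∫ p in Ioc 0 t ×ˢ univ, stateJumpAlong lam u x' a' p ∂ν := by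
    intro t h0 ht
    obtain ⟨hi, he⟩ := (hold t ht).state_equation t h0 (le_max_right _ _)
    rw [integrableOn_congr_fun (hSc t ht) (hm t), setIntegral_congr_fun (hm t) (hSc t ht)]
    exact ⟨hi, he⟩
  have hAe : ∀ t, 0 ≤ t → t < p.1 →
      IntegrableOn (ageJumpAlong lam u x' a') (Ioc 0 t ×ˢ univ) ν ∧
      a t = 0 + t - ∫ p in Ioc 0 t ×ˢ univ, ageJumpAlong lam u x' a' p ∂ν := by
    intro t h0 ht
    obtain ⟨hi, he⟩ := (hold t ht).age_equation t h0 (le_max_right _ _)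
    rw [integrableOn_congr_fun (hAc t ht) (hm t), setIntegral_congr_fun (hm t) (hAc t ht)]
    exact ⟨hi, he⟩
  refine ⟨x', a', ⟨hcx, hca, hna, ?_, ?_, ?_, ?_⟩, fun t ht =>
    ⟨hxx t (ht.trans_lt hbσ), haa t (ht.trans_lt hbσ)⟩⟩
  · intro t ht
    rw [hxx' t (hσb.trans ht), hxx' b' hσb]
  · intro t ht
    rw [haa' t (hσb.trans ht), haa' b' hσb]; ring
  · intro t h0 h1
    rcases lt_or_ge t p.1 with h' | h'
    · rw [hxx t h']
      exact hSe t h0 h'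
    · have hd := restrict_cell_of_mem le_rfl h1 hν (s' := b) (t' := t) ⟨⟨hbσ, h'⟩, hpc.2⟩
      obtain ⟨hi, he⟩ := integral_strip_of_single (fun p hp' hz =>
        h.stateJumpAlong_eq_zero (u := u) (x := x') hca hna (hb.trans_lt hp'.1) hz) hd
      obtain ⟨hi', he'⟩ := hSe b hb hbσ
      obtain ⟨hu, hs⟩ := setIntegral_Ioc_prod_union hb (hbσ.le.trans h') hi' hi
      refine ⟨hu, ?_⟩
      rw [hs, he, h.stateJumpAlong_eq hca hna hσ0, hlx', hla', ← hq, hxx' t h']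
      linarith
  · intro t h0 h1
    rcases lt_or_ge t p.1 with h' | h'
    · rw [haa t h']
      exact hAe t h0 h'
    · have hd := restrict_cell_of_mem le_rfl h1 hν (s' := b) (t' := t) ⟨⟨hbσ, h'⟩, hpc.2⟩
      obtain ⟨hi, he⟩ := integral_strip_of_single (fun p hp' hz =>
        h.ageJumpAlong_eq_zero (u := u) (x := x') hca hna (hb.trans_lt hp'.1) hz) hd
      obtain ⟨hi', he'⟩ := hAe b hb hbσ
      obtain ⟨hu, hs⟩ := setIntegral_Ioc_prod_union hb (hbσ.le.trans h') hi' hi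
      refine ⟨hu, ?_⟩
      rw [hs, he, h.ageJumpAlong_eq hca hna hσ0, hlx', hla', ← hq, haa' t h']
      linarith

theorem IsPathUpTo.extend_grid (h : BoundedRates lam Lam) {b : ℝ}
    (hp : IsPathUpTo lam u ν i b x a) (hb : 0 ≤ b) {g : ℕ → ℝ} (hg : Monotone g) (hg0 : g 0 = b)
    {m : ℕ} (hν : ∀ k < m, IsSparse Lam ν (g k) (g (k + 1))) :
    ∃ x' a', IsPathUpTo lam u ν i (g m) x' a' ∧ ∀ t ≤ b, x' t = x t ∧ a' t = a t := by
  induction m with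
  | zero => exact ⟨x, a, hg0 ▸ hp, fun t _ => ⟨rfl, rfl⟩⟩
  | succ m ih =>
    obtain ⟨x₁, a₁, h₁, he₁⟩ := ih fun k hk => hν k (hk.trans (Nat.lt_succ_self m))
    have hbm : b ≤ g m := hg0 ▸ hg (Nat.zero_le m)
    obtain ⟨x₂, a₂, h₂, he₂⟩ := h₁.extend h (hb.trans hbm) (hg (Nat.le_succ m))
      (hν m (Nat.lt_succ_self m))
    exact ⟨x₂, a₂, h₂, fun t ht => ⟨((he₂ t (ht.trans hbm)).1).trans (he₁ t ht).1,
      ((he₂ t (ht.trans hbm)).2).trans (he₁ t ht).2⟩⟩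

/-- If every time interval `(T, T + 1]` splits into finitely many intervals carrying at most one
point each, the noise drives a path. -/
theorem exists_isPath (h : BoundedRates lam Lam) (u : Control U) (i : ℕ)
    (hν : ∀ T : ℕ, ∃ m : ℕ, m ≠ 0 ∧ ∀ k < m,
      IsSparse Lam ν (gridPoint T (T + 1) m k) (gridPoint T (T + 1) m (k + 1))) :
    ∃ x a, IsPath lam u ν i x a := by
  have hstep : ∀ (T : ℕ) (w : {w : (ℝ → ℕ) × (ℝ → ℝ) // IsPathUpTo lam u ν i T w.1 w.2}),
      ∃ w' : {w : (ℝ → ℕ) × (ℝ → ℝ) // IsPathUpTo lam u ν i (T + 1 : ℕ) w.1 w.2},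
        ∀ t ≤ (T : ℝ), w'.1.1 t = w.1.1 t ∧ w'.1.2 t = w.1.2 t := by
    intro T w
    obtain ⟨m, hm, hs⟩ := hν T
    obtain ⟨x', a', h', he⟩ := w.2.extend_grid h (Nat.cast_nonneg T)
      (gridPoint_mono (by linarith : (T : ℝ) ≤ T + 1) m) (gridPoint_zero _ _ _) hs
    rw [gridPoint_last _ _ hm] at h'
    exact ⟨⟨(x', a'), by push_cast; exact h'⟩, he⟩
  choose next hnext using hstep
  let W : (T : ℕ) → {w : (ℝ → ℕ) × (ℝ → ℝ) // IsPathUpTo lam u ν i T w.1 w.2} := fun T =>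
    Nat.rec ⟨(fun _ => i, fun t => t), by simpa using isPathUpTo_zero lam u ν i⟩ next T
  have hW : ∀ T : ℕ, ∀ t ≤ (T : ℝ), (W (T + 1)).1.1 t = (W T).1.1 t ∧
      (W (T + 1)).1.2 t = (W T).1.2 t := fun T => hnext T (W T)
  have hW' : ∀ T S : ℕ, T ≤ S → ∀ t ≤ (T : ℝ), (W S).1.1 t = (W T).1.1 t ∧
      (W S).1.2 t = (W T).1.2 t := by
    intro T S hTS t ht
    induction S, hTS using Nat.le_induction with
    | base => exact ⟨rfl, rfl⟩
    | succ S hS ih =>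
      have := hW S t (ht.trans (by exact_mod_cast hS))
      exact ⟨this.1.trans ih.1, this.2.trans ih.2⟩
  let x : ℝ → ℕ := fun t => (W ⌈t⌉₊).1.1 t
  let a : ℝ → ℝ := fun t => (W ⌈t⌉₊).1.2 t
  have hxa : ∀ T : ℕ, ∀ t ≤ (T : ℝ), x t = (W T).1.1 t ∧ a t = (W T).1.2 t := by
    intro T t ht
    have := hW' ⌈t⌉₊ T (Nat.ceil_le.2 ht) t (Nat.le_ceil t)
    exact ⟨this.1.symm, this.2.symm⟩
  have hcad : ∀ {F : Type} [TopologicalSpace F] {y : ℝ → F} {Y : ℕ → ℝ → F},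
      (∀ T : ℕ, IsCadlag (Y T)) → (∀ T : ℕ, ∀ t ≤ (T : ℝ), y t = Y T t) → IsCadlag y := by
    intro F _ y Y hY hy
    constructor
    · intro t ht
      obtain ⟨T, hT⟩ := exists_nat_gt t
      refine ((hY T).1 t ht).congr_of_eventuallyEq ?_ (hy T t hT.le)
      filter_upwards [(eventually_lt_nhds hT).filter_mono nhdsWithin_le_nhds] with r hr
      exact hy T r hr.le
    · intro t ht
      obtain ⟨T, hT⟩ := exists_nat_gt t
      obtain ⟨l, hl⟩ := (hY T).2 t ht
      refine ⟨l, hl.congr' ?_⟩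
      filter_upwards [(eventually_lt_nhds hT).filter_mono nhdsWithin_le_nhds] with r hr
      exact (hy T r hr.le).symm
  have hm : ∀ t, MeasurableSet (Ioc 0 t ×ˢ univ : Set (ℝ × ℝ)) := fun t =>
    measurableSet_Ioc.prod MeasurableSet.univ
  refine ⟨x, a, hcad (fun T => (W T).2.state_cadlag) fun T t ht => (hxa T t ht).1,
    hcad (fun T => (W T).2.age_cadlag) fun T t ht => (hxa T t ht).2, ?_, ?_⟩
  · intro t ht
    obtain ⟨T, hT⟩ := exists_nat_ge t
    have hc : EqOn (stateJumpAlong lam u x a) (stateJumpAlong lam u (W T).1.1 (W T).1.2)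
        (Ioc 0 t ×ˢ univ) := fun r hr =>
      stateJumpAlong_congr (W T).2.state_cadlag (W T).2.age_cadlag
        (fun s hs => (hxa T s hs.le).1) (fun s hs => (hxa T s hs.le).2) ⟨hr.1.1, hr.1.2.trans hT⟩
    rw [integrableOn_congr_fun hc (hm t), setIntegral_congr_fun (hm t) hc, (hxa T t hT).1]
    exact (W T).2.state_equation t ht hT
  · intro t ht
    obtain ⟨T, hT⟩ := exists_nat_ge t
    have hc : EqOn (ageJumpAlong lam u x a) (ageJumpAlong lam u (W T).1.1 (W T).1.2)
        (Ioc 0 t ×ˢ univ) := fun r hr =>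
      ageJumpAlong_congr (W T).2.state_cadlag (W T).2.age_cadlag
        (fun s hs => (hxa T s hs.le).1) (fun s hs => (hxa T s hs.le).2) ⟨hr.1.1, hr.1.2.trans hT⟩
    rw [integrableOn_congr_fun hc (hm t), setIntegral_congr_fun (hm t) hc, (hxa T t hT).2]
    exact (W T).2.age_equation t ht hT

end Path

/-! ### Existence and adaptedness of solutions -/

section Solution

variable {U : Type*} [MetricSpace U] [CompactSpace U] [MeasurableSpace U] [BorelSpace U]
  {lam : ℕ → ℕ → ℝ → U → ℝ} {Lam : ℝ} {u : Control U} {i : ℕ} {x : ℝ → ℕ} {a : ℝ → ℝ}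
  {ν : Measure (ℝ × ℝ)}

open Classical in
/-- State and age at time `t`, given by `y` at time `s`, as a function of the noise in `(s, t]`;
correct if there is at most one point in between. -/
noncomputable def cellStep (lam : ℕ → ℕ → ℝ → U → ℝ) (Lam : ℝ) (u : Control U) (s t : ℝ)
    (ν : Measure (ℝ × ℝ)) (y : ℕ × ℝ) : ℕ × ℝ :=
  if ν (cell Lam s t) = 1 then afterPoint lam u s t y (atomPosition (cell Lam s t) ν)
  else (y.1, y.2 + (t - s))

theorem IsPath.eq_cellStep (h : BoundedRates lam Lam) (hp : IsPath lam u ν i x a)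
    (hn : ∀ t, 0 ≤ t → 0 ≤ a t) {s t : ℝ} (hs : 0 ≤ s) (hst : s ≤ t) (hν : IsSparse Lam ν s t) :
    (x t, a t) = cellStep lam Lam u s t ν (x s, a s) := by
  rcases hν with hν | ⟨p, hpc, hν⟩
  · have := hp.eq_of_empty h hn hs hst hν
    rw [cellStep, if_neg (by simp [hν]), this.1, this.2]
  · have h1 : ν (cell Lam s t) = 1 := by
      rw [← Measure.restrict_apply_self, hν, Measure.dirac_apply' _ (measurableSet_cell _ _ _)]
      simp [hpc]
    rw [cellStep, if_pos h1, atomPosition_eq hν (hs.trans hpc.1.1.le) hpc.2.1]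
    exact hp.eq_of_single h hn hs hpc hν

theorem BoundedRates.measurable_afterPoint (h : BoundedRates lam Lam) (u : Control U) (s t : ℝ) :
    Measurable fun q : (ℕ × ℝ) × (ℝ × ℝ) => afterPoint lam u s t q.1 q.2 := by
  have h1 : Measurable fun q : (ℕ × ℝ) × (ℝ × ℝ) =>
      (((q.1.1, q.1.2 + (q.2.1 - s)), q.2.2) : (ℕ × ℝ) × ℝ) := by fun_prop
  have h2 := (h.measurable_postJump u).comp h1
  exact (measurable_fst.comp h2).prodMk ((measurable_snd.comp h2).add
    (measurable_const.sub (measurable_fst.comp measurable_snd)))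

theorem BoundedRates.measurable_cellStep (h : BoundedRates lam Lam) (u : Control U) (s t : ℝ) :
    Measurable fun q : Measure (ℝ × ℝ) × (ℕ × ℝ) => cellStep lam Lam u s t q.1 q.2 := by
  classical
  refine Measurable.ite ?_ ?_ ?_
  · exact ((Measure.measurable_coe (measurableSet_cell _ _ _)).comp measurable_fst)
      (measurableSet_singleton 1)
  · exact (h.measurable_afterPoint u s t).comp (measurable_snd.prodMk
      ((measurable_atomPosition (measurableSet_cell _ _ _)).comp measurable_fst))
  · fun_prop

/-- The states and ages at the times `g k`, computed from the noise by one `cellStep` after the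
other. -/
noncomputable def gridState (lam : ℕ → ℕ → ℝ → U → ℝ) (Lam : ℝ) (u : Control U) (i : ℕ)
    (g : ℕ → ℝ) (ν : Measure (ℝ × ℝ)) : ℕ → ℕ × ℝ
  | 0 => (i, 0)
  | k + 1 => cellStep lam Lam u (g k) (g (k + 1)) ν (gridState lam Lam u i g ν k)

theorem BoundedRates.measurable_gridState (h : BoundedRates lam Lam) (u : Control U) (i : ℕ)
    (g : ℕ → ℝ) (k : ℕ) : Measurable fun ν => gridState lam Lam u i g ν k := by
  induction k with
  | zero => exact measurable_const
  | succ k ih => exact (h.measurable_cellStep u _ _).comp (measurable_id.prodMk ih)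

theorem cell_subset_history {s t r : ℝ} (htr : t ≤ r) : cell Lam s t ⊆ Iic r ×ˢ univ :=
  fun _ hp => ⟨hp.1.2.trans htr, mem_univ _⟩

theorem cellStep_restrict {s t r : ℝ} (htr : t ≤ r) (y : ℕ × ℝ) :
    cellStep lam Lam u s t (ν.restrict (Iic r ×ˢ univ)) y = cellStep lam Lam u s t ν y := by
  rw [cellStep, cellStep, Measure.restrict_eq_self _ (cell_subset_history htr), atomPosition,
    atomPosition, Measure.restrict_restrict_of_subset (cell_subset_history htr)]

theorem gridState_restrict {g : ℕ → ℝ} (hg : Monotone g) {r : ℝ} {m : ℕ} (hm : g m ≤ r) :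
    gridState lam Lam u i g (ν.restrict (Iic r ×ˢ univ)) m = gridState lam Lam u i g ν m := by
  induction m with
  | zero => rfl
  | succ m ih =>
    rw [gridState, gridState, ih ((hg (Nat.le_succ m)).trans hm), cellStep_restrict hm]

theorem IsPath.eq_gridState (h : BoundedRates lam Lam) (hp : IsPath lam u ν i x a)
    (hn : ∀ t, 0 ≤ t → 0 ≤ a t) {g : ℕ → ℝ} (hg : Monotone g) (hg0 : g 0 = 0) {m : ℕ}
    (hν : ∀ k < m, IsSparse Lam ν (g k) (g (k + 1))) :
    (x (g m), a (g m)) = gridState lam Lam u i g ν m := by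
  induction m with
  | zero => rw [hg0, hp.state_zero, hp.age_zero, gridState]
  | succ m ih =>
    rw [gridState, ← ih fun k hk => hν k (hk.trans (Nat.lt_succ_self m))]
    exact hp.eq_cellStep h hn (hg0 ▸ hg (Nat.zero_le m)) (hg (Nat.le_succ m))
      (hν m (Nat.lt_succ_self m))

/-- Every time interval `(T, T + 1]` splits into finitely many intervals carrying at most one
point each. -/
def IsLocallySparse (Lam : ℝ) (ν : Measure (ℝ × ℝ)) : Prop :=
  ∀ T : ℕ, ∃ m : ℕ, m ≠ 0 ∧ ∀ k < m,
    IsSparse Lam ν (gridPoint T (T + 1) m k) (gridPoint T (T + 1) m (k + 1))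

theorem exists_mem_Ioc_grid {g : ℕ → ℝ} {m : ℕ} {t : ℝ} (h0 : g 0 < t) (hm : t ≤ g m) :
    ∃ k < m, t ∈ Ioc (g k) (g (k + 1)) := by
  induction m with
  | zero => exact absurd h0 hm.not_gt
  | succ m ih =>
    rcases le_or_gt t (g m) with h | h
    · obtain ⟨k, hk, hkt⟩ := ih h
      exact ⟨k, hk.trans (Nat.lt_succ_self m), hkt⟩
    · exact ⟨m, Nat.lt_succ_self m, h, hm⟩

theorem IsLocallySparse.mass_at_time_le_one (hν : IsLocallySparse Lam ν) {t : ℝ} (ht : 0 < t) :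
    ν ({t} ×ˢ Ico 0 Lam) ≤ 1 := by
  obtain ⟨T, hT⟩ : ∃ T : ℕ, ⌈t⌉₊ = T + 1 := Nat.exists_eq_succ_of_ne_zero (by simpa using ht)
  have h1 : (T : ℝ) < t := Nat.lt_ceil.1 (by omega)
  have h2 : t ≤ T + 1 := by
    have := Nat.le_ceil t
    rw [hT] at this
    exact_mod_cast this
  obtain ⟨m, hm, hs⟩ := hν T
  obtain ⟨k, hk, hkt⟩ := exists_mem_Ioc_grid (g := gridPoint T (T + 1) m) (m := m) (t := t)
    (by rwa [gridPoint_zero]) (by rwa [gridPoint_last _ _ hm])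
  exact (measure_mono (Set.prod_mono (singleton_subset_iff.2 hkt) le_rfl)).trans
    (hs k hk).mass_le_one

variable {Ω : Type*} [MeasurableSpace Ω] {P : Measure Ω} [IsProbabilityMeasure P]
  {N : Ω → Measure (ℝ × ℝ)}

theorem IsPoissonRandomMeasure.isSparse (hN : IsPoissonRandomMeasure P N noiseIntensity) {s t : ℝ}
    {ω : Ω} (h : N ω (cell Lam s t) ≤ 1) : IsSparse Lam (N ω) s t := by
  rcases hN.mass_eq_zero_or_one (measurableSet_cell _ _ _) h with h | h
  · exact Or.inl h
  · exact Or.inr (hN.exists_restrict_eq_dirac (measurableSet_cell _ _ _) h)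

theorem IsPoissonRandomMeasure.ae_isLocallySparse (hN : IsPoissonRandomMeasure P N noiseIntensity)
    (Lam : ℝ) : ∀ᵐ ω ∂P, IsLocallySparse Lam (N ω) := by
  refine ae_all_iff.2 fun T => ?_
  filter_upwards [hN.ae_exists_grid_mass_le_one (Lam := Lam) (Nat.cast_nonneg T)
    (by linarith : (T : ℝ) ≤ T + 1)] with ω ⟨n, hn⟩
  exact ⟨2 ^ n, by positivity, fun k hk => hN.isSparse (hn k hk)⟩

/-- State and age at time `t` are, almost surely, a measurable function of the noise up to time
`t`, the same for all paths driven by the noise. -/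
theorem exists_measurable_eq_path (hN : IsPoissonRandomMeasure P N noiseIntensity)
    (h : BoundedRates lam Lam) (u : Control U) (i : ℕ) {t : ℝ} (ht : 0 ≤ t) :
    ∃ Z : Ω → ℕ × ℝ, Measurable[noiseHistory N t] Z ∧ ∀ᵐ ω ∂P, ∀ x a,
      IsPath lam u (N ω) i x a → (x t, a t) = Z ω := by
  classical
  let g : ℕ → ℕ → ℝ := fun n => gridPoint 0 t (2 ^ n)
  have hg : ∀ n, Monotone (g n) := fun n => gridPoint_mono ht _
  have hg0 : ∀ n, g n 0 = 0 := fun n => gridPoint_zero _ _ _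
  have hgt : ∀ n, g n (2 ^ n) = t := fun n => gridPoint_last _ _ (by positivity)
  let good : ℕ → Measure (ℝ × ℝ) → Prop := fun n ν =>
    ∀ k < 2 ^ n, ν (cell Lam (g n k) (g n (k + 1))) ≤ 1
  have hgood : ∀ n, MeasurableSet {ν | good n ν} := by
    intro n
    have : {ν | good n ν} =
        ⋂ k ∈ Finset.range (2 ^ n), {ν | ν (cell Lam (g n k) (g n (k + 1))) ≤ 1} := by
      ext ν; simp [good]
    rw [this]
    exact Finset.measurableSet_biInter _ fun k _ =>
      Measure.measurable_coe (measurableSet_cell _ _ _) measurableSet_Iic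
  -- the first dyadic partition separating the points is itself determined by the noise up to `t`
  let p : ℕ → Measure (ℝ × ℝ) → Prop := fun n ν => good n ν ∨ ¬ ∃ m, good m ν
  have hp : ∀ n, MeasurableSet {ν | p n ν} := by
    intro n
    have : {ν | p n ν} = {ν | good n ν} ∪ (⋃ m, {ν | good m ν})ᶜ := by
      ext ν; simp [p]
    rw [this]
    exact (hgood n).union (MeasurableSet.iUnion hgood).compl
  have hex : ∀ ν, ∃ n, p n ν := fun ν => by
    by_cases hν : ∃ m, good m ν
    · exact hν.imp fun m hm => Or.inl hm
    · exact ⟨0, Or.inr hν⟩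
  let F : Measure (ℝ × ℝ) → ℕ × ℝ := fun ν =>
    gridState lam Lam u i (g (Nat.find (hex ν))) ν (2 ^ Nat.find (hex ν))
  have hF : Measurable F := Measurable.find
    (f := fun n ν => gridState lam Lam u i (g n) ν (2 ^ n))
    (fun n => h.measurable_gridState u i (g n) (2 ^ n)) hp hex
  refine ⟨fun ω => F ((N ω).restrict (Iic t ×ˢ univ)), hF.comp (comap_measurable _), ?_⟩
  filter_upwards [hN.ae_exists_grid_mass_le_one (Lam := Lam) le_rfl ht,
    hN.ae_isLocallySparse Lam] with ω ⟨n, hn⟩ hls x a hpath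
  have hnn : ∀ s, 0 ≤ s → 0 ≤ a s := fun s hs =>
    hpath.age_nonneg h (fun t ht => hls.mass_at_time_le_one ht) hs
  set ρ := (N ω).restrict (Iic t ×ˢ univ) with hρ
  have hmass : ∀ n, ∀ k < 2 ^ n, ρ (cell Lam (g n k) (g n (k + 1))) =
      N ω (cell Lam (g n k) (g n (k + 1))) := fun n k hk =>
    Measure.restrict_eq_self _ (cell_subset_history ((hg n hk).trans (hgt n).le))
  have hfind := (Nat.find_spec (hex ρ)).resolve_right
    (not_not.2 ⟨n, fun k hk => (hmass n k hk).trans_le (hn k hk)⟩)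
  have := hpath.eq_gridState h hnn (hg (Nat.find (hex ρ))) (hg0 _) (m := 2 ^ Nat.find (hex ρ))
    fun k hk => hN.isSparse ((hmass _ k hk).ge.trans (hfind k hk))
  rw [hgt] at this
  rw [this]
  exact (gridState_restrict (hg _) (hgt _).le).symm

theorem IsSolution.ae_isPath {X : ℝ → Ω → ℕ} {Y : ℝ → Ω → ℝ}
    (hs : IsSolution P N lam u i 0 X Y) :
    ∀ᵐ ω ∂P, IsPath lam u (N ω) i (fun t => X t ω) (fun t => Y t ω) := by
  filter_upwards [hs.state_cadlag, hs.age_cadlag, hs.state_equation, hs.age_equation] with ω h1 h2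
    h3 h4
  exact ⟨h1, h2, h3, h4⟩

theorem exists_isSolution (hN : IsPoissonRandomMeasure P N noiseIntensity)
    (h : BoundedRates lam Lam) (u : Control U) (i : ℕ) :
    ∃ X Y, IsSolution P N lam u i 0 X Y := by
  classical
  have hex : ∀ ω, ∃ w : (ℝ → ℕ) × (ℝ → ℝ), IsLocallySparse Lam (N ω) →
      IsPath lam u (N ω) i w.1 w.2 := by
    intro ω
    by_cases hω : IsLocallySparse Lam (N ω)
    · obtain ⟨x, a, hxa⟩ := exists_isPath h u i hω
      exact ⟨(x, a), fun _ => hxa⟩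
    · exact ⟨(fun _ => 0, fun _ => 0), fun h' => absurd h' hω⟩
  choose w hw using hex
  have hpath : ∀ᵐ ω ∂P, IsPath lam u (N ω) i (w ω).1 (w ω).2 := by
    filter_upwards [hN.ae_isLocallySparse Lam] with ω hω
    exact hw ω hω
  have hadapt : ∀ t, 0 ≤ t → ∃ Z : Ω → ℕ × ℝ, Measurable[noiseHistory N t] Z ∧
      ∀ᵐ ω ∂P, ((w ω).1 t, (w ω).2 t) = Z ω := by
    intro t ht
    obtain ⟨Z, hZ, hZe⟩ := exists_measurable_eq_path hN h u i ht
    refine ⟨Z, hZ, ?_⟩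
    filter_upwards [hZe, hpath] with ω h1 h2
    exact h1 _ _ h2
  refine ⟨fun t ω => (w ω).1 t, fun t ω => (w ω).2 t, ?_, ?_, ?_, ?_, ?_, ?_⟩
  · intro t ht
    obtain ⟨Z, hZ, hZe⟩ := hadapt t ht
    exact ⟨fun ω => (Z ω).1, measurable_fst.comp hZ, hZe.mono fun ω hω => congrArg Prod.fst hω⟩
  · intro t ht
    obtain ⟨Z, hZ, hZe⟩ := hadapt t ht
    exact ⟨fun ω => (Z ω).2, measurable_snd.comp hZ, hZe.mono fun ω hω => congrArg Prod.snd hω⟩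
  · exact hpath.mono fun ω hω => hω.state_cadlag
  · exact hpath.mono fun ω hω => hω.age_cadlag
  · exact hpath.mono fun ω hω => hω.state_equation
  · exact hpath.mono fun ω hω => hω.age_equation

end Solution

/-! ### Resolvents of the linear age flow -/

section Resolvent

/-- The discounted integral of `q` along the ages `y + s`, `s > 0`. -/
noncomputable def resolvent (β : ℝ) (q : ℝ → ℝ) (y : ℝ) : ℝ :=
  ∫ s in Ioi (0 : ℝ), Real.exp (-β * s) * q (y + s)

variable {β B : ℝ} {q : ℝ → ℝ}

theorem integral_exp_neg_Ioi_zero_mul (hβ : 0 < β) :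
    ∫ s in Ioi (0 : ℝ), Real.exp (-β * s) = β⁻¹ := by
  rw [integral_exp_mul_Ioi (by linarith)]
  simp

theorem integrableOn_exp_mul_bounded (hβ : 0 < β) (hq : Measurable q) (hB : ∀ y, |q y| ≤ B)
    (a : ℝ) : IntegrableOn (fun s => Real.exp (-β * s) * q s) (Ioi a) :=
  Integrable.mul_bdd (c := B) (exp_neg_integrableOn_Ioi a hβ) hq.aestronglyMeasurable
    (Eventually.of_forall hB)

theorem integrableOn_resolvent (hβ : 0 < β) (hq : Measurable q) (hB : ∀ y, |q y| ≤ B) (y a : ℝ) :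
    IntegrableOn (fun s => Real.exp (-β * s) * q (y + s)) (Ioi a) :=
  integrableOn_exp_mul_bounded (q := fun s => q (y + s)) hβ (by fun_prop) (fun _ => hB _) a

theorem abs_resolvent_le (hβ : 0 < β) (hB : ∀ y, |q y| ≤ B) (y : ℝ) :
    |resolvent β q y| ≤ B * β⁻¹ := by
  have := norm_integral_le_of_norm_le (μ := volume.restrict (Ioi (0 : ℝ)))
    (f := fun s => Real.exp (-β * s) * q (y + s)) (g := fun s => Real.exp (-β * s) * B)
    ((exp_neg_integrableOn_Ioi 0 hβ).mul_const B) (Eventually.of_forall fun s => by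
      rw [norm_mul, Real.norm_of_nonneg (Real.exp_pos _).le]
      exact mul_le_mul_of_nonneg_left (hB _) (Real.exp_pos _).le)
  rw [integral_mul_const, integral_exp_neg_Ioi_zero_mul hβ, mul_comm] at this
  exact this

theorem resolvent_sub_le {q' : ℝ → ℝ} {B' D : ℝ} (hβ : 0 < β) (hq : Measurable q)
    (hB : ∀ y, |q y| ≤ B) (hq' : Measurable q') (hB' : ∀ y, |q' y| ≤ B') {y : ℝ}
    (hD : ∀ y', y ≤ y' → q y' - q' y' ≤ D) : resolvent β q y - resolvent β q' y ≤ D * β⁻¹ := by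
  rw [resolvent, resolvent, ← integral_sub (integrableOn_resolvent hβ hq hB y 0)
    (integrableOn_resolvent hβ hq' hB' y 0), ← integral_exp_neg_Ioi_zero_mul hβ, mul_comm,
    ← integral_mul_const]
  refine setIntegral_mono_on ((integrableOn_resolvent hβ hq hB y 0).sub
    (integrableOn_resolvent hβ hq' hB' y 0)) ((exp_neg_integrableOn_Ioi 0 hβ).mul_const D)
    measurableSet_Ioi fun s hs => ?_
  simp only [← mul_sub]
  exact mul_le_mul_of_nonneg_left (hD _ (le_add_of_nonneg_right (le_of_lt hs))) (Real.exp_pos _).le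

theorem resolvent_congr {q' : ℝ → ℝ} {y : ℝ} (h : ∀ y', y ≤ y' → q y' = q' y') :
    resolvent β q y = resolvent β q' y :=
  setIntegral_congr_fun measurableSet_Ioi fun s hs => by
    simp only [h _ (le_add_of_nonneg_right (le_of_lt hs) : y ≤ y + s)]

theorem setIntegral_Ioi_shift (f : ℝ → ℝ) (δ : ℝ) :
    ∫ s in Ioi δ, f s = ∫ s in Ioi (0 : ℝ), f (s + δ) := by
  have := (measurePreserving_add_right (volume : Measure ℝ) δ).setIntegral_preimage_emb
    (measurableEmbedding_addRight δ) f (Ioi δ)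
  rw [← this]
  congr 2
  ext s
  simp

/-- The part of the resolvent belonging to the first `δ` units of time, and the rest. -/
theorem resolvent_eq_add (hβ : 0 < β) (hq : Measurable q) (hB : ∀ y, |q y| ≤ B) (y δ : ℝ) :
    resolvent β q y = (∫ s in (0 : ℝ)..δ, Real.exp (-β * s) * q (y + s)) +
      Real.exp (-β * δ) * resolvent β q (y + δ) := by
  rw [resolvent, ← intervalIntegral.integral_interval_add_Ioi
    (integrableOn_resolvent hβ hq hB y 0) (integrableOn_resolvent hβ hq hB y δ),
    setIntegral_Ioi_shift _ δ, resolvent, ← integral_const_mul]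
  congr 2
  funext s
  rw [← mul_assoc, ← Real.exp_add]
  congr 2 <;> ring_nf

theorem abs_resolvent_sub_le (hβ : 0 < β) (hq : Measurable q) (hB : ∀ y, |q y| ≤ B) (y y' : ℝ) :
    |resolvent β q y - resolvent β q y'| ≤ 2 * B * |y - y'| := by
  wlog h : y ≤ y' generalizing y y'
  · rw [abs_sub_comm, abs_sub_comm y]
    exact this y' y (le_of_not_ge h)
  have hB0 : 0 ≤ B := (abs_nonneg _).trans (hB 0)
  obtain ⟨δ, hδ, rfl⟩ : ∃ δ, 0 ≤ δ ∧ y' = y + δ := ⟨y' - y, by linarith, by ring⟩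
  have h1 : |∫ s in (0 : ℝ)..δ, Real.exp (-β * s) * q (y + s)| ≤ B * |δ - 0| := by
    rw [← Real.norm_eq_abs]
    refine intervalIntegral.norm_integral_le_of_norm_le_const fun s hs => ?_
    rw [uIoc_of_le hδ] at hs
    rw [norm_mul, Real.norm_of_nonneg (Real.exp_pos _).le]
    have : Real.exp (-β * s) ≤ 1 := Real.exp_le_one_iff.2 (by nlinarith [hs.1])
    exact (mul_le_of_le_one_left (norm_nonneg _) this).trans (hB _)
  have h2 := abs_resolvent_le hβ hB (y + δ)
  have h3 : 0 ≤ 1 - Real.exp (-β * δ) := by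
    have : Real.exp (-β * δ) ≤ 1 := Real.exp_le_one_iff.2 (by nlinarith)
    linarith
  have h4 : 1 - Real.exp (-β * δ) ≤ β * δ := by
    have := Real.add_one_le_exp (-β * δ)
    linarith
  have h5 : |(1 - Real.exp (-β * δ)) * resolvent β q (y + δ)| ≤ B * δ := by
    rw [abs_mul, abs_of_nonneg h3]
    calc _ ≤ (β * δ) * (B * β⁻¹) := mul_le_mul h4 h2 (abs_nonneg _) (by positivity)
      _ = B * δ := by field_simp
  rw [resolvent_eq_add hβ hq hB y δ]
  have h6 : |y - (y + δ)| = δ := by rw [sub_add_cancel_left, abs_neg, abs_of_nonneg hδ]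
  rw [sub_zero, abs_of_nonneg hδ] at h1
  rw [h6]
  have : (∫ s in (0 : ℝ)..δ, Real.exp (-β * s) * q (y + s)) +
      Real.exp (-β * δ) * resolvent β q (y + δ) - resolvent β q (y + δ) =
      (∫ s in (0 : ℝ)..δ, Real.exp (-β * s) * q (y + s)) -
      (1 - Real.exp (-β * δ)) * resolvent β q (y + δ) := by ring
  rw [this]
  have := abs_sub (∫ s in (0 : ℝ)..δ, Real.exp (-β * s) * q (y + s))
    ((1 - Real.exp (-β * δ)) * resolvent β q (y + δ))
  linarith

theorem continuous_resolvent (hβ : 0 < β) (hq : Measurable q) (hB : ∀ y, |q y| ≤ B) :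
    Continuous (resolvent β q) := by
  have hB0 : 0 ≤ 2 * B := by
    have := (abs_nonneg _).trans (hB 0)
    linarith
  exact (LipschitzWith.of_dist_le_mul (K := ⟨2 * B, hB0⟩) fun y y' =>
    abs_resolvent_sub_le hβ hq hB y y').continuous

/-- A fixed point equation `v = resolvent β (Q v)` with `Q` Lipschitz of constant `Lam < β` has a
bounded continuous solution. -/
theorem exists_resolvent_fixedPoint {Lam : ℝ} (hLam : 0 ≤ Lam) (hβ : Lam < β)
    (Q : (ℕ × ℝ →ᵇ ℝ) → ℕ × ℝ → ℝ) (hm : ∀ v i, Measurable fun y => Q v (i, y))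
    (hb : ∀ v, ∃ B, ∀ x, |Q v x| ≤ B) (hL : ∀ v w x, Q v x - Q w x ≤ Lam * dist v w) :
    ∃ v : ℕ × ℝ →ᵇ ℝ, ∀ i y, v (i, y) = resolvent β (fun y => Q v (i, y)) y := by
  have hβ0 : 0 < β := hLam.trans_lt hβ
  choose B hB using hb
  let T : (ℕ × ℝ →ᵇ ℝ) → (ℕ × ℝ →ᵇ ℝ) := fun v =>
    BoundedContinuousFunction.ofNormedAddCommGroup
      (fun x : ℕ × ℝ => resolvent β (fun y => Q v (x.1, y)) x.2)
      (continuous_prod_of_discrete_left.2 fun i =>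
        continuous_resolvent hβ0 (hm v i) fun y => hB v (i, y))
      (B v * β⁻¹) fun x => abs_resolvent_le hβ0 (fun y => hB v (x.1, y)) x.2
  have hK0 : 0 ≤ Lam * β⁻¹ := by positivity
  have hT : ContractingWith (Lam * β⁻¹).toNNReal T := by
    refine ⟨?_, LipschitzWith.of_dist_le_mul fun v w => ?_⟩
    · rwa [Real.toNNReal_lt_one, ← div_eq_mul_inv, div_lt_one hβ0]
    · rw [Real.coe_toNNReal _ hK0, BoundedContinuousFunction.dist_le (by positivity)]
      intro x
      have h1 := resolvent_sub_le hβ0 (hm v x.1) (fun y => hB v (x.1, y)) (hm w x.1)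
        (fun y => hB w (x.1, y)) (y := x.2) (fun y _ => hL v w (x.1, y))
      have h2 := resolvent_sub_le hβ0 (hm w x.1) (fun y => hB w (x.1, y)) (hm v x.1)
        (fun y => hB v (x.1, y)) (y := x.2) (fun y _ => hL w v (x.1, y))
      rw [dist_comm] at h2
      rw [Real.dist_eq, abs_le]
      have h3 : Lam * dist v w * β⁻¹ = Lam * β⁻¹ * dist v w := by ring
      have h4 : ∀ v, T v x = resolvent β (fun y => Q v (x.1, y)) x.2 := fun v => rfl
      rw [h4, h4]
      constructor <;> linarith
  refine ⟨hT.fixedPoint T, fun i y => ?_⟩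
  have := DFunLike.congr_fun hT.fixedPoint_isFixedPt (i, y)
  exact this.symm

/-- Comparison of two resolvents at nonnegative ages, by the contraction property of a monotone
operator. -/
theorem le_of_resolvent_eq {Lam : ℝ} (hLam : 0 ≤ Lam) (hβ : Lam < β) {v w : ℕ × ℝ →ᵇ ℝ}
    {q q' : ℕ × ℝ → ℝ} {B B' : ℝ} (hq : ∀ i, Measurable fun y => q (i, y))
    (hB : ∀ x, |q x| ≤ B) (hq' : ∀ i, Measurable fun y => q' (i, y)) (hB' : ∀ x, |q' x| ≤ B')
    (hv : ∀ i y, 0 ≤ y → v (i, y) = resolvent β (fun y => q (i, y)) y)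
    (hw : ∀ i y, 0 ≤ y → w (i, y) = resolvent β (fun y => q' (i, y)) y)
    (hD : ∀ D, 0 ≤ D → (∀ i y, 0 ≤ y → v (i, y) - w (i, y) ≤ D) →
      ∀ i y, 0 ≤ y → q (i, y) - q' (i, y) ≤ Lam * D) (i : ℕ) {y : ℝ} (hy : 0 ≤ y) :
    v (i, y) ≤ w (i, y) := by
  have hβ0 : 0 < β := hLam.trans_lt hβ
  have hbdd : BddAbove (range fun x : ℕ × Ici (0 : ℝ) => v (x.1, x.2) - w (x.1, x.2)) := by
    refine ⟨‖v - w‖, ?_⟩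
    rintro _ ⟨x, rfl⟩
    exact (le_abs_self _).trans ((v - w).norm_coe_le_norm (x.1, x.2))
  set D := max 0 (⨆ x : ℕ × Ici (0 : ℝ), (v (x.1, x.2) - w (x.1, x.2))) with hDdef
  have hD0 : 0 ≤ D := le_max_left _ _
  have hle : ∀ i y, 0 ≤ y → v (i, y) - w (i, y) ≤ D := fun i y hy =>
    (le_ciSup hbdd (i, ⟨y, hy⟩)).trans (le_max_right _ _)
  have himp : ∀ i y, 0 ≤ y → v (i, y) - w (i, y) ≤ Lam * D * β⁻¹ := fun i y hy => by
    rw [hv i y hy, hw i y hy]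
    exact resolvent_sub_le hβ0 (hq i) (fun y => hB (i, y)) (hq' i)
      (fun y => hB' (i, y)) fun y' hy' => hD D hD0 hle i y' (hy.trans hy')
  have : Nonempty (Ici (0 : ℝ)) := ⟨⟨0, mem_Ici.2 le_rfl⟩⟩
  have hDle : D ≤ Lam * D * β⁻¹ :=
    max_le (by positivity) (ciSup_le fun x => himp x.1 x.2 x.2.2)
  have : D = 0 := by
    by_contra hne
    have hpos : 0 < D := hD0.lt_of_ne (Ne.symm hne)
    have : Lam * D * β⁻¹ < D := by
      rw [← div_eq_mul_inv, div_lt_iff₀ hβ0]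
      nlinarith
    linarith
  linarith [hle i y hy]

end Resolvent

/-! ### Hamiltonians -/

section Hamiltonian

variable {U : Type*} [MetricSpace U] [CompactSpace U] [MeasurableSpace U] [BorelSpace U]
  {lam : ℕ → ℕ → ℝ → U → ℝ} {Lam : ℝ} {c : ℕ → ℝ → U → ℝ} {C : ℝ}

/-- Running cost plus expected continuation value at the points of a noise of rate `Lam`, for the
action `a` in state `i` at age `y`: a point triggers a jump to `j`, worth `φ j`, at the rate
`lam i j y a`, and otherwise leaves the value at `w`. -/
noncomputable def hamiltonian (lam : ℕ → ℕ → ℝ → U → ℝ) (c : ℕ → ℝ → U → ℝ) (Lam : ℝ)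
    (φ : ℕ → ℝ) (w : ℝ) (i : ℕ) (y : ℝ) (a : U) : ℝ :=
  c i y a + ∑' j : {j : ℕ // j ≠ i}, lam i j y a * φ j + (Lam - exitRate lam i y a) * w

theorem BoundedRates.summable_mul (h : BoundedRates lam Lam) (i : ℕ) {y : ℝ} (hy : 0 ≤ y) (a : U)
    {φ : ℕ → ℝ} {K : ℝ} (hφ : ∀ j, |φ j| ≤ K) :
    Summable fun j : {j : ℕ // j ≠ i} => lam i j y a * φ j :=
  Summable.of_norm_bounded ((h.hasSum_exitRate i hy a).summable.mul_right K) fun j => by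
    rw [norm_mul, Real.norm_of_nonneg (h.nonneg i j (Ne.symm j.2) y hy a)]
    exact mul_le_mul_of_nonneg_left (hφ j) (h.nonneg i j (Ne.symm j.2) y hy a)

theorem BoundedRates.tsum_mul_le (h : BoundedRates lam Lam) (i : ℕ) {y : ℝ} (hy : 0 ≤ y) (a : U)
    {φ : ℕ → ℝ} {K D : ℝ} (hφ : ∀ j, |φ j| ≤ K) (hD : ∀ j, φ j ≤ D) :
    ∑' j : {j : ℕ // j ≠ i}, lam i j y a * φ j ≤ exitRate lam i y a * D := by
  rw [exitRate, ← tsum_mul_right]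
  exact (h.summable_mul i hy a hφ).tsum_le_tsum
    (fun j => mul_le_mul_of_nonneg_left (hD j) (h.nonneg i j (Ne.symm j.2) y hy a))
    ((h.hasSum_exitRate i hy a).summable.mul_right D)

/-- The Hamiltonian is monotone, and Lipschitz of constant `Lam`, in the continuation values. -/
theorem hamiltonian_sub_le (h : BoundedRates lam Lam) (i : ℕ) {y : ℝ} (hy : 0 ≤ y) (a : U)
    {φ φ' : ℕ → ℝ} {K K' w w' D : ℝ} (hφ : ∀ j, |φ j| ≤ K) (hφ' : ∀ j, |φ' j| ≤ K')
    (hD : ∀ j, φ j - φ' j ≤ D) (hw : w - w' ≤ D) :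
    hamiltonian lam c Lam φ w i y a - hamiltonian lam c Lam φ' w' i y a ≤ Lam * D := by
  have h1 := (h.summable_mul i hy a hφ).tsum_sub (h.summable_mul i hy a hφ')
  simp only [← mul_sub] at h1
  have h2 := h.tsum_mul_le i hy a (φ := fun j => φ j - φ' j) (K := K + K') (fun j =>
    (abs_sub _ _).trans (add_le_add (hφ j) (hφ' j))) hD
  have h3 : (Lam - exitRate lam i y a) * (w - w') ≤ (Lam - exitRate lam i y a) * D :=
    mul_le_mul_of_nonneg_left hw (sub_nonneg.2 (h.exit_le i y hy a))
  simp only [hamiltonian]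
  nlinarith

theorem abs_hamiltonian_le (h : BoundedRates lam Lam) (hc : BoundedCost c C) (i : ℕ) {y : ℝ}
    (hy : 0 ≤ y) (a : U) {φ : ℕ → ℝ} {K w : ℝ} (hφ : ∀ j, |φ j| ≤ K) (hw : |w| ≤ K) :
    |hamiltonian lam c Lam φ w i y a| ≤ C + Lam * K := by
  have hK : 0 ≤ K := (abs_nonneg _).trans hw
  have h0 : hamiltonian lam c Lam (fun _ => 0) 0 i y a = c i y a := by simp [hamiltonian]
  have h1 := hamiltonian_sub_le (c := c) h i hy a (φ' := fun _ => 0) (K' := 0) (w' := 0) (D := K)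
    hφ (by simp) (fun j => by simpa using (le_abs_self _).trans (hφ j))
    (by simpa using (le_abs_self _).trans hw)
  have h2 := hamiltonian_sub_le (c := c) h i hy a (φ := fun _ => 0) (K := 0) (w := 0) (D := K)
    (by simp) hφ (fun j => by simpa using (neg_le_abs _).trans (hφ j))
    (by simpa using (neg_le_abs _).trans hw)
  have h3 := hc.nonneg i y hy a
  have h4 := hc.le i y hy a
  rw [abs_le]
  constructor <;> linarith

/-- The series `∑_j lam_ij φ_j` inherits continuity from the uniform convergence of the series of
the rates. -/
theorem BoundedRates.continuous_tsum_mul (h : BoundedRates lam Lam) (i : ℕ) {φ : ℕ → ℝ} {K : ℝ}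
    (hφ : ∀ j, |φ j| ≤ K) :
    Continuous fun p : ℝ × U => ∑' j : {j : ℕ // j ≠ i}, lam i j (max p.1 0) p.2 * φ j := by
  refine ContinuousOn.comp_clamp
    (f := fun p => ∑' j : {j : ℕ // j ≠ i}, lam i j p.1 p.2 * φ j) ?_
  have hu : TendstoUniformlyOn (fun (n : ℕ) (p : ℝ × U) =>
      ∑ j ∈ (Finset.range n).filter (· ≠ i), lam i j p.1 p.2 * φ j)
      (fun p : ℝ × U => ∑' j : {j : ℕ // j ≠ i}, lam i j p.1 p.2 * φ j) atTop
      (Ici 0 ×ˢ univ) := by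
    have hK : 0 ≤ K := (abs_nonneg _).trans (hφ 0)
    rw [Metric.tendstoUniformlyOn_iff]
    intro ε hε
    filter_upwards [Metric.tendstoUniformlyOn_iff.1 (h.unif i) (ε / (K + 1)) (by positivity)]
      with n hn p hp
    have hy : 0 ≤ p.1 := hp.1
    have h1 : HasSum (fun j => if j ≠ i then lam i j p.1 p.2 else 0) (exitRate lam i p.1 p.2) :=
      (hasSum_subtype_ne (a := fun j => lam i j p.1 p.2)).1 (h.hasSum_exitRate i hy p.2)
    have h2 : HasSum (fun j => if j ≠ i then lam i j p.1 p.2 * φ j else 0)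
        (∑' j : {j : ℕ // j ≠ i}, lam i j p.1 p.2 * φ j) :=
      (hasSum_subtype_ne (a := fun j => lam i j p.1 p.2 * φ j)).1
        (h.summable_mul i hy p.2 hφ).hasSum
    have h1' := (hasSum_nat_add_iff' n).2 h1
    have h2' := (hasSum_nat_add_iff' n).2 h2
    have hle : |(∑' j : {j : ℕ // j ≠ i}, lam i j p.1 p.2 * φ j) -
        ∑ j ∈ Finset.range n, (if j ≠ i then lam i j p.1 p.2 * φ j else 0)| ≤
        (exitRate lam i p.1 p.2 -
          ∑ j ∈ Finset.range n, if j ≠ i then lam i j p.1 p.2 else 0) * K := by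
      rw [← h2'.tsum_eq, ← Real.norm_eq_abs]
      refine tsum_of_norm_bounded (h1'.mul_right K) fun j => ?_
      split_ifs with hj
      · rw [norm_mul, Real.norm_of_nonneg (h.nonneg i _ (Ne.symm hj) p.1 hy p.2)]
        exact mul_le_mul_of_nonneg_left (hφ _) (h.nonneg i _ (Ne.symm hj) p.1 hy p.2)
      · simp
    have hn' := hn p hp
    rw [Real.dist_eq, Finset.sum_filter] at hn' ⊢
    calc _ ≤ _ := hle
      _ ≤ ε / (K + 1) * K := mul_le_mul_of_nonneg_right ((le_abs_self _).trans hn'.le) hK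
      _ < ε := by
        rw [div_mul_eq_mul_div, div_lt_iff₀ (by positivity)]
        nlinarith
  refine hu.continuousOn (Frequently.of_forall fun n => ?_)
  exact continuousOn_finsetSum _ fun j hj =>
    (h.cont i j (Ne.symm (Finset.mem_filter.1 hj).2)).mul continuousOn_const

theorem continuous_hamiltonian (h : BoundedRates lam Lam) (hc : BoundedCost c C) (i : ℕ)
    {φ : ℕ → ℝ} {K : ℝ} (hφ : ∀ j, |φ j| ≤ K) (w y : ℝ) :
    Continuous (hamiltonian lam c Lam φ w i (max y 0)) := by
  have hy : (0 : ℝ) ≤ max y 0 := le_max_right _ _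
  exact ((hc.action i _ hy).add ((h.continuous_tsum_mul i hφ).comp (Continuous.prodMk_right y))).add
    ((continuous_const.sub (h.continuous_exitRate_right i hy)).mul continuous_const)

theorem measurable_hamiltonian (h : BoundedRates lam Lam) (hc : BoundedCost c C) (i : ℕ)
    {φ : ℕ → ℝ} {K : ℝ} (hφ : ∀ j, |φ j| ≤ K) {w : ℝ → ℝ} (hw : Measurable w) :
    Measurable fun p : ℝ × U => hamiltonian lam c Lam φ (w p.1) i (max p.1 0) p.2 :=
  ((hc.measurable_clamp i).add (h.continuous_tsum_mul i hφ).measurable).add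
    ((measurable_const.sub (h.continuous_exitRate i).measurable).mul (hw.comp measurable_fst))

/-- The Hamiltonian averaged over the actions chosen by `r`; negative ages are read as `0`. -/
noncomputable def averageHamiltonian (lam : ℕ → ℕ → ℝ → U → ℝ) (c : ℕ → ℝ → U → ℝ) (Lam : ℝ)
    (r : ℝ → ProbabilityMeasure U) (φ : ℕ → ℝ) (w : ℝ) (i : ℕ) (y : ℝ) : ℝ :=
  ∫ a, hamiltonian lam c Lam φ w i (max y 0) a ∂(r (max y 0) : Measure U)

/-- The Hamiltonian minimised over the actions; negative ages are read as `0`. -/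
noncomputable def minHamiltonian (lam : ℕ → ℕ → ℝ → U → ℝ) (c : ℕ → ℝ → U → ℝ) (Lam : ℝ)
    (φ : ℕ → ℝ) (w : ℝ) (i : ℕ) (y : ℝ) : ℝ :=
  ⨅ a, hamiltonian lam c Lam φ w i (max y 0) a

theorem integrable_hamiltonian (h : BoundedRates lam Lam) (hc : BoundedCost c C) (i : ℕ)
    {φ : ℕ → ℝ} {K : ℝ} (hφ : ∀ j, |φ j| ≤ K) (w y : ℝ) (ν : ProbabilityMeasure U) :
    Integrable (hamiltonian lam c Lam φ w i (max y 0)) (ν : Measure U) :=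
  integrable_of_continuous (continuous_hamiltonian h hc i hφ w y)

theorem averageHamiltonian_sub_le (h : BoundedRates lam Lam) (hc : BoundedCost c C)
    (r : ℝ → ProbabilityMeasure U) (i : ℕ) (y : ℝ) {φ φ' : ℕ → ℝ} {K K' w w' D : ℝ}
    (hφ : ∀ j, |φ j| ≤ K) (hφ' : ∀ j, |φ' j| ≤ K')
    (hD : ∀ j, φ j - φ' j ≤ D) (hw : w - w' ≤ D) :
    averageHamiltonian lam c Lam r φ w i y - averageHamiltonian lam c Lam r φ' w' i y ≤
      Lam * D := by
  rw [averageHamiltonian, averageHamiltonian, ← integral_sub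
    (integrable_hamiltonian h hc i hφ w y _) (integrable_hamiltonian h hc i hφ' w' y _)]
  refine (integral_mono ((integrable_hamiltonian h hc i hφ w y _).sub
    (integrable_hamiltonian h hc i hφ' w' y _)) (integrable_const (Lam * D)) fun a =>
    hamiltonian_sub_le h i (le_max_right _ _) a hφ hφ' hD hw).trans (by simp)

theorem abs_averageHamiltonian_le (h : BoundedRates lam Lam) (hc : BoundedCost c C)
    (r : ℝ → ProbabilityMeasure U) (i : ℕ) (y : ℝ) {φ : ℕ → ℝ} {K w : ℝ} (hφ : ∀ j, |φ j| ≤ K)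
    (hw : |w| ≤ K) : |averageHamiltonian lam c Lam r φ w i y| ≤ C + Lam * K :=
  abs_integral_le_of_abs_le fun a => abs_hamiltonian_le h hc i (le_max_right _ _) a hφ hw

theorem measurable_averageHamiltonian (h : BoundedRates lam Lam) (hc : BoundedCost c C)
    {r : ℝ → ProbabilityMeasure U} (hr : Measurable r) (i : ℕ) {φ : ℕ → ℝ} {K : ℝ}
    (hφ : ∀ j, |φ j| ≤ K) {w : ℝ → ℝ} (hw : Measurable w) :
    Measurable fun y => averageHamiltonian lam c Lam r φ (w y) i y :=
  measurable_average (hr.comp (by fun_prop : Measurable fun y : ℝ => max y 0))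
    (f := fun p => hamiltonian lam c Lam φ (w p.1) i (max p.1 0) p.2)
    (measurable_hamiltonian h hc i hφ hw)

/-! ### Measurable selection of minimisers -/

variable [Nonempty U]

theorem exists_eq_iInf_of_continuous {f : U → ℝ} (hf : Continuous f) :
    ∃ a, f a = ⨅ a, f a ∧ ∀ b, f a ≤ f b := by
  obtain ⟨a, -, ha⟩ := isCompact_univ.exists_isMinOn univ_nonempty hf.continuousOn
  have hb : ∀ b, f a ≤ f b := fun b => ha (mem_univ b)
  exact ⟨a, le_antisymm (le_ciInf hb) (ciInf_le ⟨f a, by rintro _ ⟨b, rfl⟩; exact hb b⟩ a), hb⟩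

theorem iInf_le_of_continuous {f : U → ℝ} (hf : Continuous f) (a : U) : ⨅ a, f a ≤ f a := by
  obtain ⟨b, hb, hb'⟩ := exists_eq_iInf_of_continuous hf
  exact hb ▸ hb' a

/-- The minimum over a compact space of a function continuous in the minimised variable depends
measurably on the parameter. -/
theorem measurable_iInf_of_continuous {γ K : Type*} [MeasurableSpace γ] [TopologicalSpace K]
    [CompactSpace K] [Nonempty K] [TopologicalSpace.SeparableSpace K] {f : γ → K → ℝ}
    (hf : ∀ y, Continuous (f y)) (hm : ∀ a, Measurable fun y => f y a) :
    Measurable fun y => ⨅ a, f y a := by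
  have heq : (fun y => ⨅ a, f y a) = fun y => ⨅ n, f y (TopologicalSpace.denseSeq K n) := by
    funext y
    obtain ⟨a, -, ha⟩ := isCompact_univ.exists_isMinOn univ_nonempty (hf y).continuousOn
    have hbdd : BddBelow (range (f y)) := ⟨f y a, by rintro _ ⟨b, rfl⟩; exact ha (mem_univ b)⟩
    have hbdd' : BddBelow (range fun n => f y (TopologicalSpace.denseSeq K n)) :=
      hbdd.mono (by rintro _ ⟨n, rfl⟩; exact ⟨_, rfl⟩)
    refine le_antisymm (le_ciInf fun n => ciInf_le hbdd _) (le_ciInf fun b => ?_)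
    refine isClosed_property (TopologicalSpace.denseRange_denseSeq K)
      (p := fun b => ⨅ n, f y (TopologicalSpace.denseSeq K n) ≤ f y b) ?_ (fun n => ?_) b
    · exact isClosed_le continuous_const (hf y)
    · exact ciInf_le hbdd' n
  rw [heq]
  exact Measurable.iInf fun n => hm _

/-- A function continuous in the action and measurable in the parameter has a measurable choice of
minimisers. The action space is a continuous image of the Cantor set, and the least minimiser, in
the order of the real line, of the function pulled back to the Cantor set depends measurably on
the parameter. -/
theorem exists_measurable_minimiser {f : ℝ → U → ℝ} (hf : ∀ y, Continuous (f y))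
    (hm : ∀ a, Measurable fun y => f y a) :
    ∃ s : ℝ → U, Measurable s ∧ ∀ y, f y (s y) = ⨅ a, f y a := by
  obtain ⟨g, hg, hgs⟩ := exists_nat_bool_continuous_surjective_of_compact U
  let e : (ℕ → Bool) → ℝ := fun b => (cantorSetHomeomorphNatToBool.symm b : cantorSet)
  have he : Continuous e := continuous_subtype_val.comp cantorSetHomeomorphNatToBool.symm.continuous
  have hinj : Function.Injective e :=
    Subtype.val_injective.comp cantorSetHomeomorphNatToBool.symm.injective
  have hemb : MeasurableEmbedding e := (he.isClosedEmbedding hinj).measurableEmbedding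
  -- the defect of optimality of the action coded by `b`
  let d : ℝ → (ℕ → Bool) → ℝ := fun y b => f y (g b) - ⨅ a, f y a
  have hd : ∀ y, Continuous (d y) := fun y => ((hf y).comp hg).sub continuous_const
  have hdm : ∀ b, Measurable fun y => d y b := fun b =>
    (hm _).sub (measurable_iInf_of_continuous hf hm)
  have hd0 : ∀ y b, 0 ≤ d y b := fun y b => sub_nonneg.2 (iInf_le_of_continuous (hf y) _)
  have hcpt : ∀ y, IsCompact {b | d y b = 0} := fun y =>
    (isClosed_eq (hd y) continuous_const).isCompact
  have hne : ∀ y, {b | d y b = 0}.Nonempty := fun y => by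
    obtain ⟨a, ha, -⟩ := exists_eq_iInf_of_continuous (hf y)
    obtain ⟨b, rfl⟩ := hgs a
    exact ⟨b, by simp only [mem_ofPred_eq, d, ha, sub_self]⟩
  have hsel : ∀ y, ∃ b, d y b = 0 ∧ ∀ b', d y b' = 0 → e b ≤ e b' := fun y => by
    obtain ⟨b, hb, hmin⟩ := (hcpt y).exists_isMinOn (hne y) he.continuousOn
    exact ⟨b, hb, fun b' hb' => hmin hb'⟩
  choose s hs hmin using hsel
  have hes : Measurable fun y => e (s y) := by
    refine measurable_of_Iic fun r => ?_
    -- some minimiser has coordinate at most `r` iff the defect plus the excess over `r` vanishes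
    -- somewhere
    have hset : (fun y => e (s y)) ⁻¹' Iic r = {y | ⨅ b, (d y b + max (e b - r) 0) = 0} := by
      ext y
      have hcont : Continuous fun b => d y b + max (e b - r) 0 :=
        (hd y).add ((he.sub continuous_const).max continuous_const)
      have hnn : ∀ b, 0 ≤ d y b + max (e b - r) 0 := fun b =>
        add_nonneg (hd0 y b) (le_max_right _ _)
      obtain ⟨b, -, hb⟩ := isCompact_univ.exists_isMinOn univ_nonempty hcont.continuousOn
      have hbdd : BddBelow (range fun b => d y b + max (e b - r) 0) :=
        ⟨0, by rintro _ ⟨b, rfl⟩; exact hnn b⟩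
      simp only [mem_preimage, mem_Iic, mem_ofPred_eq]
      constructor
      · intro h
        refine le_antisymm ((ciInf_le hbdd (s y)).trans ?_) (le_ciInf hnn)
        rw [hs, zero_add, max_eq_right (by linarith)]
      · intro h
        have h1 : d y b + max (e b - r) 0 ≤ ⨅ b, (d y b + max (e b - r) 0) :=
          le_ciInf fun b' => hb (mem_univ b')
        rw [h] at h1
        have h2 := hd0 y b
        have h3 := le_max_right (e b - r) 0
        have h4 := le_max_left (e b - r) 0
        have := hmin y b (by linarith)
        linarith
    rw [hset]
    exact measurable_iInf_of_continuous
      (fun y => (hd y).add ((he.sub continuous_const).max continuous_const))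
      (fun b => (hdm b).add_const _) (measurableSet_singleton 0)
  refine ⟨fun y => g (s y), hg.measurable.comp (hemb.measurable_comp_iff.1 hes), fun y => ?_⟩
  exact sub_eq_zero.1 (hs y)

theorem minHamiltonian_le (h : BoundedRates lam Lam) (hc : BoundedCost c C) (i : ℕ)
    {φ : ℕ → ℝ} {K : ℝ} (hφ : ∀ j, |φ j| ≤ K) (w y : ℝ) (a : U) :
    minHamiltonian lam c Lam φ w i y ≤ hamiltonian lam c Lam φ w i (max y 0) a :=
  iInf_le_of_continuous (continuous_hamiltonian h hc i hφ w y) a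

theorem minHamiltonian_le_average (h : BoundedRates lam Lam) (hc : BoundedCost c C)
    (r : ℝ → ProbabilityMeasure U) (i : ℕ) {φ : ℕ → ℝ} {K : ℝ} (hφ : ∀ j, |φ j| ≤ K) (w y : ℝ) :
    minHamiltonian lam c Lam φ w i y ≤ averageHamiltonian lam c Lam r φ w i y := by
  refine le_trans (by simp) (integral_mono (integrable_const (minHamiltonian lam c Lam φ w i y))
    (integrable_hamiltonian h hc i hφ w y (r (max y 0)))
    fun a => minHamiltonian_le h hc i hφ w y a)

theorem minHamiltonian_sub_le (h : BoundedRates lam Lam) (hc : BoundedCost c C)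
    (i : ℕ) (y : ℝ) {φ φ' : ℕ → ℝ} {K K' w w' D : ℝ}
    (hφ : ∀ j, |φ j| ≤ K) (hφ' : ∀ j, |φ' j| ≤ K')
    (hD : ∀ j, φ j - φ' j ≤ D) (hw : w - w' ≤ D) :
    minHamiltonian lam c Lam φ w i y - minHamiltonian lam c Lam φ' w' i y ≤ Lam * D := by
  obtain ⟨a, ha, -⟩ := exists_eq_iInf_of_continuous (continuous_hamiltonian h hc i hφ' w' y)
  have h1 := minHamiltonian_le h hc i hφ w y a
  have h2 := hamiltonian_sub_le (c := c) h i (le_max_right y 0) a hφ hφ' hD hw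
  rw [ha] at h2
  change _ - minHamiltonian lam c Lam φ' w' i y ≤ _ at h2
  linarith

theorem abs_minHamiltonian_le (h : BoundedRates lam Lam) (hc : BoundedCost c C)
    (i : ℕ) (y : ℝ) {φ : ℕ → ℝ} {K w : ℝ} (hφ : ∀ j, |φ j| ≤ K)
    (hw : |w| ≤ K) : |minHamiltonian lam c Lam φ w i y| ≤ C + Lam * K := by
  obtain ⟨a, ha, -⟩ := exists_eq_iInf_of_continuous (continuous_hamiltonian h hc i hφ w y)
  rw [minHamiltonian, ← ha]
  exact abs_hamiltonian_le h hc i (le_max_right _ _) a hφ hw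

theorem measurable_minHamiltonian (h : BoundedRates lam Lam) (hc : BoundedCost c C) (i : ℕ)
    {φ : ℕ → ℝ} {K : ℝ} (hφ : ∀ j, |φ j| ≤ K) {w : ℝ → ℝ} (hw : Measurable w) :
    Measurable fun y => minHamiltonian lam c Lam φ (w y) i y :=
  measurable_iInf_of_continuous (fun y => continuous_hamiltonian h hc i hφ (w y) y) fun _ =>
    (measurable_hamiltonian h hc i hφ hw).comp (measurable_id.prodMk measurable_const)

/-- Some action, that is, some measurable choice of a probability measure at every age, attains the
minimum of the Hamiltonian at all ages. -/
theorem exists_action_averageHamiltonian_eq_min (h : BoundedRates lam Lam) (hc : BoundedCost c C)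
    (i : ℕ) {φ : ℕ → ℝ} {K : ℝ} (hφ : ∀ j, |φ j| ≤ K) {w : ℝ → ℝ} (hw : Measurable w) :
    ∃ r : Action U, ∀ y, 0 ≤ y → averageHamiltonian lam c Lam r.1 φ (w y) i y =
      minHamiltonian lam c Lam φ (w y) i y := by
  obtain ⟨s, hs, hmin⟩ := exists_measurable_minimiser
    (f := fun y => hamiltonian lam c Lam φ (w y) i (max y 0))
    (fun y => continuous_hamiltonian h hc i hφ (w y) y)
    (fun a => (measurable_hamiltonian h hc i hφ hw).comp (measurable_id.prodMk measurable_const))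
  refine ⟨⟨fun y => ⟨Measure.dirac (s y), inferInstance⟩,
    (Measure.measurable_dirac.comp hs).subtype_mk⟩, fun y hy => ?_⟩
  simp only [averageHamiltonian, max_eq_left hy, ProbabilityMeasure.coe_mk]
  rw [integral_dirac]
  have := hmin y
  rw [max_eq_left hy] at this
  rw [this, minHamiltonian, max_eq_left hy]

end Hamiltonian

/-! ### The optimality equation as a resolvent equation -/

section Killing

variable {α Lam B W : ℝ} {κ b w : ℝ → ℝ}

theorem intervalIntegrable_of_bounded {f : ℝ → ℝ} (hf : Measurable f) {K : ℝ}
    (hK : ∀ y, |f y| ≤ K) (s t : ℝ) : IntervalIntegrable f volume s t := by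
  refine (intervalIntegrable_const (c := K)).mono_fun hf.aestronglyMeasurable
    (Eventually.of_forall fun y => ?_)
  exact (hK y).trans (le_abs_self K)

/-- The primitive of a bounded measurable rate, exponentiated, is absolutely continuous. -/
theorem absolutelyContinuousOnInterval_exp_primitive {f : ℝ → ℝ} (hf : Measurable f) {K : ℝ}
    (hK : ∀ y, |f y| ≤ K) (T : ℝ) :
    AbsolutelyContinuousOnInterval (fun y => Real.exp (∫ s in (0 : ℝ)..y, f s)) 0 T := by
  have hK0 : 0 ≤ K := (abs_nonneg _).trans (hK 0)
  have hi := intervalIntegrable_of_bounded hf hK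
  have hA : LipschitzWith ⟨K, hK0⟩ fun y => ∫ s in (0 : ℝ)..y, f s := by
    refine LipschitzWith.of_dist_le_mul fun y y' => ?_
    rw [Real.dist_eq, intervalIntegral.integral_interval_sub_left (hi _ _) (hi _ _),
      ← Real.norm_eq_abs]
    exact intervalIntegral.norm_integral_le_of_norm_le_const fun s _ => hK s
  have hcpt : IsCompact ((fun y => ∫ s in (0 : ℝ)..y, f s) '' uIcc 0 T) :=
    isCompact_uIcc.image hA.continuous
  obtain ⟨R, hR⟩ := hcpt.isBounded.subset_closedBall 0
  obtain ⟨L, hL⟩ := (Real.contDiff_exp (n := 1)).contDiffOn.exists_lipschitzOnWith (by decide)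
    (convex_closedBall (0 : ℝ) R) (isCompact_closedBall 0 R)
  exact (hL.comp hA.lipschitzOnWith fun y hy => hR ⟨y, hy, rfl⟩).absolutelyContinuousOnInterval

/-- A bounded solution of the resolvent equation with source `b` and killing at rate `κ` is, at
`0`, the integral of the source discounted at rate `α` and killed at rate `κ`: along the flow the
discounted and killed solution has almost everywhere the derivative
`- exp (-α y) * exp (- ∫_0^y κ) * b y`, and it is absolutely continuous. -/
theorem resolvent_fixedPoint_zero (hα : 0 < α) (hκ : Measurable κ) (hκ0 : ∀ y, 0 ≤ κ y)
    (hκL : ∀ y, κ y ≤ Lam) (hb : Measurable b) (hB : ∀ y, |b y| ≤ B) (hw : Measurable w)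
    (hW : ∀ y, |w y| ≤ W)
    (heq : ∀ y, w y = resolvent (α + Lam) (fun y => b y + (Lam - κ y) * w y) y) :
    w 0 = ∫ y in Ioi (0 : ℝ), Real.exp (-α * y) * Real.exp (-∫ s in (0 : ℝ)..y, κ s) * b y := by
  have hLam : 0 ≤ Lam := (hκ0 0).trans (hκL 0)
  have hβ : 0 < α + Lam := by linarith
  have hW0 : 0 ≤ W := (abs_nonneg _).trans (hW 0)
  have hB0 : 0 ≤ B := (abs_nonneg _).trans (hB 0)
  set q : ℝ → ℝ := fun y => b y + (Lam - κ y) * w y with hqdef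
  have hq : Measurable q := hb.add ((measurable_const.sub hκ).mul hw)
  have hqB : ∀ y, |q y| ≤ B + Lam * W := fun y => by
    refine (abs_add_le _ _).trans (add_le_add (hB y) ?_)
    rw [abs_mul, abs_of_nonneg (sub_nonneg.2 (hκL y))]
    exact mul_le_mul (by linarith [hκ0 y]) (hW y) (abs_nonneg _) hLam
  have hκabs : ∀ y, |κ y| ≤ Lam := fun y => by rw [abs_of_nonneg (hκ0 y)]; exact hκL y
  have hρ : ∀ y, |Lam - κ y| ≤ Lam := fun y => by
    rw [abs_of_nonneg (sub_nonneg.2 (hκL y))]; linarith [hκ0 y]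
  have hκi := intervalIntegrable_of_bounded hκ hκabs
  set e : ℝ → ℝ := fun y => Real.exp (-(α + Lam) * y) * q y with he
  have hei : ∀ s t, IntervalIntegrable e volume s t := fun s t =>
    (intervalIntegrable_of_bounded hq hqB s t).continuousOn_mul (by fun_prop)
  -- the explicit form of the solution
  have hwe : ∀ y, w 0 - ∫ s in (0 : ℝ)..y, e s = Real.exp (-(α + Lam) * y) * w y := by
    intro y
    have := resolvent_eq_add hβ hq hqB 0 y
    simp only [zero_add] at this
    rw [← heq, ← heq] at this
    linarith
  set G : ℝ → ℝ := fun y => Real.exp (-∫ s in (0 : ℝ)..y, κ s) with hG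
  have hGc : Continuous G :=
    Real.continuous_exp.comp (intervalIntegral.continuous_primitive hκi 0).neg
  set E : ℝ → ℝ := fun y => Real.exp (∫ s in (0 : ℝ)..y, (Lam - κ s)) with hE
  have hEG : ∀ y, E y = Real.exp (Lam * y) * G y := fun y => by
    simp only [hE, hG]
    rw [intervalIntegral.integral_sub intervalIntegrable_const (hκi 0 y),
      intervalIntegral.integral_const, ← Real.exp_add, smul_eq_mul]
    ring_nf
  set d : ℝ → ℝ := fun y => Real.exp (-α * y) * G y * b y with hd
  have hdi : ∀ s t, IntervalIntegrable d volume s t := fun s t =>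
    (intervalIntegrable_of_bounded hb hB s t).continuousOn_mul
      (((by fun_prop : Continuous fun y : ℝ => Real.exp (-α * y)).mul hGc).continuousOn)
  have hconst : ∀ T, 0 ≤ T → w 0 = Real.exp (-α * T) * G T * w T + ∫ y in (0 : ℝ)..T, d y := by
    intro T hT
    have hρm : Measurable fun y => Lam - κ y := measurable_const.sub hκ
    have hac : AbsolutelyContinuousOnInterval
        (fun y => E y * (w 0 + (-1) * ∫ s in (0 : ℝ)..y, e s) + ∫ s in (0 : ℝ)..y, d s) 0 T := by
      have h0 : (0 : ℝ) ∈ uIcc 0 T := left_mem_uIcc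
      have h1 := absolutelyContinuousOnInterval_exp_primitive hρm hρ T
      have h2 := (hei 0 T).absolutelyContinuousOnInterval_intervalIntegral h0
      have h3 := (hdi 0 T).absolutelyContinuousOnInterval_intervalIntegral h0
      have h4 : AbsolutelyContinuousOnInterval (fun _ : ℝ => w 0) 0 T :=
        (LipschitzWith.const (w 0)).lipschitzOnWith.absolutelyContinuousOnInterval
      exact (h1.mul (h4.add (h2.const_mul (-1)))).add h3
    have hder : ∀ᵐ y, y ∈ uIcc 0 T → HasDerivAt
        (fun y => E y * (w 0 + (-1) * ∫ s in (0 : ℝ)..y, e s) + ∫ s in (0 : ℝ)..y, d s) 0 y := by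
      have h0 : (0 : ℝ) ∈ uIcc 0 T := left_mem_uIcc
      filter_upwards [(intervalIntegrable_of_bounded hρm hρ 0 T).ae_hasDerivAt_integral,
        (hei 0 T).ae_hasDerivAt_integral, (hdi 0 T).ae_hasDerivAt_integral] with y h1 h2 h3 hy
      have h := (((h1 hy 0 h0).exp).mul (((h2 hy 0 h0).const_mul (-1)).const_add (w 0))).add
        (h3 hy 0 h0)
      refine h.congr_deriv ?_
      have h5 : w 0 + (-1) * ∫ s in (0 : ℝ)..y, e s = Real.exp (-(α + Lam) * y) * w y := by
        rw [← hwe y]; ring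
      have h6 : Real.exp (∫ s in (0 : ℝ)..y, (Lam - κ s)) = Real.exp (Lam * y) * G y := hEG y
      have h7 : Real.exp (Lam * y) * Real.exp (-(α + Lam) * y) = Real.exp (-α * y) := by
        rw [← Real.exp_add]; ring_nf
      rw [h5, h6]
      simp only [he, hd, hqdef, ← h7]
      ring
    obtain ⟨c, hc⟩ := hac.const_of_ae_hasDerivAt_zero hder
    have h1 := hc 0 left_mem_uIcc
    have h2 := hc T right_mem_uIcc
    have h7 : Real.exp (Lam * T) * Real.exp (-(α + Lam) * T) = Real.exp (-α * T) := by
      rw [← Real.exp_add]; ring_nf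
    have h5 : w 0 + (-1) * ∫ s in (0 : ℝ)..T, e s = Real.exp (-(α + Lam) * T) * w T := by
      rw [← hwe T]; ring
    simp only [intervalIntegral.integral_same, mul_zero, add_zero] at h1
    rw [h5, hEG] at h2
    have hE0 : E 0 = 1 := by simp [hE]
    rw [hE0, one_mul] at h1
    rw [h1, ← h2, ← h7]
    ring
  have hG1 : ∀ y, 0 ≤ y → G y ≤ 1 := fun y hy => by
    refine Real.exp_le_one_iff.2 ?_
    have := intervalIntegral.integral_nonneg (μ := volume) hy (fun s _ => hκ0 s)
    linarith
  have hdint : IntegrableOn d (Ioi 0) := by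
    refine Integrable.mono' ((exp_neg_integrableOn_Ioi 0 hα).mul_const B) ?_ ?_
    · exact ((((by fun_prop : Continuous fun y : ℝ => Real.exp (-α * y)).mul
        hGc).measurable).mul hb).aestronglyMeasurable
    · refine (ae_restrict_iff' measurableSet_Ioi).2 (Eventually.of_forall fun y hy => ?_)
      rw [hd, norm_mul, norm_mul, Real.norm_of_nonneg (Real.exp_pos _).le,
        Real.norm_of_nonneg (Real.exp_pos _).le, mul_assoc]
      refine mul_le_mul_of_nonneg_left ?_ (Real.exp_pos _).le
      exact (mul_le_of_le_one_left (norm_nonneg _) (hG1 y (le_of_lt hy))).trans (hB y)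
  have hlim1 := intervalIntegral_tendsto_integral_Ioi 0 hdint tendsto_id
  have hlim2 : Tendsto (fun T => Real.exp (-α * T) * G T * w T) atTop (𝓝 0) := by
    have hexp : Tendsto (fun T : ℝ => Real.exp (-α * T) * W) atTop (𝓝 0) := by
      have : Tendsto (fun T : ℝ => -α * T) atTop atBot :=
        tendsto_id.const_mul_atTop_of_neg (by linarith)
      simpa using (Real.tendsto_exp_atBot.comp this).mul_const W
    refine squeeze_zero_norm' ?_ hexp
    filter_upwards [eventually_ge_atTop 0] with T hT
    rw [norm_mul, norm_mul, Real.norm_of_nonneg (Real.exp_pos _).le,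
      Real.norm_of_nonneg (Real.exp_pos _).le, mul_assoc]
    refine mul_le_mul_of_nonneg_left ?_ (Real.exp_pos _).le
    exact (mul_le_of_le_one_left (norm_nonneg _) (hG1 T hT)).trans (hW T)
  have hlim := hlim2.add hlim1
  rw [zero_add] at hlim
  refine tendsto_nhds_unique (tendsto_const_nhds.congr' ?_) hlim
  filter_upwards [eventually_ge_atTop 0] with T hT
  exact hconst T hT

end Killing

section Bellman

variable {U : Type*} [MetricSpace U] [CompactSpace U] [MeasurableSpace U] [BorelSpace U]
  {lam : ℕ → ℕ → ℝ → U → ℝ} {Lam : ℝ} {c : ℕ → ℝ → U → ℝ} {C : ℝ}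

theorem averageHamiltonian_eq (h : BoundedRates lam Lam) (hc : BoundedCost c C)
    (r : ℝ → ProbabilityMeasure U) (i : ℕ) {φ : ℕ → ℝ} {K : ℝ} (hφ : ∀ j, |φ j| ≤ K) (w y : ℝ) :
    averageHamiltonian lam c Lam r φ w i y =
      relaxedCost c i (max y 0) (r (max y 0)) +
      ∑' j : {j : ℕ // j ≠ i}, relaxedRate lam i j (max y 0) (r (max y 0)) * φ j +
      (Lam - ∫ a, exitRate lam i (max y 0) a ∂(r (max y 0) : Measure U)) * w := by
  have hy : (0 : ℝ) ≤ max y 0 := le_max_right _ _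
  have h1 : Integrable (c i (max y 0)) (r (max y 0) : Measure U) :=
    integrable_of_continuous (hc.action i _ hy)
  have h2 : Integrable (fun a => ∑' j : {j : ℕ // j ≠ i}, lam i j (max y 0) a * φ j)
      (r (max y 0) : Measure U) :=
    integrable_of_continuous ((h.continuous_tsum_mul i hφ).comp (Continuous.prodMk_right y))
  have h3 : Integrable (exitRate lam i (max y 0)) (r (max y 0) : Measure U) :=
    integrable_of_continuous (h.continuous_exitRate_right i hy)
  have h12 : Integrable (fun a => c i (max y 0) a +
      ∑' j : {j : ℕ // j ≠ i}, lam i j (max y 0) a * φ j) (r (max y 0) : Measure U) := h1.add h2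
  have h4 : Integrable (fun a => (Lam - exitRate lam i (max y 0) a) * w)
      (r (max y 0) : Measure U) := ((integrable_const Lam).sub h3).mul_const w
  simp only [averageHamiltonian, hamiltonian]
  rw [integral_add h12 h4, integral_add h1 h2, integral_mul_const,
    integral_sub (integrable_const _) h3,
    (h.hasSum_relaxedRate_mul i hy _ hφ).tsum_eq, integral_const, relaxedCost]
  simp

theorem setIntegral_Ioi_eq_of_eqOn {f g : ℝ → ℝ} (h : ∀ y, 0 < y → f y = g y) :
    ∫ y in Ioi (0 : ℝ), f y = ∫ y in Ioi (0 : ℝ), g y :=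
  setIntegral_congr_fun measurableSet_Ioi fun y hy => h y hy

theorem survival_eq (lam : ℕ → ℕ → ℝ → U → ℝ) (i : ℕ) (r : Action U) {y : ℝ} (hy : 0 ≤ y) :
    survival lam i r y = Real.exp (-∫ s in (0 : ℝ)..y,
      ∫ a, exitRate lam i (max s 0) a ∂(r.1 (max s 0) : Measure U)) := by
  rw [survival, intervalIntegral.integral_of_le hy]
  congr 2
  refine setIntegral_congr_fun measurableSet_Ioc fun s hs => ?_
  simp only [max_eq_left hs.1.le]

theorem BoundedRates.measurable_relaxedExitRate (h : BoundedRates lam Lam) (i : ℕ) (r : Action U) :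
    Measurable fun y : ℝ => ∫ a, exitRate lam i (max y 0) a ∂(r.1 (max y 0) : Measure U) :=
  measurable_average (r.2.comp (by fun_prop : Measurable fun y : ℝ => max y 0))
    (f := fun p => exitRate lam i (max p.1 0) p.2) (h.continuous_exitRate i).measurable

theorem BoundedRates.measurable_relaxedRate (h : BoundedRates lam Lam) {i j : ℕ} (hij : i ≠ j)
    (r : Action U) : Measurable fun y : ℝ => relaxedRate lam i j (max y 0) (r.1 (max y 0)) :=
  measurable_average (r.2.comp (by fun_prop : Measurable fun y : ℝ => max y 0))
    (f := fun p => lam i j (max p.1 0) p.2) (h.continuous_lam hij).measurable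

theorem BoundedCost.measurable_relaxedCost (hc : BoundedCost c C) (i : ℕ) (r : Action U) :
    Measurable fun y : ℝ => relaxedCost c i (max y 0) (r.1 (max y 0)) :=
  measurable_average (r.2.comp (by fun_prop : Measurable fun y : ℝ => max y 0))
    (f := fun p => c i (max p.1 0) p.2) (hc.measurable_clamp i)

/-- The discounted contribution of the jumps to `j`; if the transition probability vanishes, so
does the density of the jump time, and both sides are `0`. -/
theorem transitionProb_mul_integral (h : BoundedRates lam Lam) {i j : ℕ} (hij : i ≠ j)
    (r : Action U) (α x : ℝ)
    (hint : IntegrableOn (fun y => survival lam i r y * relaxedRate lam i j y (r.1 y)) (Ioi 0)) :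
    transitionProb lam i j r * ∫ t, Real.exp (-α * t) * x ∂(sojournLaw lam i j r) =
      ∫ y in Ioi (0 : ℝ), Real.exp (-α * y) *
        (survival lam i r y * (relaxedRate lam i j y (r.1 y) * x)) := by
  have hnn : ∀ y, 0 < y → 0 ≤ survival lam i r y * relaxedRate lam i j y (r.1 y) := fun y hy =>
    mul_nonneg (Real.exp_pos _).le (h.relaxedRate_nonneg hij hy.le _)
  have hp : 0 ≤ transitionProb lam i j r := setIntegral_nonneg measurableSet_Ioi hnn
  rcases hp.eq_or_lt with hp0 | hp0
  · rw [← hp0, zero_mul]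
    have hz : ∀ᵐ y ∂(volume.restrict (Ioi (0 : ℝ))),
        survival lam i r y * relaxedRate lam i j y (r.1 y) = 0 := by
      refine (integral_eq_zero_iff_of_nonneg_ae ?_ hint).1 hp0.symm
      exact (ae_restrict_iff' measurableSet_Ioi).2 (Eventually.of_forall hnn)
    refine (integral_eq_zero_of_ae ?_).symm
    filter_upwards [hz] with y hy
    rw [← mul_assoc (survival lam i r y), hy, zero_mul, mul_zero, Pi.zero_apply]
  · rw [sojournLaw, integral_withDensity_eq_integral_toReal_smul₀
      ((hint.aestronglyMeasurable.aemeasurable.div_const _).ennreal_ofReal)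
      (Eventually.of_forall fun y => ENNReal.ofReal_lt_top), ← integral_const_mul]
    refine setIntegral_congr_fun measurableSet_Ioi fun y hy => ?_
    simp only [smul_eq_mul]
    rw [ENNReal.toReal_ofReal (div_nonneg (hnn y hy) hp)]
    field_simp

/-- The right-hand side of the optimality equation is the value at age `0` of the resolvent
equation for the sojourn in state `i`. -/
theorem bellman_eq_of_resolvent_eq (h : BoundedRates lam Lam) (hc : BoundedCost c C) {α m : ℝ}
    (hα : 0 < α) (hm : 0 < m) (hlow : ∀ i y, 0 ≤ y → ∀ u, m ≤ exitRate lam i y u)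
    (i : ℕ) (r : Action U) {φ : ℕ → ℝ} {K W : ℝ} (hφ : ∀ j, |φ j| ≤ K) {w : ℝ → ℝ}
    (hw : Measurable w) (hW : ∀ y, |w y| ≤ W)
    (heq : ∀ y, w y = resolvent (α + Lam)
      (fun y => averageHamiltonian lam c Lam r.1 φ (w y) i y) y) :
    bellman lam c α φ i r = w 0 := by
  have hK : 0 ≤ K := (abs_nonneg _).trans (hφ 0)
  set κ : ℝ → ℝ := fun y => ∫ a, exitRate lam i (max y 0) a ∂(r.1 (max y 0) : Measure U) with hκdef
  have hκ : Measurable κ := h.measurable_relaxedExitRate i r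
  have hκ0 : ∀ y, 0 ≤ κ y := fun y =>
    integral_nonneg fun a => h.exitRate_nonneg i (le_max_right _ _) a
  have hκL : ∀ y, κ y ≤ Lam := fun y => h.relaxedExitRate_le i (le_max_right _ _) _
  have hκm : ∀ y, m ≤ κ y := fun y => by
    refine le_trans (by simp) (integral_mono (integrable_const m)
      (integrable_of_continuous (h.continuous_exitRate_right i (le_max_right y 0)))
      (hlow i _ (le_max_right y 0)))
  have hκabs : ∀ y, |κ y| ≤ Lam := fun y => by rw [abs_of_nonneg (hκ0 y)]; exact hκL y
  have hκi := intervalIntegrable_of_bounded hκ hκabs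
  set G : ℝ → ℝ := fun y => Real.exp (-∫ s in (0 : ℝ)..y, κ s) with hG
  have hGs : ∀ y, 0 < y → survival lam i r y = G y := fun y hy => survival_eq lam i r hy.le
  have hGc : Continuous G :=
    Real.continuous_exp.comp (intervalIntegral.continuous_primitive hκi 0).neg
  have hGle : ∀ y, 0 < y → G y ≤ Real.exp (-m * y) := fun y hy => by
    refine Real.exp_le_exp.2 ?_
    have : ∫ _ in (0 : ℝ)..y, m ≤ ∫ s in (0 : ℝ)..y, κ s :=
      intervalIntegral.integral_mono_on hy.le (intervalIntegrable_const (c := m)) (hκi 0 y)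
        (fun s _ => hκm s)
    rw [intervalIntegral.integral_const, smul_eq_mul] at this
    linarith
  have hG1 : ∀ y, 0 < y → G y ≤ 1 := fun y hy =>
    (hGle y hy).trans (Real.exp_le_one_iff.2 (by nlinarith))
  let ρ : ℕ → ℝ → ℝ := fun j y => relaxedRate lam i j (max y 0) (r.1 (max y 0))
  have hρs : ∀ y, HasSum (fun j : {j : ℕ // j ≠ i} => ρ j y) (κ y) := fun y =>
    h.hasSum_relaxedRate i (le_max_right _ _) _
  have hρ0 : ∀ (j : {j : ℕ // j ≠ i}) y, 0 ≤ ρ j y := fun j y =>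
    h.relaxedRate_nonneg (Ne.symm j.2) (le_max_right _ _) _
  have hρm : ∀ j : {j : ℕ // j ≠ i}, Measurable (ρ j) := fun j =>
    h.measurable_relaxedRate (Ne.symm j.2) r
  have hρL : ∀ (j : {j : ℕ // j ≠ i}) y, ρ j y ≤ Lam := fun j y =>
    (le_hasSum (hρs y) j fun k _ => hρ0 k y).trans (hκL y)
  let σ : ℝ → ℝ := fun y => ∑' j : {j : ℕ // j ≠ i}, ρ j y * φ j
  have hρφ : ∀ y, HasSum (fun j : {j : ℕ // j ≠ i} => ρ j y * φ j) (σ y) := fun y =>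
    (h.hasSum_relaxedRate_mul i (le_max_right y 0) (r.1 (max y 0)) hφ).summable.hasSum
  have hσm : Measurable σ := by
    have : σ = fun y => ∫ a, ∑' j : {j : ℕ // j ≠ i}, lam i j (max y 0) a * φ j
        ∂(r.1 (max y 0) : Measure U) := by
      funext y
      exact (h.hasSum_relaxedRate_mul i (le_max_right y 0) (r.1 (max y 0)) hφ).tsum_eq
    rw [this]
    exact measurable_average (r.2.comp (by fun_prop : Measurable fun y : ℝ => max y 0))
      (f := fun p => ∑' j : {j : ℕ // j ≠ i}, lam i j (max p.1 0) p.2 * φ j)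
      (h.continuous_tsum_mul i hφ).measurable
  have hσB : ∀ y, |σ y| ≤ Lam * K := fun y => by
    rw [← Real.norm_eq_abs]
    refine (tsum_of_norm_bounded ((hρs y).mul_right K) fun j => ?_).trans
      (mul_le_mul_of_nonneg_right (hκL y) hK)
    rw [norm_mul, Real.norm_of_nonneg (hρ0 j y)]
    exact mul_le_mul_of_nonneg_left (hφ j) (hρ0 j y)
  let k : ℝ → ℝ := fun y => relaxedCost c i (max y 0) (r.1 (max y 0))
  have hkm : Measurable k := hc.measurable_relaxedCost i r
  have hkB : ∀ y, |k y| ≤ C := fun y =>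
    abs_integral_le_of_abs_le fun a => hc.abs_le i (le_max_right _ _) a
  have hfix := resolvent_fixedPoint_zero (κ := κ) (b := fun y => k y + σ y) (B := C + Lam * K) hα hκ
    hκ0 hκL (hkm.add hσm) (fun y => (abs_add_le _ _).trans (add_le_add (hkB y) (hσB y))) hw hW
    (fun y => by
      rw [heq y]
      congr 1
      funext y
      exact averageHamiltonian_eq h hc r.1 i hφ _ y)
  have hexpc : Continuous fun y : ℝ => Real.exp (-α * y) := by fun_prop
  have hexpi := exp_neg_integrableOn_Ioi 0 hα
  have hEG1 : ∀ y, 0 < y → Real.exp (-α * y) * G y ≤ Real.exp (-α * y) := fun y hy =>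
    mul_le_of_le_one_right (Real.exp_pos _).le (hG1 y hy)
  -- every bounded function is integrable against the discounted survival function
  have hint : ∀ f : ℝ → ℝ, Measurable f → ∀ F, (∀ y, |f y| ≤ F) →
      IntegrableOn (fun y => Real.exp (-α * y) * G y * f y) (Ioi 0) := by
    intro f hf F hF
    refine Integrable.mono' (hexpi.mul_const F)
      (((hexpc.mul hGc).measurable.mul hf).aestronglyMeasurable) ?_
    refine (ae_restrict_iff' measurableSet_Ioi).2 (Eventually.of_forall fun y hy => ?_)
    rw [norm_mul, Real.norm_of_nonneg (by positivity)]
    exact mul_le_mul (hEG1 y hy) (hF y) (norm_nonneg _) (Real.exp_pos _).le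
  have hstage : stageCost lam c α i r = ∫ y in Ioi (0 : ℝ), Real.exp (-α * y) * G y * k y := by
    refine setIntegral_Ioi_eq_of_eqOn fun y hy => ?_
    simp only [k, hGs y hy, max_eq_left hy.le]
  have hjump : ∀ j : {j : ℕ // j ≠ i}, transitionProb lam i j r *
      ∫ t, Real.exp (-α * t) * φ j ∂(sojournLaw lam i j r) =
      ∫ y in Ioi (0 : ℝ), Real.exp (-α * y) * G y * (ρ j y * φ j) := by
    intro j
    rw [transitionProb_mul_integral h (Ne.symm j.2) r α (φ j)]
    · refine setIntegral_Ioi_eq_of_eqOn fun y hy => ?_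
      simp only [ρ, hGs y hy, max_eq_left hy.le]
      ring
    · have h1 : IntegrableOn (fun y => G y * ρ j y) (Ioi 0) := by
        refine Integrable.mono' ((exp_neg_integrableOn_Ioi 0 hm).mul_const Lam)
          ((hGc.measurable.mul (hρm j)).aestronglyMeasurable) ?_
        refine (ae_restrict_iff' measurableSet_Ioi).2 (Eventually.of_forall fun y hy => ?_)
        rw [norm_mul, Real.norm_of_nonneg (Real.exp_pos _).le, Real.norm_of_nonneg (hρ0 j y)]
        exact mul_le_mul (hGle y hy) (hρL j y) (hρ0 j y) (Real.exp_pos _).le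
      refine h1.congr_fun (fun y hy => ?_) measurableSet_Ioi
      have hy' : (0 : ℝ) < y := hy
      simp only [ρ, hGs y hy', max_eq_left hy'.le]
  have hsum : HasSum (fun j : {j : ℕ // j ≠ i} =>
      ∫ y in Ioi (0 : ℝ), Real.exp (-α * y) * G y * (ρ j y * φ j))
      (∫ y in Ioi (0 : ℝ), Real.exp (-α * y) * G y * σ y) := by
    refine hasSum_integral_of_dominated_convergence
      (fun (j : {j : ℕ // j ≠ i}) y => Real.exp (-α * y) * G y * (ρ j y * K)) ?_ ?_ ?_ ?_ ?_
    · exact fun j => ((hexpc.mul hGc).measurable.mul ((hρm j).mul_const _)).aestronglyMeasurable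
    · refine fun j => Eventually.of_forall fun y => ?_
      rw [norm_mul, norm_mul (ρ j y), Real.norm_of_nonneg (hρ0 j y),
        Real.norm_of_nonneg (by positivity : 0 ≤ Real.exp (-α * y) * G y)]
      exact mul_le_mul_of_nonneg_left (mul_le_mul_of_nonneg_left (hφ j) (hρ0 j y)) (by positivity)
    · exact Eventually.of_forall fun y => ((hρs y).summable.mul_right K).mul_left _
    · simp_rw [tsum_mul_left, tsum_mul_right, (hρs _).tsum_eq]
      refine hint (fun y => κ y * K) (hκ.mul_const K) (Lam * K) fun y => ?_
      rw [abs_mul, abs_of_nonneg hK]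
      exact mul_le_mul_of_nonneg_right (hκabs y) hK
    · exact Eventually.of_forall fun y => (hρφ y).mul_left _
  rw [bellman, hstage, tsum_congr hjump, hsum.tsum_eq, hfix,
    ← integral_add (hint k hkm C hkB) (hint σ hσm _ hσB)]
  refine integral_congr_ae (Eventually.of_forall fun y => ?_)
  simp only [hG]
  ring

end Bellman

/-! ### The cost over a short time interval -/

section OneStep

variable {U : Type*} [MetricSpace U] [CompactSpace U] [MeasurableSpace U] [BorelSpace U]
  {lam : ℕ → ℕ → ℝ → U → ℝ} {Lam : ℝ} {c : ℕ → ℝ → U → ℝ} {C : ℝ} {u : Control U}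
  {v : ℕ × ℝ → ℝ} {K L : ℝ}

/-- The value `v` after a point of the noise met at `x`, integrated over the mark of the point. -/
noncomputable def pointValue (lam : ℕ → ℕ → ℝ → U → ℝ) (Lam : ℝ) (u : Control U) (v : ℕ × ℝ → ℝ)
    (x : ℕ × ℝ) : ℝ :=
  ∫ z in Ico 0 Lam, v (postJump lam u x z)

theorem BoundedRates.measurable_pointValue (h : BoundedRates lam Lam) (u : Control U)
    (hv : Measurable v) : Measurable (pointValue lam Lam u v) :=
  (StronglyMeasurable.integral_prod_right' (ν := volume.restrict (Ico 0 Lam))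
    (f := fun q : (ℕ × ℝ) × ℝ => v (postJump lam u q.1 q.2))
    (hv.comp (h.measurable_postJump u)).stronglyMeasurable).measurable

theorem abs_pointValue_le (hLam : 0 ≤ Lam) (hK : ∀ x, |v x| ≤ K) (x : ℕ × ℝ) :
    |pointValue lam Lam u v x| ≤ Lam * K := by
  have := norm_setIntegral_le_of_norm_le_const (μ := volume) (s := Ico 0 Lam)
    (f := fun z => v (postJump lam u x z)) (C := K) (by simp) fun z _ => hK _
  rw [measureReal_def, Real.volume_Ico, sub_zero, ENNReal.toReal_ofReal hLam, mul_comm] at this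
  exact this

theorem BoundedCost.measurable_policyCost_pair (hc : BoundedCost c C) (u : Control U) :
    Measurable fun x : ℕ × ℝ => policyCost c u x.1 x.2 :=
  measurable_from_prod_countable_right fun i => hc.measurable_policyCost u i

theorem BoundedCost.measurable_integral_policyCost (hc : BoundedCost c C) (u : Control U) {δ : ℝ}
    (hδ : 0 ≤ δ) :
    Measurable fun x : ℕ × ℝ => ∫ r in (0 : ℝ)..δ, policyCost c u x.1 (x.2 + r) := by
  simp_rw [intervalIntegral.integral_of_le hδ]
  exact (((hc.measurable_policyCost_pair u).comp (by fun_prop :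
    Measurable fun q : (ℕ × ℝ) × ℝ => (q.1.1, q.1.2 + q.2))).stronglyMeasurable.integral_prod_right'
    (ν := volume.restrict (Ioc 0 δ))).measurable

theorem BoundedCost.abs_integral_policyCost_le (hc : BoundedCost c C) (u : Control U) {δ : ℝ}
    (hδ : 0 ≤ δ) (x : ℕ × ℝ) :
    |∫ r in (0 : ℝ)..δ, policyCost c u x.1 (x.2 + r)| ≤ C * δ := by
  have := intervalIntegral.norm_integral_le_of_norm_le_const (a := 0) (b := δ)
    (f := fun r => policyCost c u x.1 (x.2 + r)) fun r _ => hc.abs_policyCost_le u _ _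
  rwa [sub_zero, abs_of_nonneg hδ] at this

theorem volume_real_cell (hLam : 0 ≤ Lam) {s t : ℝ} (hst : s ≤ t) :
    volume.real (cell Lam s t) = (t - s) * Lam := by
  rw [measureReal_def, cell, Measure.volume_eq_prod, Measure.prod_prod, Real.volume_Ioc,
    Real.volume_Ico, sub_zero, ENNReal.toReal_mul, ENNReal.toReal_ofReal (by linarith),
    ENNReal.toReal_ofReal hLam]

theorem volume_cell_lt_top (Lam s t : ℝ) : volume (cell Lam s t) < ∞ := by
  rw [cell, Measure.volume_eq_prod, Measure.prod_prod, Real.volume_Ioc, Real.volume_Ico]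
  exact ENNReal.mul_lt_top ENNReal.ofReal_lt_top ENNReal.ofReal_lt_top

theorem noiseIntensity_restrict_cell {s t : ℝ} (hs : 0 ≤ s) :
    noiseIntensity.restrict (cell Lam s t) = volume.restrict (cell Lam s t) := by
  have : noiseIntensity = (volume : Measure (ℝ × ℝ)).restrict (Ici 0 ×ˢ univ) := by
    rw [noiseIntensity, Measure.volume_eq_prod, ← Measure.prod_restrict, Measure.restrict_univ]
  rw [this, Measure.restrict_restrict (measurableSet_cell _ _ _), inter_eq_left.2]
  exact fun p hp => ⟨hs.trans hp.1.1.le, mem_univ _⟩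

theorem BoundedRates.integrableOn_afterPoint (h : BoundedRates lam Lam) (u : Control U) (s t : ℝ)
    (x : ℕ × ℝ) (hv : Measurable v) (hK : ∀ x, |v x| ≤ K) :
    IntegrableOn (fun p => v (afterPoint lam u s t x p)) (cell Lam s t) :=
  Measure.integrableOn_of_bounded (volume_cell_lt_top _ _ _).ne
    (hv.comp ((h.measurable_afterPoint u s t).comp measurable_prodMk_left)).aestronglyMeasurable
    (Eventually.of_forall fun _ => hK _)

theorem BoundedRates.measurable_postJump_moving (h : BoundedRates lam Lam) (u : Control U) (s : ℝ)
    (x : ℕ × ℝ) (hv : Measurable v) :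
    Measurable fun p : ℝ × ℝ => v (postJump lam u (x.1, x.2 + (p.1 - s)) p.2) :=
  hv.comp ((h.measurable_postJump u).comp
    (by fun_prop : Measurable fun p : ℝ × ℝ => (((x.1, x.2 + (p.1 - s)), p.2) : (ℕ × ℝ) × ℝ)))

theorem BoundedRates.setIntegral_cell_postJump (h : BoundedRates lam Lam) (u : Control U)
    {s t : ℝ} (hst : s ≤ t) (x : ℕ × ℝ) (hv : Measurable v) (hK : ∀ x, |v x| ≤ K) :
    ∫ p in cell Lam s t, v (postJump lam u (x.1, x.2 + (p.1 - s)) p.2) =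
      ∫ r in (0 : ℝ)..(t - s), pointValue lam Lam u v (x.1, x.2 + r) := by
  have hint : IntegrableOn (fun p : ℝ × ℝ => v (postJump lam u (x.1, x.2 + (p.1 - s)) p.2))
      (Ioc s t ×ˢ Ico 0 Lam) (volume.prod volume) :=
    Measure.integrableOn_of_bounded (volume_cell_lt_top Lam s t).ne
      (h.measurable_postJump_moving u s x hv).aestronglyMeasurable
      (Eventually.of_forall fun p => hK _)
  rw [cell, Measure.volume_eq_prod, setIntegral_prod _ hint, ← intervalIntegral.integral_of_le hst]
  have := intervalIntegral.integral_comp_sub_right (a := s) (b := t)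
    (fun r => pointValue lam Lam u v (x.1, x.2 + r)) s
  rw [sub_self] at this
  exact this

/-- Neglecting the growth of the age after the point of the noise changes `v` by at most `L` times
the length of the interval; integrated over the position of the point, this is of second order. -/
theorem BoundedRates.abs_setIntegral_afterPoint_sub_le (h : BoundedRates lam Lam)
    (hLam : 0 ≤ Lam) (u : Control U) {s t : ℝ} (hst : s ≤ t) (x : ℕ × ℝ) (hv : Measurable v)
    (hK : ∀ x, |v x| ≤ K) (hL0 : 0 ≤ L) (hL : ∀ i y y', |v (i, y) - v (i, y')| ≤ L * |y - y'|) :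
    |(∫ p in cell Lam s t, v (afterPoint lam u s t x p)) -
      ∫ r in (0 : ℝ)..(t - s), pointValue lam Lam u v (x.1, x.2 + r)| ≤ L * Lam * (t - s) ^ 2 := by
  rw [← h.setIntegral_cell_postJump u hst x hv hK, ← integral_sub
    (h.integrableOn_afterPoint u s t x hv hK) (Measure.integrableOn_of_bounded
      (volume_cell_lt_top Lam s t).ne (h.measurable_postJump_moving u s x hv).aestronglyMeasurable
      (Eventually.of_forall fun p => hK _)), ← Real.norm_eq_abs]
  refine (norm_setIntegral_le_of_norm_le_const (C := L * (t - s)) (volume_cell_lt_top Lam s t)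
    fun p hp => ?_).trans (le_of_eq ?_)
  · refine (hL (postJump lam u (x.1, x.2 + (p.1 - s)) p.2).1
      ((postJump lam u (x.1, x.2 + (p.1 - s)) p.2).2 + (t - p.1))
      (postJump lam u (x.1, x.2 + (p.1 - s)) p.2).2).trans (mul_le_mul_of_nonneg_left ?_ hL0)
    rw [add_sub_cancel_left, abs_of_nonneg (by linarith [hp.1.2])]
    linarith [hp.1.1]
  · rw [volume_real_cell hLam hst]; ring

/-- The resolvent equation over a short time: up to an error of second order, the value is the cost
until `t` plus the discounted value at `t`, where at most one point of the noise is considered. -/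
theorem abs_value_sub_step_le (h : BoundedRates lam Lam) (hLam : 0 ≤ Lam) (hc : BoundedCost c C)
    {α : ℝ} (hα : 0 < α) (hv : Measurable v) (hK : ∀ x, |v x| ≤ K) (hL0 : 0 ≤ L)
    (hL : ∀ i y y', |v (i, y) - v (i, y')| ≤ L * |y - y'|)
    (heq : ∀ i y, v (i, y) = resolvent (α + Lam)
      (fun y => policyCost c u i y + pointValue lam Lam u v (i, y)) y)
    {s t : ℝ} (hst : s ≤ t) (x : ℕ × ℝ) :
    |v x - Real.exp (-α * (t - s)) * (Real.exp (-((t - s) * Lam)) * (v (x.1, x.2 + (t - s)) +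
        ∫ p in cell Lam s t, v (afterPoint lam u s t x p))) -
      ∫ r in (0 : ℝ)..(t - s), policyCost c u x.1 (x.2 + r)| ≤
    ((α + Lam) * (C + Lam * K) + L * Lam + (α + Lam) * (K * Lam)) * (t - s) ^ 2 := by
  set δ := t - s with hδ
  have hδ0 : 0 ≤ δ := by linarith
  set β := α + Lam with hβdef
  have hβ : 0 < β := by linarith
  have hK0 : 0 ≤ K := (abs_nonneg _).trans (hK x)
  set k : ℝ → ℝ := fun y => policyCost c u x.1 y with hk
  set p : ℝ → ℝ := fun y => pointValue lam Lam u v (x.1, y) with hp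
  have hkm : Measurable k := hc.measurable_policyCost u x.1
  have hpm : Measurable p := (h.measurable_pointValue u hv).comp measurable_prodMk_left
  have hkB : ∀ y, |k y| ≤ C := fun y => hc.abs_policyCost_le u x.1 y
  have hpB : ∀ y, |p y| ≤ Lam * K := fun y => abs_pointValue_le hLam hK _
  have hqB : ∀ y, |k y + p y| ≤ C + Lam * K := fun y =>
    (abs_add_le _ _).trans (add_le_add (hkB y) (hpB y))
  have hres := resolvent_eq_add (q := fun y => k y + p y) hβ (hkm.add hpm) hqB x.2 δ
  have h1 := heq x.1 x.2
  have h2 := heq x.1 (x.2 + δ)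
  simp only [hk, hp] at hres
  rw [← h1, ← h2] at hres
  have hki : IntervalIntegrable (fun r => k (x.2 + r)) volume 0 δ :=
    intervalIntegrable_of_bounded (hkm.comp (by fun_prop)) (fun y => hkB _) 0 δ
  have hpi : IntervalIntegrable (fun r => p (x.2 + r)) volume 0 δ :=
    intervalIntegrable_of_bounded (hpm.comp (by fun_prop)) (fun y => hpB _) 0 δ
  have hqi : IntervalIntegrable (fun r => k (x.2 + r) + p (x.2 + r)) volume 0 δ := hki.add hpi
  have heqi : IntervalIntegrable (fun r => Real.exp (-β * r) * (k (x.2 + r) + p (x.2 + r)))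
      volume 0 δ := hqi.continuousOn_mul (by fun_prop)
  set A := ∫ p in cell Lam s t, v (afterPoint lam u s t x p) with hA
  have hAK : |A| ≤ K * Lam * δ := by
    have := norm_setIntegral_le_of_norm_le_const (volume_cell_lt_top Lam s t)
      (f := fun p => v (afterPoint lam u s t x p)) (C := K) fun p _ => hK _
    rw [volume_real_cell hLam hst] at this
    calc |A| ≤ K * ((t - s) * Lam) := this
      _ = K * Lam * δ := by rw [hδ]; ring
  have hAP : |A - ∫ r in (0 : ℝ)..δ, p (x.2 + r)| ≤ L * Lam * δ ^ 2 :=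
    h.abs_setIntegral_afterPoint_sub_le hLam u hst x hv hK hL0 hL
  have hE : |∫ r in (0 : ℝ)..δ, (Real.exp (-β * r) * (k (x.2 + r) + p (x.2 + r)) -
      (k (x.2 + r) + p (x.2 + r)))| ≤ β * δ * (C + Lam * K) * |δ - 0| := by
    rw [← Real.norm_eq_abs]
    refine intervalIntegral.norm_integral_le_of_norm_le_const fun r hr => ?_
    rw [uIoc_of_le hδ0] at hr
    have e1 : Real.exp (-β * r) ≤ 1 := Real.exp_le_one_iff.2 (by nlinarith [hr.1])
    have e2 := Real.add_one_le_exp (-β * r)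
    rw [← sub_one_mul, norm_mul, Real.norm_eq_abs, abs_sub_comm,
      abs_of_nonneg (by linarith : 0 ≤ 1 - Real.exp (-β * r))]
    refine mul_le_mul (by nlinarith [hr.2]) (hqB _) (abs_nonneg _) (by positivity)
  rw [intervalIntegral.integral_sub heqi hqi, intervalIntegral.integral_add hki hpi, sub_zero,
    abs_of_nonneg hδ0] at hE
  have e1 : Real.exp (-β * δ) ≤ 1 := Real.exp_le_one_iff.2 (by nlinarith)
  have e2 := Real.add_one_le_exp (-β * δ)
  have hF : |(1 - Real.exp (-β * δ)) * A| ≤ β * δ * (K * Lam * δ) := by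
    rw [abs_mul, abs_of_nonneg (by linarith : 0 ≤ 1 - Real.exp (-β * δ))]
    exact mul_le_mul (by linarith) hAK (abs_nonneg _) (by positivity)
  have hexp : Real.exp (-α * δ) * Real.exp (-(δ * Lam)) = Real.exp (-β * δ) := by
    rw [← Real.exp_add, hβdef]; ring_nf
  rw [← mul_assoc, hexp, show v x = v (x.1, x.2) from rfl, hres]
  rw [abs_le] at hE hF hAP ⊢
  simp only [hk, hp] at hE hAP ⊢
  constructor <;> nlinarith [hE.1, hE.2, hF.1, hF.2, hAP.1, hAP.2]

variable {Ω : Type*} [MeasurableSpace Ω] {P : Measure Ω} [IsProbabilityMeasure P]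
  {N : Ω → Measure (ℝ × ℝ)}

theorem integrable_comp_of_bounded {Z : Ω → ℕ × ℝ} (hZ : AEMeasurable Z P) {f : ℕ × ℝ → ℝ}
    (hf : Measurable f) {B : ℝ} (hB : ∀ x, |f x| ≤ B) : Integrable (fun ω => f (Z ω)) P :=
  Integrable.of_bound (hf.comp_aemeasurable hZ).aestronglyMeasurable B
    (Eventually.of_forall fun _ => hB _)

/-- The expectation of `v` after a step, up to the probability of two points of the noise. -/
theorem abs_integral_step_sub_le (hN : IsPoissonRandomMeasure P N noiseIntensity)
    (h : BoundedRates lam Lam) (hLam : 0 ≤ Lam) (u : Control U) {s t : ℝ} (hs : 0 ≤ s)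
    (hst : s ≤ t) {Z Z' : Ω → ℕ × ℝ} (hZ : Measurable[noiseHistory N s] Z)
    (hZ' : AEMeasurable Z' P)
    (hstep : ∀ᵐ ω ∂P, N ω (cell Lam s t) ≤ 1 →
      Z' ω = cellStep lam Lam u s t (N ω) (Z ω))
    (hv : Measurable v) (hK : ∀ x, |v x| ≤ K) :
    |(∫ ω, v (Z' ω) ∂P) - ∫ ω, Real.exp (-((t - s) * Lam)) * (v ((Z ω).1, (Z ω).2 + (t - s)) +
      ∫ p in cell Lam s t, v (afterPoint lam u s t (Z ω) p)) ∂P| ≤ K * ((t - s) * Lam) ^ 2 := by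
  have hK0 : 0 ≤ K := (abs_nonneg _).trans (hK (0, 0))
  have hδ : 0 ≤ (t - s) * Lam := mul_nonneg (by linarith) hLam
  set S : Set (ℝ × ℝ) := Iic s ×ˢ univ with hSdef
  set D := cell Lam s t with hD
  have hS : MeasurableSet S := measurableSet_Iic.prod MeasurableSet.univ
  have hDm : MeasurableSet D := measurableSet_cell _ _ _
  have hSD : Disjoint S D := Set.disjoint_left.2 fun p hp hp' => absurd hp'.1.1 (not_lt.2 hp.1)
  have hμ : noiseIntensity D = ENNReal.ofReal ((t - s) * Lam) := noiseIntensity_cell hs hst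
  have hfin : noiseIntensity D ≠ ∞ := by rw [hμ]; exact ENNReal.ofReal_ne_top
  have hμr : (noiseIntensity D).toReal = (t - s) * Lam := by rw [hμ, ENNReal.toReal_ofReal hδ]
  have hZm : Measurable Z :=
    hZ.mono (((measurable_measure_restrict hS).comp hN.measurable).comap_le) le_rfl
  have hm0 : MeasurableSet {ω | N ω D = 0} := hN.measurable_mass hDm (measurableSet_singleton _)
  have hm1 : MeasurableSet {ω | N ω D = 1} := hN.measurable_mass hDm (measurableSet_singleton _)
  have hdisj : Disjoint {ω | N ω D = 0} {ω | N ω D = 1} := Set.disjoint_left.2 fun ω h0 h1 => by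
    have : (0 : ℝ≥0∞) = 1 := h0.symm.trans h1
    exact zero_ne_one this
  have hint : Integrable (fun ω => v (Z' ω)) P := integrable_comp_of_bounded hZ' hv hK
  set E := Real.exp (-((t - s) * Lam)) with hE
  have hE0 : 0 ≤ E := (Real.exp_pos _).le
  -- no point
  have h0 : ∫ ω in {ω | N ω D = 0}, v (Z' ω) ∂P = E * ∫ ω, v ((Z ω).1, (Z ω).2 + (t - s)) ∂P := by
    have hf : Measurable fun x : ℕ × ℝ => v (x.1, x.2 + (t - s)) := hv.comp (by fun_prop)
    have e1 : ∫ ω in {ω | N ω D = 0}, v (Z' ω) ∂P =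
        ∫ ω in {ω | N ω D = 0}, v ((Z ω).1, (Z ω).2 + (t - s)) ∂P := by
      refine setIntegral_congr_ae hm0 ?_
      filter_upwards [hstep] with ω hω h0
      have h0' : N ω (cell Lam s t) = 0 := h0
      rw [hω (by rw [h0']; exact zero_le_one), cellStep, if_neg (by rw [h0']; exact zero_ne_one)]
    rw [e1, ← integral_map (μ := P.restrict {ω | N ω D = 0}) hZm.aemeasurable
      hf.aestronglyMeasurable, hN.map_restrict_empty hS hDm hSD hfin hZ, integral_smul_measure,
      integral_map hZm.aemeasurable hf.aestronglyMeasurable, hμr, ENNReal.toReal_ofReal hE0,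
      smul_eq_mul]
  -- one point
  have h1 : ∫ ω in {ω | N ω D = 1}, v (Z' ω) ∂P =
      E * ∫ ω, (∫ p in D, v (afterPoint lam u s t (Z ω) p)) ∂P := by
    have hf : Measurable fun q : (ℕ × ℝ) × (ℝ × ℝ) => v (afterPoint lam u s t q.1 q.2) :=
      hv.comp (h.measurable_afterPoint u s t)
    have hpm : Measurable fun ω => atomPosition D (N ω) :=
      (measurable_atomPosition hDm).comp hN.measurable
    have e1 : ∫ ω in {ω | N ω D = 1}, v (Z' ω) ∂P =
        ∫ ω in {ω | N ω D = 1}, v (afterPoint lam u s t (Z ω) (atomPosition D (N ω))) ∂P := by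
      refine setIntegral_congr_ae hm1 ?_
      filter_upwards [hstep] with ω hω h1
      have h1' : N ω (cell Lam s t) = 1 := h1
      rw [hω h1'.le, cellStep, if_pos h1']
    have hlaw := hN.map_restrict_single hS hDm hSD hfin hZ hpm
      fun ω hω => (hN.restrict_cell_eq_dirac hs hω).2
    have : IsProbabilityMeasure (P.map Z) := Measure.isProbabilityMeasure_map hZm.aemeasurable
    have hfm : IsFiniteMeasure (volume.restrict D) :=
      ⟨by simpa using volume_cell_lt_top Lam s t⟩
    rw [hD, noiseIntensity_restrict_cell hs, ← hD, Measure.prod_smul_right] at hlaw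
    have hfi : Integrable (fun q : (ℕ × ℝ) × (ℝ × ℝ) => v (afterPoint lam u s t q.1 q.2))
        ((P.map Z).prod (volume.restrict D)) :=
      Integrable.of_bound hf.aestronglyMeasurable K (Eventually.of_forall fun _ => hK _)
    rw [e1, ← integral_map (μ := P.restrict {ω | N ω D = 1})
      (f := fun q : (ℕ × ℝ) × (ℝ × ℝ) => v (afterPoint lam u s t q.1 q.2))
      (hZm.prodMk hpm).aemeasurable hf.aestronglyMeasurable, hlaw, integral_smul_measure,
      integral_prod _ hfi, integral_map hZm.aemeasurable
        (hf.stronglyMeasurable.integral_prod_right').aestronglyMeasurable, hμr,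
      ENNReal.toReal_ofReal hE0, smul_eq_mul]
  -- several points
  have h2 : |∫ ω in ({ω | N ω D = 0} ∪ {ω | N ω D = 1})ᶜ, v (Z' ω) ∂P| ≤
      K * ((t - s) * Lam) ^ 2 := by
    have hsub : ({ω | N ω D = 0} ∪ {ω | N ω D = 1})ᶜ ⊆ {ω | 1 < N ω D} := fun ω hω =>
      lt_of_not_ge fun hle => hω (hN.mass_eq_zero_or_one hDm hle)
    have hP : P.real ({ω | N ω D = 0} ∪ {ω | N ω D = 1})ᶜ ≤ ((t - s) * Lam) ^ 2 := by
      have := (measure_mono hsub).trans (hN.prob_one_lt_mass_le hDm hfin)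
      rw [hμr] at this
      exact ENNReal.toReal_le_of_le_ofReal (sq_nonneg _) this
    exact (norm_setIntegral_le_of_norm_le_const (f := fun ω => v (Z' ω)) (measure_lt_top P _)
      fun ω _ => hK _).trans (mul_le_mul_of_nonneg_left hP hK0)
  have hI1 : Integrable (fun ω => v ((Z ω).1, (Z ω).2 + (t - s))) P :=
    integrable_comp_of_bounded hZm.aemeasurable (f := fun x => v (x.1, x.2 + (t - s)))
      (hv.comp (by fun_prop)) fun _ => hK _
  have hI2 : Integrable (fun ω => ∫ p in D, v (afterPoint lam u s t (Z ω) p)) P := by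
    have : IsFiniteMeasure (volume.restrict D) := ⟨by simpa using volume_cell_lt_top Lam s t⟩
    refine integrable_comp_of_bounded hZm.aemeasurable
      (f := fun x => ∫ p in D, v (afterPoint lam u s t x p)) (B := K * volume.real D)
      ((hv.comp (h.measurable_afterPoint u s t)).stronglyMeasurable.integral_prod_right').measurable
      fun x => norm_setIntegral_le_of_norm_le_const
        (f := fun p => v (afterPoint lam u s t x p)) (volume_cell_lt_top Lam s t) fun p _ => hK _
  rw [integral_const_mul, integral_add hI1 hI2, mul_add, ← h0, ← h1,
    ← setIntegral_union hdisj hm1 hint.integrableOn hint.integrableOn,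
    ← integral_add_compl (hm0.union hm1) hint, add_sub_cancel_left]
  exact h2

/-- Dynamic programming over a short time, up to an error of second order. -/
theorem abs_integral_value_sub_le (hN : IsPoissonRandomMeasure P N noiseIntensity)
    (h : BoundedRates lam Lam) (hLam : 0 ≤ Lam) (hc : BoundedCost c C)
    {α : ℝ} (hα : 0 < α) (hv : Measurable v) (hK : ∀ x, |v x| ≤ K) (hL0 : 0 ≤ L)
    (hL : ∀ i y y', |v (i, y) - v (i, y')| ≤ L * |y - y'|)
    (heq : ∀ i y, v (i, y) = resolvent (α + Lam)
      (fun y => policyCost c u i y + pointValue lam Lam u v (i, y)) y)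
    {s t : ℝ} (hs : 0 ≤ s) (hst : s ≤ t) {Z Z' : Ω → ℕ × ℝ} (hZ : Measurable[noiseHistory N s] Z)
    (hZ' : AEMeasurable Z' P)
    (hstep : ∀ᵐ ω ∂P, N ω (cell Lam s t) ≤ 1 →
      Z' ω = cellStep lam Lam u s t (N ω) (Z ω)) :
    |(∫ ω, v (Z ω) ∂P) - Real.exp (-α * (t - s)) * (∫ ω, v (Z' ω) ∂P) -
      ∫ ω, (∫ r in (0 : ℝ)..(t - s), policyCost c u (Z ω).1 ((Z ω).2 + r)) ∂P| ≤
    ((α + Lam) * (C + Lam * K) + L * Lam + (α + Lam) * (K * Lam) + K * Lam ^ 2) *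
      (t - s) ^ 2 := by
  have hδ0 : 0 ≤ t - s := by linarith
  have hZm : Measurable Z := hZ.mono (((measurable_measure_restrict
    (measurableSet_Iic.prod MeasurableSet.univ)).comp hN.measurable).comap_le) le_rfl
  have hfm : IsFiniteMeasure (volume.restrict (cell Lam s t)) :=
    ⟨by simpa using volume_cell_lt_top Lam s t⟩
  have hA : Measurable fun x : ℕ × ℝ => ∫ p in cell Lam s t, v (afterPoint lam u s t x p) :=
    ((hv.comp (h.measurable_afterPoint u s t)).stronglyMeasurable.integral_prod_right').measurable
  have hG : Measurable fun x : ℕ × ℝ => Real.exp (-((t - s) * Lam)) * (v (x.1, x.2 + (t - s)) +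
      ∫ p in cell Lam s t, v (afterPoint lam u s t x p)) :=
    ((hv.comp (by fun_prop)).add hA).const_mul _
  have hGB : ∀ x : ℕ × ℝ, |Real.exp (-((t - s) * Lam)) * (v (x.1, x.2 + (t - s)) +
      ∫ p in cell Lam s t, v (afterPoint lam u s t x p))| ≤
      Real.exp (-((t - s) * Lam)) * (K + K * volume.real (cell Lam s t)) := fun x => by
    rw [abs_mul, abs_of_nonneg (Real.exp_pos _).le]
    refine mul_le_mul_of_nonneg_left ((abs_add_le _ _).trans (add_le_add (hK _) ?_))
      (Real.exp_pos _).le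
    exact norm_setIntegral_le_of_norm_le_const (f := fun p => v (afterPoint lam u s t x p))
      (volume_cell_lt_top Lam s t) fun p _ => hK _
  have hGi := integrable_comp_of_bounded (P := P) hZm.aemeasurable hG hGB
  have hvi := integrable_comp_of_bounded (P := P) hZm.aemeasurable hv hK
  have hki := integrable_comp_of_bounded (P := P) hZm.aemeasurable
    (hc.measurable_integral_policyCost u hδ0) (hc.abs_integral_policyCost_le u hδ0)
  have h1 := abs_integral_step_sub_le hN h hLam u hs hst hZ hZ' hstep hv hK
  set I := ∫ ω, Real.exp (-((t - s) * Lam)) * (v ((Z ω).1, (Z ω).2 + (t - s)) +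
      ∫ p in cell Lam s t, v (afterPoint lam u s t (Z ω) p)) ∂P with hI
  have h2 : |(∫ ω, v (Z ω) ∂P) - Real.exp (-α * (t - s)) * I -
      ∫ ω, (∫ r in (0 : ℝ)..(t - s), policyCost c u (Z ω).1 ((Z ω).2 + r)) ∂P| ≤
      ((α + Lam) * (C + Lam * K) + L * Lam + (α + Lam) * (K * Lam)) * (t - s) ^ 2 := by
    have hd : Integrable (fun ω => v (Z ω) - Real.exp (-α * (t - s)) *
        (Real.exp (-((t - s) * Lam)) * (v ((Z ω).1, (Z ω).2 + (t - s)) +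
          ∫ p in cell Lam s t, v (afterPoint lam u s t (Z ω) p)))) P := hvi.sub (hGi.const_mul _)
    rw [hI, ← integral_const_mul, ← integral_sub hvi (hGi.const_mul _), ← integral_sub hd hki]
    rw [← Real.norm_eq_abs]
    refine (norm_integral_le_of_norm_le_const (μ := P) (C := ((α + Lam) * (C + Lam * K) +
      L * Lam + (α + Lam) * (K * Lam)) * (t - s) ^ 2) (Eventually.of_forall fun ω => ?_)).trans
      (by simp)
    exact abs_value_sub_step_le h hLam hc hα hv hK hL0 hL heq hst (Z ω)
  have h3 : Real.exp (-α * (t - s)) ≤ 1 := Real.exp_le_one_iff.2 (by nlinarith)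
  have h4 : |Real.exp (-α * (t - s)) * ((∫ ω, v (Z' ω) ∂P) - I)| ≤ K * ((t - s) * Lam) ^ 2 := by
    rw [abs_mul, abs_of_nonneg (Real.exp_pos _).le]
    exact (mul_le_of_le_one_left (abs_nonneg _) h3).trans h1
  rw [abs_le] at h2 h4 ⊢
  constructor <;> nlinarith [h2.1, h2.2, h4.1, h4.2]

end OneStep

/-! ### The cost along a path -/

section PathCost

/-- A right-continuous path is the limit of its values at the next point of the grid of mesh
`1 / (n + 1)`. -/
theorem IsCadlag.measurable {F : Type*} [TopologicalSpace F]
    [TopologicalSpace.PseudoMetrizableSpace F] [MeasurableSpace F] [BorelSpace F] {x : ℝ → F}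
    (hx : IsCadlag x) :
    Measurable fun t => x (max t 0) := by
  refine measurable_of_tendsto_metrizable
    (f := fun (n : ℕ) t => x ((⌊((n : ℝ) + 1) * max t 0⌋₊ + 1 : ℝ) / (n + 1))) (fun n => ?_)
    (tendsto_pi_nhds.2 fun t => ?_)
  · exact (measurable_from_nat (f := fun k : ℕ => x ((k + 1 : ℝ) / (n + 1)))).comp
      (Nat.measurable_floor.comp (by fun_prop))
  · have hy : (0 : ℝ) ≤ max t 0 := le_max_right _ _
    set y := max t 0
    have hle : ∀ n : ℕ, y ≤ (⌊((n : ℝ) + 1) * y⌋₊ + 1 : ℝ) / (n + 1) := fun n => by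
      rw [le_div_iff₀ (by positivity), mul_comm]
      exact (Nat.lt_floor_add_one _).le
    have hge : ∀ n : ℕ, (⌊((n : ℝ) + 1) * y⌋₊ + 1 : ℝ) / (n + 1) ≤ y + 1 / ((n : ℝ) + 1) :=
        fun n => by
      have hn : (0 : ℝ) < n + 1 := by positivity
      have he : (y + 1 / ((n : ℝ) + 1)) * (n + 1) = (n + 1) * y + 1 := by field_simp
      rw [div_le_iff₀ hn, he]
      linarith [Nat.floor_le (mul_nonneg hn.le hy)]
    refine (hx.1 y hy).tendsto.comp (tendsto_nhdsWithin_iff.2 ⟨?_, Eventually.of_forall hle⟩)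
    refine tendsto_of_tendsto_of_tendsto_of_le_of_le tendsto_const_nhds ?_ hle hge
    simpa using (tendsto_const_nhds (x := y)).add tendsto_one_div_add_atTop_nhds_zero_nat

variable {U : Type*} [MetricSpace U] [CompactSpace U] [MeasurableSpace U] [BorelSpace U]
  {lam : ℕ → ℕ → ℝ → U → ℝ} {Lam : ℝ} {c : ℕ → ℝ → U → ℝ} {C : ℝ} {u : Control U}
  {i : ℕ} {x : ℝ → ℕ} {a : ℝ → ℝ} {ν : Measure (ℝ × ℝ)} {α : ℝ}

/-- The discounted running cost along a path; negative times are read as `0`. -/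
noncomputable def pathCost (c : ℕ → ℝ → U → ℝ) (α : ℝ) (u : Control U) (x : ℝ → ℕ) (a : ℝ → ℝ)
    (r : ℝ) : ℝ :=
  Real.exp (-α * r) * policyCost c u (x (max r 0)) (a (max r 0))

theorem measurable_pathCost (hc : BoundedCost c C) (hx : IsCadlag x) (ha : IsCadlag a) :
    Measurable (pathCost c α u x a) :=
  (by fun_prop : Measurable fun r : ℝ => Real.exp (-α * r)).mul
    ((hc.measurable_policyCost_pair u).comp (hx.measurable.prodMk ha.measurable))

theorem abs_pathCost_le (hc : BoundedCost c C) (r : ℝ) :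
    |pathCost c α u x a r| ≤ Real.exp (-α * r) * C := by
  rw [pathCost, abs_mul, abs_of_nonneg (Real.exp_pos _).le]
  exact mul_le_mul_of_nonneg_left (hc.abs_policyCost_le u _ _) (Real.exp_pos _).le

theorem integrableOn_pathCost (hc : BoundedCost c C) (hα : 0 < α) (hx : IsCadlag x)
    (ha : IsCadlag a) (s : ℝ) : IntegrableOn (pathCost c α u x a) (Ioi s) :=
  Integrable.mono' ((exp_neg_integrableOn_Ioi s hα).mul_const C)
    (measurable_pathCost hc hx ha).aestronglyMeasurable
    (Eventually.of_forall fun r => abs_pathCost_le hc r)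

theorem intervalIntegrable_pathCost (hc : BoundedCost c C) (hα : 0 < α) (hx : IsCadlag x)
    (ha : IsCadlag a) {s t : ℝ} (hst : s ≤ t) :
    IntervalIntegrable (pathCost c α u x a) volume s t :=
  (intervalIntegrable_iff_integrableOn_Ioc_of_le hst).2
    ((integrableOn_pathCost hc hα hx ha s).mono_set Ioc_subset_Ioi_self)

/-- The cost over a time interval, compared with the cost that would arise without jumps: the
difference is of second order unless there is a point of the noise. -/
theorem IsPath.abs_integral_pathCost_sub_le (h : BoundedRates lam Lam) (hc : BoundedCost c C)
    (hC : 0 ≤ C) (hα : 0 < α) (hp : IsPath lam u ν i x a) (hn : ∀ t, 0 ≤ t → 0 ≤ a t) {s t : ℝ}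
    (hs : 0 ≤ s) (hst : s ≤ t) (hint : ∃ n : ℕ∞, ν (cell Lam s t) = n)
    (hfin : ν (cell Lam s t) < ∞) :
    |(∫ r in s..t, pathCost c α u x a r) -
      Real.exp (-α * s) * ∫ r in (0 : ℝ)..(t - s), policyCost c u (x s) (a s + r)| ≤
      α * C * (t - s) ^ 2 + 2 * C * (t - s) * ν.real (cell Lam s t) := by
  have hδ : 0 ≤ t - s := by linarith
  obtain ⟨n, hnν⟩ := hint
  have hexp1 : ∀ r, 0 ≤ r → Real.exp (-α * r) ≤ 1 := fun r hr =>
    Real.exp_le_one_iff.2 (by nlinarith)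
  rcases eq_or_ne n 0 with rfl | hn0
  · have h0 : ν (cell Lam s t) = 0 := by simpa using hnν
    have hm : Measurable fun r => policyCost c u (x s) (a s + (r - s)) :=
      (hc.measurable_policyCost u (x s)).comp (by fun_prop)
    have hi : IntervalIntegrable (fun r => Real.exp (-α * s) *
        policyCost c u (x s) (a s + (r - s))) volume s t :=
      (intervalIntegrable_of_bounded hm (fun r => hc.abs_policyCost_le u _ _) s t).const_mul _
    have hshift := intervalIntegral.integral_comp_sub_right (a := s) (b := t)
      (fun r => policyCost c u (x s) (a s + r)) s
    rw [sub_self] at hshift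
    rw [← hshift, ← intervalIntegral.integral_const_mul, ← intervalIntegral.integral_sub
      (intervalIntegrable_pathCost hc hα hp.state_cadlag hp.age_cadlag hst) hi,
      ← Real.norm_eq_abs]
    have hb := intervalIntegral.norm_integral_le_of_norm_le_const (a := s) (b := t)
      (C := α * (t - s) * C) (f := fun r => pathCost c α u x a r - Real.exp (-α * s) *
        policyCost c u (x s) (a s + (r - s))) fun r hr => by
      rw [uIoc_of_le hst] at hr
      have hr0 : 0 ≤ r := hs.trans hr.1.le
      obtain ⟨e1, e2⟩ := hp.eq_of_empty h hn hs hr.1.le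
        (measure_mono_null (cell_mono le_rfl hr.2) h0)
      rw [pathCost, max_eq_left hr0, e1, e2, ← sub_mul, norm_mul]
      refine mul_le_mul ?_ (hc.abs_policyCost_le u _ _) (norm_nonneg _) (by positivity)
      have e3 : Real.exp (-α * r) = Real.exp (-α * s) * Real.exp (-α * (r - s)) := by
        rw [← Real.exp_add]; ring_nf
      have e4 := Real.add_one_le_exp (-α * (r - s))
      have e5 := hexp1 (r - s) (by linarith [hr.1])
      have e6 := hexp1 s hs
      rw [e3, ← mul_sub_one, Real.norm_eq_abs, abs_mul, abs_of_nonneg (Real.exp_pos _).le,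
        abs_sub_comm, abs_of_nonneg (by linarith : 0 ≤ 1 - Real.exp (-α * (r - s)))]
      refine (mul_le_of_le_one_left (by linarith) e6).trans ?_
      nlinarith [hr.2]
    rw [abs_of_nonneg hδ] at hb
    have : ν.real (cell Lam s t) = 0 := by simp [measureReal_def, h0]
    rw [this]
    linarith
  · have h1 : 1 ≤ ν.real (cell Lam s t) := by
      have h2 : (1 : ℝ≥0∞) ≤ ν (cell Lam s t) := by
        rw [hnν]; exact_mod_cast Order.one_le_iff_ne_zero.2 hn0
      exact (ENNReal.ofReal_le_iff_le_toReal hfin.ne).1 (by simpa using h2)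
    have hb1 := intervalIntegral.norm_integral_le_of_norm_le_const (a := s) (b := t)
      (C := C) (f := pathCost c α u x a) fun r hr => by
      rw [uIoc_of_le hst] at hr
      exact (abs_pathCost_le hc r).trans
        (mul_le_of_le_one_left hC (hexp1 r (hs.trans hr.1.le)))
    have hb2 := hc.abs_integral_policyCost_le u hδ (x s, a s)
    rw [abs_of_nonneg hδ] at hb1
    have hb3 : |Real.exp (-α * s) * ∫ r in (0 : ℝ)..(t - s), policyCost c u (x s) (a s + r)| ≤
        C * (t - s) := by
      rw [abs_mul, abs_of_nonneg (Real.exp_pos _).le]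
      exact (mul_le_of_le_one_left (abs_nonneg _) (hexp1 s hs)).trans hb2
    have hb4 : 2 * C * (t - s) * 1 ≤ 2 * C * (t - s) * ν.real (cell Lam s t) :=
      mul_le_mul_of_nonneg_left h1 (by positivity)
    have hb5 : 0 ≤ α * C * (t - s) ^ 2 := by positivity
    refine (abs_sub _ _).trans ?_
    rw [Real.norm_eq_abs] at hb1
    linarith

/-- The Riemann sum for the discounted cost, up to the `k`-th of the `m` cells of `(0, T]`, in
which the path is followed without jumps within each cell. -/
noncomputable def cellCostSum (c : ℕ → ℝ → U → ℝ) (α : ℝ) (u : Control U) (T : ℝ) (m : ℕ)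
    (x : ℝ → ℕ) (a : ℝ → ℝ) (k : ℕ) : ℝ :=
  ∑ l ∈ Finset.range k, Real.exp (-α * gridPoint 0 T m l) *
    ∫ r in (0 : ℝ)..(T / m), policyCost c u (x (gridPoint 0 T m l)) (a (gridPoint 0 T m l) + r)

theorem IsPath.abs_integral_sub_cellCostSum_le (h : BoundedRates lam Lam) (hc : BoundedCost c C)
    (hC : 0 ≤ C) (hα : 0 < α) (hp : IsPath lam u ν i x a) (hn : ∀ t, 0 ≤ t → 0 ≤ a t)
    (hint : ∀ s t, ∃ n : ℕ∞, ν (cell Lam s t) = n) {T : ℝ} (hT : 0 ≤ T)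
    (hfin : ν (cell Lam 0 T) < ∞) {m : ℕ} (hm : m ≠ 0) {k : ℕ} (hk : k ≤ m) :
    |(∫ r in (0 : ℝ)..gridPoint 0 T m k, pathCost c α u x a r) - cellCostSum c α u T m x a k| ≤
      k * (α * C * (T / m) ^ 2) +
        2 * C * (T / m) * ν.real (cell Lam 0 (gridPoint 0 T m k)) := by
  have hmono := gridPoint_mono hT m
  have h0 : ∀ k, 0 ≤ gridPoint 0 T m k := fun k => by
    simpa [gridPoint_zero] using hmono (Nat.zero_le k)
  induction k with
  | zero => simp [cellCostSum, gridPoint_zero, cell]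
  | succ k ih =>
    have hkm : gridPoint 0 T m (k + 1) ≤ T := (hmono hk).trans (gridPoint_last _ _ hm).le
    have hst := hmono (Nat.le_succ k)
    have hf1 : ν (cell Lam (gridPoint 0 T m k) (gridPoint 0 T m (k + 1))) < ∞ :=
      (measure_mono (cell_mono (h0 k) hkm)).trans_lt hfin
    have hf0 : ν (cell Lam 0 (gridPoint 0 T m k)) < ∞ :=
      (measure_mono (cell_mono le_rfl (hst.trans hkm))).trans_lt hfin
    have hd : gridPoint 0 T m (k + 1) - gridPoint 0 T m k = T / m := by
      rw [gridPoint_succ]; ring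
    have hcell : ν.real (cell Lam 0 (gridPoint 0 T m (k + 1))) =
        ν.real (cell Lam 0 (gridPoint 0 T m k)) +
        ν.real (cell Lam (gridPoint 0 T m k) (gridPoint 0 T m (k + 1))) := by
      rw [← measureReal_union _ (measurableSet_cell _ _ _) hf0.ne hf1.ne]
      · rw [cell, cell, cell, ← union_prod, Ioc_union_Ioc_eq_Ioc (h0 k) hst]
      · exact Disjoint.set_prod_left (Ioc_disjoint_Ioc_of_le le_rfl) _ _
    have h1 := ih (Nat.le_of_succ_le hk)
    have h2 := hp.abs_integral_pathCost_sub_le h hc hC hα hn (h0 k) hst (hint _ _) hf1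
    rw [hd] at h2
    rw [← intervalIntegral.integral_add_adjacent_intervals
      (intervalIntegrable_pathCost hc hα hp.state_cadlag hp.age_cadlag (h0 k))
      (intervalIntegrable_pathCost hc hα hp.state_cadlag hp.age_cadlag hst), cellCostSum,
      Finset.sum_range_succ, ← cellCostSum, hcell]
    push_cast
    rw [abs_le] at h1 h2 ⊢
    constructor <;> linarith [h1.1, h1.2, h2.1, h2.2]

theorem IsPath.tendsto_cellCostSum (h : BoundedRates lam Lam) (hc : BoundedCost c C)
    (hC : 0 ≤ C) (hα : 0 < α) (hp : IsPath lam u ν i x a) (hn : ∀ t, 0 ≤ t → 0 ≤ a t)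
    (hint : ∀ s t, ∃ n : ℕ∞, ν (cell Lam s t) = n) {T : ℝ} (hT : 0 ≤ T)
    (hfin : ν (cell Lam 0 T) < ∞) :
    Tendsto (fun m : ℕ => cellCostSum c α u T (m + 1) x a (m + 1)) atTop
      (𝓝 (∫ r in (0 : ℝ)..T, pathCost c α u x a r)) := by
  rw [tendsto_iff_dist_tendsto_zero]
  have hlim : Tendsto (fun m : ℕ => (α * C * T ^ 2 + 2 * C * T * ν.real (cell Lam 0 T)) *
      (1 / ((m : ℝ) + 1))) atTop (𝓝 0) := by
    have := (tendsto_one_div_add_atTop_nhds_zero_nat (𝕜 := ℝ)).const_mul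
      (α * C * T ^ 2 + 2 * C * T * ν.real (cell Lam 0 T))
    rwa [mul_zero] at this
  refine squeeze_zero (fun m => dist_nonneg) (fun m => ?_) hlim
  have := hp.abs_integral_sub_cellCostSum_le h hc hC hα hn hint hT hfin m.succ_ne_zero le_rfl
  rw [gridPoint_last _ _ m.succ_ne_zero] at this
  rw [dist_comm, Real.dist_eq]
  refine this.trans (le_of_eq ?_)
  push_cast
  field_simp

theorem abs_cellCostSum_le (hc : BoundedCost c C) (hα : 0 < α) {T : ℝ} (hT : 0 ≤ T) {m : ℕ}
    (hm : m ≠ 0) : |cellCostSum c α u T m x a m| ≤ C * T := by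
  have hm0 : (m : ℝ) ≠ 0 := by exact_mod_cast hm
  refine (Finset.abs_sum_le_sum_abs _ _).trans ?_
  have : ∀ l ∈ Finset.range m, |Real.exp (-α * gridPoint 0 T m l) * ∫ r in (0 : ℝ)..(T / m),
      policyCost c u (x (gridPoint 0 T m l)) (a (gridPoint 0 T m l) + r)| ≤ C * (T / m) := by
    intro l _
    have h0 : 0 ≤ gridPoint 0 T m l := by
      simpa [gridPoint_zero] using gridPoint_mono hT m (Nat.zero_le l)
    rw [abs_mul, abs_of_nonneg (Real.exp_pos _).le]
    exact (mul_le_of_le_one_left (abs_nonneg _) (Real.exp_le_one_iff.2 (by nlinarith))).trans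
      (hc.abs_integral_policyCost_le u (by positivity) (_, _))
  refine (Finset.sum_le_sum this).trans (le_of_eq ?_)
  rw [Finset.sum_const, Finset.card_range, nsmul_eq_mul]
  field_simp

end PathCost

/-! ### The cost of a control -/

section Cost

variable {U : Type*} [MetricSpace U] [CompactSpace U] [MeasurableSpace U] [BorelSpace U]
  {lam : ℕ → ℕ → ℝ → U → ℝ} {Lam : ℝ} {c : ℕ → ℝ → U → ℝ} {C : ℝ} {u : Control U}
  {i : ℕ} {α : ℝ} {v : ℕ × ℝ → ℝ} {K L : ℝ}
  {Ω : Type*} [MeasurableSpace Ω] {P : Measure Ω} [IsProbabilityMeasure P]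
  {N : Ω → Measure (ℝ × ℝ)} {X : ℝ → Ω → ℕ} {Y : ℝ → Ω → ℝ}

theorem IsPoissonRandomMeasure.ae_mass_lt_top {E : Type*} [MeasurableSpace E] {N : Ω → Measure E}
    {μ : Measure E} (hN : IsPoissonRandomMeasure P N μ) {B : Set E} (hB : MeasurableSet B)
    (hfin : μ B ≠ ∞) : ∀ᵐ ω ∂P, N ω B < ∞ := by
  have h := congrArg (fun ν : Measure ℝ≥0∞ => ν {∞}) (hN.law B hB hfin)
  rw [Measure.map_apply (hN.measurable_mass hB) (measurableSet_singleton _),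
    Measure.map_apply measurable_from_nat (measurableSet_singleton _)] at h
  have h0 : (fun n : ℕ => (n : ℝ≥0∞)) ⁻¹' {∞} = ∅ := by
    ext n; simp
  rw [h0, measure_empty] at h
  filter_upwards [measure_eq_zero_iff_ae_notMem.1 h] with ω hω
  exact lt_top_iff_ne_top.2 hω

theorem ae_age_nonneg (hN : IsPoissonRandomMeasure P N noiseIntensity)
    (h : BoundedRates lam Lam)
    (hp : ∀ᵐ ω ∂P, IsPath lam u (N ω) i (fun t => X t ω) (fun t => Y t ω)) :
    ∀ᵐ ω ∂P, ∀ t, 0 ≤ t → 0 ≤ Y t ω := by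
  filter_upwards [hN.ae_isLocallySparse Lam, hp] with ω hls hω t ht
  exact hω.age_nonneg h (fun t ht => hls.mass_at_time_le_one ht) ht

theorem aemeasurable_state (hN : IsPoissonRandomMeasure P N noiseIntensity)
    (h : BoundedRates lam Lam)
    (hp : ∀ᵐ ω ∂P, IsPath lam u (N ω) i (fun t => X t ω) (fun t => Y t ω)) {t : ℝ} (ht : 0 ≤ t) :
    AEMeasurable (fun ω => (X t ω, Y t ω)) P := by
  obtain ⟨Z, hZ, hZe⟩ := exists_measurable_eq_path hN h u i ht
  refine ⟨Z, hZ.mono (((measurable_measure_restrict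
    (measurableSet_Iic.prod MeasurableSet.univ)).comp hN.measurable).comap_le) le_rfl, ?_⟩
  filter_upwards [hZe, hp] with ω h1 h2
  exact h1 _ _ h2

theorem abs_integral_path_sub_le (hN : IsPoissonRandomMeasure P N noiseIntensity)
    (h : BoundedRates lam Lam) (hLam : 0 ≤ Lam) (hc : BoundedCost c C)
    (hα : 0 < α) (hv : Measurable v) (hK : ∀ x, |v x| ≤ K) (hL0 : 0 ≤ L)
    (hL : ∀ i y y', |v (i, y) - v (i, y')| ≤ L * |y - y'|)
    (heq : ∀ i y, v (i, y) = resolvent (α + Lam)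
      (fun y => policyCost c u i y + pointValue lam Lam u v (i, y)) y)
    (hp : ∀ᵐ ω ∂P, IsPath lam u (N ω) i (fun t => X t ω) (fun t => Y t ω))
    {s t : ℝ} (hs : 0 ≤ s) (hst : s ≤ t) :
    |(∫ ω, v (X s ω, Y s ω) ∂P) - Real.exp (-α * (t - s)) * (∫ ω, v (X t ω, Y t ω) ∂P) -
      ∫ ω, (∫ r in (0 : ℝ)..(t - s), policyCost c u (X s ω) (Y s ω + r)) ∂P| ≤
    ((α + Lam) * (C + Lam * K) + L * Lam + (α + Lam) * (K * Lam) + K * Lam ^ 2) *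
      (t - s) ^ 2 := by
  obtain ⟨Z, hZ, hZe⟩ := exists_measurable_eq_path hN h u i hs
  have hZe' : ∀ᵐ ω ∂P, (X s ω, Y s ω) = Z ω := by
    filter_upwards [hZe, hp] with ω h1 h2
    exact h1 _ _ h2
  have key := abs_integral_value_sub_le hN h hLam hc hα hv hK hL0 hL heq hs hst hZ
    (aemeasurable_state hN h hp (hs.trans hst)) (by
      filter_upwards [hZe', hp, ae_age_nonneg hN h hp] with ω h1 h2 h3 h4
      rw [← h1]
      exact h2.eq_cellStep h h3 hs hst (hN.isSparse h4))
  have e1 : ∫ ω, v (X s ω, Y s ω) ∂P = ∫ ω, v (Z ω) ∂P :=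
    integral_congr_ae (hZe'.mono fun ω hω => by simp only [hω])
  have e2 : ∫ ω, (∫ r in (0 : ℝ)..(t - s), policyCost c u (X s ω) (Y s ω + r)) ∂P =
      ∫ ω, (∫ r in (0 : ℝ)..(t - s), policyCost c u (Z ω).1 ((Z ω).2 + r)) ∂P :=
    integral_congr_ae (hZe'.mono fun ω hω => by simp only [← hω])
  rw [e1, e2]
  exact key

/-- The expectation of the discounted cost up to time `T` and of the discounted value at time `T`
add up to the value at time `0`: the errors of second order of the cells of a partition vanish
together as the partition is refined. -/
theorem integral_pathCost_eq (hN : IsPoissonRandomMeasure P N noiseIntensity)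
    (h : BoundedRates lam Lam) (hLam : 0 ≤ Lam) (hc : BoundedCost c C) (hC : 0 ≤ C)
    (hα : 0 < α) (hv : Measurable v) (hK : ∀ x, |v x| ≤ K) (hL0 : 0 ≤ L)
    (hL : ∀ i y y', |v (i, y) - v (i, y')| ≤ L * |y - y'|)
    (heq : ∀ i y, v (i, y) = resolvent (α + Lam)
      (fun y => policyCost c u i y + pointValue lam Lam u v (i, y)) y)
    (hp : ∀ᵐ ω ∂P, IsPath lam u (N ω) i (fun t => X t ω) (fun t => Y t ω))
    {T : ℝ} (hT : 0 ≤ T) :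
    AEStronglyMeasurable (fun ω => ∫ r in (0 : ℝ)..T,
        pathCost c α u (fun t => X t ω) (fun t => Y t ω) r) P ∧
      ∫ ω, (∫ r in (0 : ℝ)..T, pathCost c α u (fun t => X t ω) (fun t => Y t ω) r) ∂P =
        v (i, 0) - Real.exp (-α * T) * ∫ ω, v (X T ω, Y T ω) ∂P := by
  set M := (α + Lam) * (C + Lam * K) + L * Lam + (α + Lam) * (K * Lam) + K * Lam ^ 2 with hM
  have h0 : ∀ m k, 0 ≤ gridPoint 0 T m k := fun m k => by
    simpa [gridPoint_zero] using gridPoint_mono hT m (Nat.zero_le k)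
  have hcellint : ∀ m l, Integrable (fun ω => Real.exp (-α * gridPoint 0 T m l) *
      ∫ r in (0 : ℝ)..(T / m), policyCost c u (X (gridPoint 0 T m l) ω)
        (Y (gridPoint 0 T m l) ω + r)) P := fun m l =>
    (integrable_comp_of_bounded (aemeasurable_state hN h hp (h0 m l))
      (hc.measurable_integral_policyCost u (by positivity : 0 ≤ T / m))
      (hc.abs_integral_policyCost_le u (by positivity))).const_mul _
  have hsumint : ∀ m k, Integrable (fun ω =>
      cellCostSum c α u T m (fun t => X t ω) (fun t => Y t ω) k) P := fun m k =>
    integrable_finsetSum _ fun l _ => hcellint m l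
  have hstart : ∫ ω, v (X 0 ω, Y 0 ω) ∂P = v (i, 0) := by
    have : ∀ᵐ ω ∂P, v (X 0 ω, Y 0 ω) = v (i, 0) := by
      filter_upwards [hp] with ω hω
      rw [hω.state_zero, hω.age_zero]
    rw [integral_congr_ae this]
    simp
  have htel : ∀ m : ℕ, m ≠ 0 → ∀ k, |v (i, 0) - Real.exp (-α * gridPoint 0 T m k) *
      (∫ ω, v (X (gridPoint 0 T m k) ω, Y (gridPoint 0 T m k) ω) ∂P) -
      ∫ ω, cellCostSum c α u T m (fun t => X t ω) (fun t => Y t ω) k ∂P| ≤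
      k * (M * (T / m) ^ 2) := by
    intro m hm k
    induction k with
    | zero => simp [gridPoint_zero, hstart, cellCostSum]
    | succ k ih =>
      have hst := gridPoint_mono hT m (Nat.le_succ k)
      have hstep := abs_integral_path_sub_le hN h hLam hc hα hv hK hL0 hL heq hp (h0 m k) hst
      have hd : gridPoint 0 T m (k + 1) - gridPoint 0 T m k = T / m := by
        rw [gridPoint_succ]; ring
      rw [Nat.succ_eq_add_one, hd] at hstep
      have hexp : Real.exp (-α * gridPoint 0 T m (k + 1)) =
          Real.exp (-α * gridPoint 0 T m k) * Real.exp (-α * (T / m)) := by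
        rw [← hd, ← Real.exp_add]; ring_nf
      have he1 : Real.exp (-α * gridPoint 0 T m k) ≤ 1 :=
        Real.exp_le_one_iff.2 (by nlinarith [h0 m k])
      have hstep' := (mul_le_of_le_one_left (abs_nonneg _) he1).trans hstep
      rw [← abs_of_nonneg (Real.exp_pos (-α * gridPoint 0 T m k)).le, ← abs_mul] at hstep'
      simp only [cellCostSum, Finset.sum_range_succ] at ih ⊢
      rw [integral_add (integrable_finsetSum _ fun l _ => hcellint m l) (hcellint m k),
        integral_const_mul, hexp]
      push_cast
      rw [← hM] at hstep'
      rw [abs_le] at ih hstep' ⊢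
      constructor <;> nlinarith [ih.1, ih.2, hstep'.1, hstep'.2]
  have hlim : ∀ᵐ ω ∂P, Tendsto
      (fun m : ℕ => cellCostSum c α u T (m + 1) (fun t => X t ω) (fun t => Y t ω) (m + 1)) atTop
      (𝓝 (∫ r in (0 : ℝ)..T, pathCost c α u (fun t => X t ω) (fun t => Y t ω) r)) := by
    have hfin : noiseIntensity (cell Lam 0 T) ≠ ∞ := by
      rw [noiseIntensity_cell le_rfl hT]; exact ENNReal.ofReal_ne_top
    filter_upwards [hp, ae_age_nonneg hN h hp,
      hN.ae_mass_lt_top (measurableSet_cell _ _ _) hfin] with ω h1 h2 h3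
    exact h1.tendsto_cellCostSum h hc hC hα h2
      (fun s t => hN.integer_valued ω _ (measurableSet_cell _ _ _)) hT h3
  have hmeas := aestronglyMeasurable_of_tendsto_ae atTop
    (fun m : ℕ => (hsumint (m + 1) (m + 1)).aestronglyMeasurable) hlim
  refine ⟨hmeas, ?_⟩
  have hdct := tendsto_integral_of_dominated_convergence (fun _ => C * T)
    (fun m : ℕ => (hsumint (m + 1) (m + 1)).aestronglyMeasurable) (integrable_const _)
    (fun m => Eventually.of_forall fun ω => abs_cellCostSum_le hc hα hT m.succ_ne_zero) hlim
  refine tendsto_nhds_unique hdct ?_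
  rw [tendsto_iff_dist_tendsto_zero]
  have hz : Tendsto (fun m : ℕ => M * T ^ 2 * (1 / ((m : ℝ) + 1))) atTop (𝓝 0) := by
    have := (tendsto_one_div_add_atTop_nhds_zero_nat (𝕜 := ℝ)).const_mul (M * T ^ 2)
    rwa [mul_zero] at this
  refine squeeze_zero (fun m => dist_nonneg) (fun m => ?_) hz
  have := htel (m + 1) m.succ_ne_zero (m + 1)
  rw [gridPoint_last _ _ m.succ_ne_zero] at this
  rw [dist_comm, Real.dist_eq]
  refine this.trans (le_of_eq ?_)
  push_cast
  field_simp

/-- The cost of a solution is the value at its starting point. -/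
theorem processCost_eq (hN : IsPoissonRandomMeasure P N noiseIntensity)
    (h : BoundedRates lam Lam) (hLam : 0 ≤ Lam) (hc : BoundedCost c C) (hC : 0 ≤ C)
    (hα : 0 < α) (hv : Measurable v) (hK : ∀ x, |v x| ≤ K) (hL0 : 0 ≤ L)
    (hL : ∀ i y y', |v (i, y) - v (i, y')| ≤ L * |y - y'|)
    (heq : ∀ i y, v (i, y) = resolvent (α + Lam)
      (fun y => policyCost c u i y + pointValue lam Lam u v (i, y)) y)
    (hs : IsSolution P N lam u i 0 X Y) : processCost P c α u X Y = v (i, 0) := by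
  have hp := hs.ae_isPath
  have hT := fun n : ℕ => integral_pathCost_eq hN h hLam hc hC hα hv hK hL0 hL heq hp
    (Nat.cast_nonneg (α := ℝ) n)
  have hcost : processCost P c α u X Y =
      ∫ ω, (∫ r in Ioi (0 : ℝ), pathCost c α u (fun t => X t ω) (fun t => Y t ω) r) ∂P := by
    refine integral_congr_ae ?_
    filter_upwards [ae_age_nonneg hN h hp] with ω hω
    refine setIntegral_congr_fun measurableSet_Ioi fun r hr => ?_
    have hr' : (0 : ℝ) ≤ r := le_of_lt hr
    simp only [pathCost, policyCost, max_eq_left hr', max_eq_left (hω r hr')]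
  have hlim : ∀ᵐ ω ∂P, Tendsto (fun n : ℕ => ∫ r in (0 : ℝ)..n,
      pathCost c α u (fun t => X t ω) (fun t => Y t ω) r) atTop
      (𝓝 (∫ r in Ioi (0 : ℝ), pathCost c α u (fun t => X t ω) (fun t => Y t ω) r)) := by
    filter_upwards [hp] with ω hω
    exact intervalIntegral_tendsto_integral_Ioi 0
      (integrableOn_pathCost hc hα hω.state_cadlag hω.age_cadlag 0) tendsto_natCast_atTop_atTop
  have hdct := tendsto_integral_of_dominated_convergence (fun _ => α⁻¹ * C)
    (fun n => (hT n).1) (integrable_const _) (fun n => by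
      filter_upwards [hp] with ω hω
      rw [intervalIntegral.integral_of_le (Nat.cast_nonneg n)]
      refine (norm_integral_le_of_norm_le ((exp_neg_integrableOn_Ioi 0 hα).mono_set
        Ioc_subset_Ioi_self |>.mul_const C) (Eventually.of_forall fun r =>
          abs_pathCost_le hc r)).trans ?_
      rw [integral_mul_const]
      refine mul_le_mul_of_nonneg_right ?_ hC
      rw [← integral_exp_neg_Ioi_zero_mul hα]
      exact setIntegral_mono_set (exp_neg_integrableOn_Ioi 0 hα)
        (Eventually.of_forall fun r => (Real.exp_pos _).le)
        (Ioc_subset_Ioi_self.eventuallyLE)) hlim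
  rw [hcost]
  refine tendsto_nhds_unique hdct ?_
  simp_rw [fun n => (hT n).2]
  have hexp : Tendsto (fun n : ℕ => Real.exp (-α * n)) atTop (𝓝 0) :=
    Real.tendsto_exp_atBot.comp
      (tendsto_natCast_atTop_atTop.const_mul_atTop_of_neg (by linarith : -α < 0))
  have hz : Tendsto (fun n : ℕ => Real.exp (-α * n) * ∫ ω, v (X n ω, Y n ω) ∂P) atTop (𝓝 0) := by
    refine squeeze_zero_norm (a := fun n : ℕ => Real.exp (-α * n) * K) (fun n => ?_)
      (by simpa using hexp.mul_const K)
    rw [norm_mul, Real.norm_of_nonneg (Real.exp_pos _).le]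
    refine mul_le_mul_of_nonneg_left ?_ (Real.exp_pos _).le
    simpa using norm_integral_le_of_norm_le_const (μ := P)
      (f := fun ω => v (X n ω, Y n ω)) (C := K) (Eventually.of_forall fun ω => hK _)
  simpa using (tendsto_const_nhds (x := v (i, 0))).sub hz

end Cost

/-! ### Fixed points for fixed controls and for optimal ones -/

section Values

/-- A monotone and nonexpansive way to read the values `A v j` of entering the states `j` off a
function `v` of state and age: they are the values `v (j, 0)` at age `0`, or are held fixed. -/
structure IsEntryValue (A : (ℕ × ℝ →ᵇ ℝ) → ℕ → ℝ) : Prop where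
  bounded : ∀ v, ∃ K, ∀ j, |A v j| ≤ K
  sub_le : ∀ v w D, 0 ≤ D → (∀ i y, 0 ≤ y → v (i, y) - w (i, y) ≤ D) → ∀ j, A v j - A w j ≤ D

theorem isEntryValue_zero_age : IsEntryValue fun v j => v (j, 0) :=
  ⟨fun v => ⟨‖v‖, fun j => v.norm_coe_le_norm (j, 0)⟩, fun _ _ _ _ h j => h j 0 le_rfl⟩

theorem isEntryValue_const {φ : ℕ → ℝ} {K : ℝ} (hφ : ∀ j, |φ j| ≤ K) : IsEntryValue fun _ => φ :=
  ⟨fun _ => ⟨K, hφ⟩, fun _ _ D hD _ j => by rwa [sub_self]⟩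

theorem IsEntryValue.exists_bound {A : (ℕ × ℝ →ᵇ ℝ) → ℕ → ℝ} (hA : IsEntryValue A)
    (v : ℕ × ℝ →ᵇ ℝ) : ∃ K, (∀ j, |A v j| ≤ K) ∧ ∀ x, |v x| ≤ K := by
  obtain ⟨K, hK⟩ := hA.bounded v
  exact ⟨max K ‖v‖, fun j => (hK j).trans (le_max_left _ _),
    fun x => (v.norm_coe_le_norm x).trans (le_max_right _ _)⟩

theorem sub_le_dist (v w : ℕ × ℝ →ᵇ ℝ) (x : ℕ × ℝ) : v x - w x ≤ dist v w :=
  (le_abs_self _).trans ((Real.dist_eq _ _).ge.trans (BoundedContinuousFunction.dist_coe_le_dist x))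

variable {U : Type*} [MetricSpace U] [CompactSpace U] [MeasurableSpace U] [BorelSpace U]

/-- `v` satisfies the resolvent equation for the control `u`, where entering the state `j` is
worth `A v j`. -/
def IsPolicyValue (lam : ℕ → ℕ → ℝ → U → ℝ) (c : ℕ → ℝ → U → ℝ) (Lam α : ℝ) (u : Control U)
    (A : (ℕ × ℝ →ᵇ ℝ) → ℕ → ℝ) (v : ℕ × ℝ →ᵇ ℝ) : Prop :=
  ∀ i y, 0 ≤ y → v (i, y) = resolvent (α + Lam)
    (fun y => averageHamiltonian lam c Lam (u.1 i) (A v) (v (i, y)) i y) y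

/-- `v` satisfies the resolvent equation for the minimised Hamiltonian, where entering the state `j`
is worth `A v j`. -/
def IsOptimalValue (lam : ℕ → ℕ → ℝ → U → ℝ) (c : ℕ → ℝ → U → ℝ) (Lam α : ℝ)
    (A : (ℕ × ℝ →ᵇ ℝ) → ℕ → ℝ) (v : ℕ × ℝ →ᵇ ℝ) : Prop :=
  ∀ i y, 0 ≤ y → v (i, y) = resolvent (α + Lam)
    (fun y => minHamiltonian lam c Lam (A v) (v (i, y)) i y) y

variable {lam : ℕ → ℕ → ℝ → U → ℝ} {Lam : ℝ} {c : ℕ → ℝ → U → ℝ} {C : ℝ} {u : Control U}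
  {α : ℝ} {A : (ℕ × ℝ →ᵇ ℝ) → ℕ → ℝ} {v w : ℕ × ℝ →ᵇ ℝ}

theorem Control.measurable_action (u : Control U) (i : ℕ) : Measurable (u.1 i) :=
  u.2.comp measurable_prodMk_left

theorem measurable_section (v : ℕ × ℝ →ᵇ ℝ) (i : ℕ) : Measurable fun y => v (i, y) :=
  v.continuous.measurable.comp measurable_prodMk_left

theorem exists_policy_fixedPoint (h : BoundedRates lam Lam) (hLam : 0 ≤ Lam)
    (hc : BoundedCost c C) (hα : 0 < α) (u : Control U) (hA : IsEntryValue A) :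
    ∃ v : ℕ × ℝ →ᵇ ℝ, ∀ i y, v (i, y) = resolvent (α + Lam)
      (fun y => averageHamiltonian lam c Lam (u.1 i) (A v) (v (i, y)) i y) y := by
  refine exists_resolvent_fixedPoint hLam (by linarith : Lam < α + Lam)
    (fun v x => averageHamiltonian lam c Lam (u.1 x.1) (A v) (v x) x.1 x.2) (fun v i => ?_)
    (fun v => ?_) fun v w x => ?_
  · obtain ⟨K, hK, -⟩ := hA.exists_bound v
    exact measurable_averageHamiltonian h hc (u.measurable_action i) i hK (measurable_section v i)
  · obtain ⟨K, hK, hvK⟩ := hA.exists_bound v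
    exact ⟨C + Lam * K, fun x => abs_averageHamiltonian_le h hc _ _ _ hK (hvK x)⟩
  · obtain ⟨K, hK⟩ := hA.bounded v
    obtain ⟨K', hK'⟩ := hA.bounded w
    exact averageHamiltonian_sub_le h hc _ _ _ hK hK'
      (hA.sub_le v w _ dist_nonneg fun i y _ => sub_le_dist v w _) (sub_le_dist v w x)

theorem IsPolicyValue.le (h : BoundedRates lam Lam) (hLam : 0 ≤ Lam) (hc : BoundedCost c C)
    (hα : 0 < α) (hA : IsEntryValue A) (hv : IsPolicyValue lam c Lam α u A v)
    (hw : IsPolicyValue lam c Lam α u A w) (i : ℕ) {y : ℝ} (hy : 0 ≤ y) :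
    v (i, y) ≤ w (i, y) := by
  obtain ⟨K, hK, hvK⟩ := hA.exists_bound v
  obtain ⟨K', hK', hwK⟩ := hA.exists_bound w
  exact le_of_resolvent_eq
    (q := fun x => averageHamiltonian lam c Lam (u.1 x.1) (A v) (v x) x.1 x.2)
    (q' := fun x => averageHamiltonian lam c Lam (u.1 x.1) (A w) (w x) x.1 x.2) hLam
    (by linarith : Lam < α + Lam)
    (fun i => measurable_averageHamiltonian h hc (u.measurable_action i) i hK
      (measurable_section v i))
    (fun x => abs_averageHamiltonian_le h hc _ _ _ hK (hvK x))
    (fun i => measurable_averageHamiltonian h hc (u.measurable_action i) i hK'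
      (measurable_section w i))
    (fun x => abs_averageHamiltonian_le h hc _ _ _ hK' (hwK x)) hv hw
    (fun D hD hle i y hy => averageHamiltonian_sub_le h hc _ _ _ hK hK' (hA.sub_le v w D hD hle)
      (hle i y hy)) i hy

theorem IsPolicyValue.eq (h : BoundedRates lam Lam) (hLam : 0 ≤ Lam) (hc : BoundedCost c C)
    (hα : 0 < α) (hA : IsEntryValue A) (hv : IsPolicyValue lam c Lam α u A v)
    (hw : IsPolicyValue lam c Lam α u A w) (i : ℕ) {y : ℝ} (hy : 0 ≤ y) :
    v (i, y) = w (i, y) :=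
  le_antisymm (hv.le h hLam hc hα hA hw i hy) (hw.le h hLam hc hα hA hv i hy)

variable [Nonempty U]

theorem exists_isOptimalValue (h : BoundedRates lam Lam) (hLam : 0 ≤ Lam)
    (hc : BoundedCost c C) (hα : 0 < α) (hA : IsEntryValue A) :
    ∃ v, IsOptimalValue lam c Lam α A v := by
  obtain ⟨v, hv⟩ := exists_resolvent_fixedPoint hLam (by linarith : Lam < α + Lam)
    (fun v x => minHamiltonian lam c Lam (A v) (v x) x.1 x.2) (fun v i => by
      obtain ⟨K, hK, -⟩ := hA.exists_bound v
      exact measurable_minHamiltonian h hc i hK (measurable_section v i))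
    (fun v => by
      obtain ⟨K, hK, hvK⟩ := hA.exists_bound v
      exact ⟨C + Lam * K, fun x => abs_minHamiltonian_le h hc _ _ hK (hvK x)⟩)
    (fun v w x => by
      obtain ⟨K, hK⟩ := hA.bounded v
      obtain ⟨K', hK'⟩ := hA.bounded w
      exact minHamiltonian_sub_le h hc _ _ hK hK'
        (hA.sub_le v w _ dist_nonneg fun i y _ => sub_le_dist v w _) (sub_le_dist v w x))
  exact ⟨v, fun i y _ => hv i y⟩

theorem IsOptimalValue.le (h : BoundedRates lam Lam) (hLam : 0 ≤ Lam) (hc : BoundedCost c C)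
    (hα : 0 < α) (hA : IsEntryValue A) (hv : IsOptimalValue lam c Lam α A v)
    (hw : IsOptimalValue lam c Lam α A w) (i : ℕ) {y : ℝ} (hy : 0 ≤ y) :
    v (i, y) ≤ w (i, y) := by
  obtain ⟨K, hK, hvK⟩ := hA.exists_bound v
  obtain ⟨K', hK', hwK⟩ := hA.exists_bound w
  exact le_of_resolvent_eq (q := fun x => minHamiltonian lam c Lam (A v) (v x) x.1 x.2)
    (q' := fun x => minHamiltonian lam c Lam (A w) (w x) x.1 x.2) hLam
    (by linarith : Lam < α + Lam)
    (fun i => measurable_minHamiltonian h hc i hK (measurable_section v i))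
    (fun x => abs_minHamiltonian_le h hc _ _ hK (hvK x))
    (fun i => measurable_minHamiltonian h hc i hK' (measurable_section w i))
    (fun x => abs_minHamiltonian_le h hc _ _ hK' (hwK x)) hv hw
    (fun D hD hle i y hy => minHamiltonian_sub_le h hc _ _ hK hK' (hA.sub_le v w D hD hle)
      (hle i y hy)) i hy

theorem IsOptimalValue.eq (h : BoundedRates lam Lam) (hLam : 0 ≤ Lam) (hc : BoundedCost c C)
    (hα : 0 < α) (hA : IsEntryValue A) (hv : IsOptimalValue lam c Lam α A v)
    (hw : IsOptimalValue lam c Lam α A w) (i : ℕ) {y : ℝ} (hy : 0 ≤ y) :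
    v (i, y) = w (i, y) :=
  le_antisymm (hv.le h hLam hc hα hA hw i hy) (hw.le h hLam hc hα hA hv i hy)

theorem IsOptimalValue.le_policy (h : BoundedRates lam Lam) (hLam : 0 ≤ Lam)
    (hc : BoundedCost c C) (hα : 0 < α) (hA : IsEntryValue A)
    (hv : IsOptimalValue lam c Lam α A v) (hw : IsPolicyValue lam c Lam α u A w) (i : ℕ) {y : ℝ}
    (hy : 0 ≤ y) : v (i, y) ≤ w (i, y) := by
  obtain ⟨K, hK, hvK⟩ := hA.exists_bound v
  obtain ⟨K', hK', hwK⟩ := hA.exists_bound w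
  refine le_of_resolvent_eq (q := fun x => minHamiltonian lam c Lam (A v) (v x) x.1 x.2)
    (q' := fun x => averageHamiltonian lam c Lam (u.1 x.1) (A w) (w x) x.1 x.2) hLam
    (by linarith : Lam < α + Lam)
    (fun i => measurable_minHamiltonian h hc i hK (measurable_section v i))
    (fun x => abs_minHamiltonian_le h hc _ _ hK (hvK x))
    (fun i => measurable_averageHamiltonian h hc (u.measurable_action i) i hK'
      (measurable_section w i))
    (fun x => abs_averageHamiltonian_le h hc _ _ _ hK' (hwK x)) hv hw
    (fun D hD hle i y hy => ?_) i hy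
  have h1 := minHamiltonian_sub_le h hc i y hK hK' (hA.sub_le v w D hD hle) (hle i y hy)
  have h2 := minHamiltonian_le_average h hc (u.1 i) i hK' (w (i, y)) y
  linarith

/-- A measurable choice of minimisers of the Hamiltonian is a control attaining the optimal
value. -/
theorem IsOptimalValue.exists_isPolicyValue (h : BoundedRates lam Lam) (hc : BoundedCost c C)
    (hA : IsEntryValue A) (hv : IsOptimalValue lam c Lam α A v) :
    ∃ r : ℕ → Action U, IsPolicyValue lam c Lam α (controlOfActions r) A v := by
  obtain ⟨K, hK, -⟩ := hA.exists_bound v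
  choose r hr using fun i =>
    exists_action_averageHamiltonian_eq_min h hc i hK (measurable_section v i)
  refine ⟨r, fun i y hy => (hv i y hy).trans (resolvent_congr fun y' hy' => ?_)⟩
  exact (hr i y' (hy.trans hy')).symm

end Values

/-! ### Costs of controls and the optimality equation as values -/

section Optimality

variable {U : Type*} [MetricSpace U] [CompactSpace U] [MeasurableSpace U] [BorelSpace U]
  {lam : ℕ → ℕ → ℝ → U → ℝ} {Lam : ℝ} {c : ℕ → ℝ → U → ℝ} {C : ℝ} {u : Control U}
  {α : ℝ} {v w : ℕ × ℝ →ᵇ ℝ}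
  {Ω : Type*} [MeasurableSpace Ω] {P : Measure Ω} [IsProbabilityMeasure P]
  {N : Ω → Measure (ℝ × ℝ)}

/-- The averaged Hamiltonian is the running cost plus the value after the points of the noise. -/
theorem averageHamiltonian_eq_policyCost_add (h : BoundedRates lam Lam) (hLam : 0 ≤ Lam)
    (hc : BoundedCost c C) (u : Control U) (v : ℕ × ℝ →ᵇ ℝ) (i : ℕ) (y : ℝ) :
    averageHamiltonian lam c Lam (u.1 i) (fun j => v (j, 0)) (v (i, y)) i y =
      policyCost c u i y + pointValue lam Lam u v (i, y) := by
  have hK : ∀ x, |v x| ≤ ‖v‖ := v.norm_coe_le_norm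
  have h0 : (0 : ℝ) ≤ max y 0 := le_max_right _ _
  have h1 := h.hasSum_relaxedRate_mul i h0 (u.1 i (max y 0)) (fun j => hK (j, 0))
  have h2 := (h.hasSum_relaxedRate i h0 (u.1 i (max y 0))).mul_right (v (i, y))
  have h3 := h1.sub h2
  simp only [← mul_sub] at h3
  rw [pointValue, h.integral_postJump hLam u (i, y) v.continuous.measurable hK,
    averageHamiltonian_eq h hc (u.1 i) i (fun j => hK (j, 0)), h1.tsum_eq]
  simp only [policyRate, policyCost]
  rw [h3.tsum_eq]
  ring

/-- The cost of every solution is the value of the control. -/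
theorem processCost_eq_value (hN : IsPoissonRandomMeasure P N noiseIntensity)
    (h : BoundedRates lam Lam) (hLam : 0 ≤ Lam) (hc : BoundedCost c C) (hC : 0 ≤ C) (hα : 0 < α)
    (hv : ∀ i y, v (i, y) = resolvent (α + Lam)
      (fun y => averageHamiltonian lam c Lam (u.1 i) (fun j => v (j, 0)) (v (i, y)) i y) y)
    {i : ℕ} {X : ℝ → Ω → ℕ} {Y : ℝ → Ω → ℝ} (hs : IsSolution P N lam u i 0 X Y) :
    processCost P c α u X Y = v (i, 0) := by
  have hK : ∀ x, |v x| ≤ ‖v‖ := v.norm_coe_le_norm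
  have hB : 0 ≤ C + Lam * ‖v‖ := by positivity
  refine processCost_eq hN h hLam hc hC hα v.continuous.measurable hK
    (L := 2 * (C + Lam * ‖v‖)) (by positivity) (fun i y y' => ?_) (fun i y => ?_) hs
  · rw [hv i y, hv i y']
    exact abs_resolvent_sub_le (by linarith) (measurable_averageHamiltonian h hc
      (u.measurable_action i) i (fun j => hK (j, 0)) (measurable_section v i))
      (fun y => abs_averageHamiltonian_le h hc _ _ _ (fun j => hK (j, 0)) (hK _)) y y'
  · simp_rw [← averageHamiltonian_eq_policyCost_add h hLam hc u v]
    exact hv i y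

theorem discountedCost_eq_value (hN : IsPoissonRandomMeasure P N noiseIntensity)
    (h : BoundedRates lam Lam) (hLam : 0 ≤ Lam) (hc : BoundedCost c C) (hC : 0 ≤ C) (hα : 0 < α)
    (hv : ∀ i y, v (i, y) = resolvent (α + Lam)
      (fun y => averageHamiltonian lam c Lam (u.1 i) (fun j => v (j, 0)) (v (i, y)) i y) y)
    (i : ℕ) : discountedCost P N lam c α u i = v (i, 0) := by
  obtain ⟨X, Y, hs⟩ := exists_isSolution hN h u i
  have hex : ∃ Z : (ℝ → Ω → ℕ) × (ℝ → Ω → ℝ), IsSolution P N lam u i 0 Z.1 Z.2 := ⟨(X, Y), hs⟩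
  rw [discountedCost, dif_pos hex]
  exact processCost_eq_value hN h hLam hc hC hα hv hex.choose_spec

/-- The right-hand sides of the optimality equation, for the actions `r i`, are attained by a
common function of state and age. -/
theorem exists_frozen_value (h : BoundedRates lam Lam) (hLam : 0 ≤ Lam) (hc : BoundedCost c C)
    (hα : 0 < α) {m : ℝ} (hm : 0 < m) (hlow : ∀ i y, 0 ≤ y → ∀ u, m ≤ exitRate lam i y u)
    {φ : ℕ → ℝ} {K : ℝ} (hφ : ∀ j, |φ j| ≤ K) (r : ℕ → Action U) :
    ∃ w : ℕ × ℝ →ᵇ ℝ, (∀ i y, w (i, y) = resolvent (α + Lam)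
      (fun y => averageHamiltonian lam c Lam (r i).1 φ (w (i, y)) i y) y) ∧
      ∀ i, bellman lam c α φ i (r i) = w (i, 0) := by
  obtain ⟨w, hw⟩ := exists_policy_fixedPoint h hLam hc hα (controlOfActions r)
    (isEntryValue_const hφ)
  refine ⟨w, hw, fun i => ?_⟩
  exact bellman_eq_of_resolvent_eq h hc hα hm hlow i (r i) hφ (w := fun y => w (i, y))
    (measurable_section w i) (fun y => w.norm_coe_le_norm (i, y)) (hw i)

variable [Nonempty U]

/-- With the values `φ` of the states entered held fixed, the minimised resolvent equation gives the
minimum in the optimality equation. -/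
theorem isLeast_bellman (h : BoundedRates lam Lam) (hLam : 0 ≤ Lam) (hc : BoundedCost c C)
    (hα : 0 < α) {m : ℝ} (hm : 0 < m) (hlow : ∀ i y, 0 ≤ y → ∀ u, m ≤ exitRate lam i y u)
    {φ : ℕ → ℝ} {K : ℝ} (hφ : ∀ j, |φ j| ≤ K)
    (hv : IsOptimalValue lam c Lam α (fun _ => φ) v) (i : ℕ) :
    IsLeast (range (bellman lam c α φ i)) (v (i, 0)) := by
  have hA := isEntryValue_const hφ
  constructor
  · obtain ⟨r, hr⟩ := hv.exists_isPolicyValue h hc hA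
    obtain ⟨w, hw, hwb⟩ := exists_frozen_value h hLam hc hα hm hlow hφ r
    refine ⟨r i, (hwb i).trans ?_⟩
    have hw' : IsPolicyValue lam c Lam α (controlOfActions r) (fun _ => φ) w :=
      fun i y _ => hw i y
    exact hw'.eq h hLam hc hα hA hr i le_rfl
  · rintro _ ⟨r, rfl⟩
    obtain ⟨w, hw, hwb⟩ := exists_frozen_value h hLam hc hα hm hlow hφ fun _ => r
    rw [hwb i]
    have hw' : IsPolicyValue lam c Lam α (controlOfActions fun _ => r) (fun _ => φ) w :=
      fun i y _ => hw i y
    exact hv.le_policy h hLam hc hα hA hw' i le_rfl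

/-- The optimal value at age `0` is the only bounded solution of the optimality equation. -/
theorem IsOptimalValue.solves_iff (h : BoundedRates lam Lam) (hLam : 0 ≤ Lam)
    (hc : BoundedCost c C) (hα : 0 < α) {m : ℝ} (hm : 0 < m)
    (hlow : ∀ i y, 0 ≤ y → ∀ u, m ≤ exitRate lam i y u)
    (hv : IsOptimalValue lam c Lam α (fun v j => v (j, 0)) v) {φ : ℕ → ℝ} {K : ℝ}
    (hφ : ∀ j, |φ j| ≤ K) :
    SolvesOptimalityEquation lam c α φ ↔ φ = fun i => v (i, 0) := by
  constructor
  · intro hs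
    obtain ⟨w, hw⟩ := exists_isOptimalValue h hLam hc hα (isEntryValue_const hφ)
    have hwφ : φ = fun i => w (i, 0) := funext fun i =>
      (hs i).unique (isLeast_bellman h hLam hc hα hm hlow hφ hw i)
    have hw' : IsOptimalValue lam c Lam α (fun v j => v (j, 0)) w := by
      intro i y hy
      have := hw i y hy
      rwa [hwφ] at this
    rw [hwφ]
    exact funext fun i => hw'.eq h hLam hc hα isEntryValue_zero_age hv i le_rfl
  · rintro rfl i
    exact isLeast_bellman h hLam hc hα hm hlow hφ hv i

theorem IsOptimalValue.valueFunction_eq (hN : IsPoissonRandomMeasure P N noiseIntensity)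
    (h : BoundedRates lam Lam) (hLam : 0 ≤ Lam) (hc : BoundedCost c C) (hC : 0 ≤ C) (hα : 0 < α)
    (hv : IsOptimalValue lam c Lam α (fun v j => v (j, 0)) v) (i : ℕ) :
    valueFunction P N lam c α i = v (i, 0) := by
  have hA := isEntryValue_zero_age
  have hle : ∀ u : Control U, v (i, 0) ≤ discountedCost P N lam c α u i := fun u => by
    obtain ⟨w, hw⟩ := exists_policy_fixedPoint h hLam hc hα u hA
    rw [discountedCost_eq_value hN h hLam hc hC hα hw]
    have hw' : IsPolicyValue lam c Lam α u (fun v j => v (j, 0)) w := fun i y _ => hw i y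
    exact hv.le_policy h hLam hc hα hA hw' i le_rfl
  obtain ⟨r, hr⟩ := hv.exists_isPolicyValue h hc hA
  obtain ⟨w, hw⟩ := exists_policy_fixedPoint h hLam hc hα (controlOfActions r) hA
  have hw' : IsPolicyValue lam c Lam α (controlOfActions r) (fun v j => v (j, 0)) w :=
    fun i y _ => hw i y
  have hr' : discountedCost P N lam c α (controlOfActions r) i = v (i, 0) :=
    (discountedCost_eq_value hN h hLam hc hC hα hw i).trans
      (hw'.eq h hLam hc hα hA hr i le_rfl)
  have : Nonempty (Control U) := ⟨controlOfActions r⟩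
  exact le_antisymm (hr' ▸ ciInf_le ⟨v (i, 0), by rintro _ ⟨u, rfl⟩; exact hle u⟩ _)
    (le_ciInf hle)

end Optimality

end AgeControl

theorem mainTheorem1
    {U : Type*} [MetricSpace U] [CompactSpace U] [Nonempty U] [MeasurableSpace U] [BorelSpace U]
    {Ω : Type*} [MeasurableSpace Ω] (P : Measure Ω) [IsProbabilityMeasure P]
    (N : Ω → Measure (ℝ × ℝ))
    (hN : AgeControl.IsPoissonRandomMeasure P N AgeControl.noiseIntensity)
    (lam : ℕ → ℕ → ℝ → U → ℝ) (c : ℕ → ℝ → U → ℝ) (α : ℝ) (hα : 0 < α)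
    (hlam : ∀ i j, i ≠ j → ∀ y, 0 ≤ y → ∀ u, 0 ≤ lam i j y u)
    (hc : ∀ i y, 0 ≤ y → ∀ u, 0 ≤ c i y u)
    -- (A1)
    (hA1 : ∃ M : ℝ, ∀ i y, 0 ≤ y → ∀ u, AgeControl.exitRate lam i y u ≤ M)
    -- (A2)
    (hA2 : ∃ m : ℝ, 0 < m ∧ ∀ i y, 0 ≤ y → ∀ u, m ≤ AgeControl.exitRate lam i y u)
    -- (A3)
    (hA3_cont : ∀ i j, i ≠ j →
      ContinuousOn (fun p : ℝ × U => lam i j p.1 p.2) (Ici 0 ×ˢ univ))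
    (hA3_unif : ∀ i, TendstoUniformlyOn
      (fun (n : ℕ) (p : ℝ × U) => ∑ j ∈ (Finset.range n).filter (· ≠ i), lam i j p.1 p.2)
      (fun p : ℝ × U => AgeControl.exitRate lam i p.1 p.2) atTop (Ici 0 ×ˢ univ))
    -- (A4)
    (hA4_age : ∀ i u, ContinuousOn (fun y => c i y u) (Ici 0))
    (hA4_action : ∀ i y, 0 ≤ y → Continuous (c i y))
    (hA4_bdd : ∃ C : ℝ, ∀ i y, 0 ≤ y → ∀ u, c i y u ≤ C) :
    -- the controlled processes exist and the discounted costs are well defined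
    (∀ (u : AgeControl.Control U) (i : ℕ),
      (∃ X Y, AgeControl.IsSolution P N lam u i 0 X Y) ∧
      ∀ X Y, AgeControl.IsSolution P N lam u i 0 X Y →
        AgeControl.processCost P c α u X Y = AgeControl.discountedCost P N lam c α u i) ∧
    -- the value function is a bounded solution of the optimality equation
    (∃ K : ℝ, ∀ i, |AgeControl.valueFunction P N lam c α i| ≤ K) ∧
    AgeControl.SolvesOptimalityEquation lam c α (AgeControl.valueFunction P N lam c α) ∧
    -- and the only one
    (∀ φ : ℕ → ℝ, (∃ K : ℝ, ∀ i, |φ i| ≤ K) → AgeControl.SolvesOptimalityEquation lam c α φ →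
      φ = AgeControl.valueFunction P N lam c α) ∧
    -- minimisers of the right-hand side exist
    (∀ i, ∃ r : AgeControl.Action U, ∀ r' : AgeControl.Action U,
      AgeControl.bellman lam c α (AgeControl.valueFunction P N lam c α) i r ≤
        AgeControl.bellman lam c α (AgeControl.valueFunction P N lam c α) i r') ∧
    -- and give an optimal control
    (∀ r : ℕ → AgeControl.Action U,
      (∀ i, ∀ r' : AgeControl.Action U,
        AgeControl.bellman lam c α (AgeControl.valueFunction P N lam c α) i (r i) ≤
          AgeControl.bellman lam c α (AgeControl.valueFunction P N lam c α) i r') →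
      ∀ i, AgeControl.discountedCost P N lam c α (AgeControl.controlOfActions r) i =
        AgeControl.valueFunction P N lam c α i) := by
  obtain ⟨M, hM⟩ := hA1
  obtain ⟨m, hm, hlow⟩ := hA2
  obtain ⟨C, hC⟩ := hA4_bdd
  obtain ⟨a⟩ := ‹Nonempty U›
  have : Nonempty U := ⟨a⟩
  have hM0 : 0 ≤ M := hm.le.trans ((hlow 0 0 le_rfl a).trans (hM 0 0 le_rfl a))
  have hC0 : 0 ≤ C := (hc 0 0 le_rfl a).trans (hC 0 0 le_rfl a)
  have h : AgeControl.BoundedRates lam M := ⟨hlam, hA3_cont, hA3_unif, hM⟩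
  have hcost : AgeControl.BoundedCost c C := ⟨hc, hA4_age, hA4_action, hC⟩
  have hA := AgeControl.isEntryValue_zero_age
  obtain ⟨v, hv⟩ := AgeControl.exists_isOptimalValue h hM0 hcost hα hA
  have hV : AgeControl.valueFunction P N lam c α = fun i => v (i, 0) :=
    funext fun i => hv.valueFunction_eq hN h hM0 hcost hC0 hα i
  have hVb : ∀ i, |v (i, 0)| ≤ ‖v‖ := fun i => v.norm_coe_le_norm (i, 0)
  have hsolves : AgeControl.SolvesOptimalityEquation lam c α fun i => v (i, 0) :=
    (hv.solves_iff h hM0 hcost hα hm hlow hVb).2 rfl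
  rw [hV]
  refine ⟨fun u i => ⟨AgeControl.exists_isSolution hN h u i, fun X Y hs => ?_⟩, ⟨‖v‖, hVb⟩,
    hsolves, fun φ ⟨K, hφ⟩ hs => (hv.solves_iff h hM0 hcost hα hm hlow hφ).1 hs, fun i => ?_,
    fun r hr i => ?_⟩
  · obtain ⟨w, hw⟩ := AgeControl.exists_policy_fixedPoint h hM0 hcost hα u hA
    rw [AgeControl.processCost_eq_value hN h hM0 hcost hC0 hα hw hs,
      AgeControl.discountedCost_eq_value hN h hM0 hcost hC0 hα hw]
  · obtain ⟨⟨r, hr⟩, hmin⟩ := hsolves i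
    exact ⟨r, fun r' => hr.trans_le (hmin ⟨r', rfl⟩)⟩
  · obtain ⟨w, hw, hwb⟩ := AgeControl.exists_frozen_value h hM0 hcost hα hm hlow hVb r
    have hwv : (fun j => v (j, 0)) = fun j => w (j, 0) := funext fun j => by
      obtain ⟨⟨r', hr'⟩, hmin⟩ := hsolves j
      rw [← hwb j]
      exact le_antisymm (hmin ⟨r j, rfl⟩) ((hr j r').trans hr'.le)
    -- entering `j` is worth the same under `w` as under `v`, hence `w` is the value of the control
    rw [AgeControl.discountedCost_eq_value hN h hM0 hcost hC0 hα (v := w) (by rwa [hwv] at hw)]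
    exact (congrFun hwv i).symm
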